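/- Conventions. $\mathbb Z/2$-graded objects are called super; $|x|$ is the parity of a homogeneous element $x$. For a Lie superalgebra $\mathfrak g=\mathfrak g_0\oplus\mathfrak g_1$ over a field $k$ of characteristic $0$, $\mathcal U(\mathfrak g)$ is its universal enveloping superalgebra, generated by $\mathfrak g$ with the relations $XY-(-1)^{|X||Y|}YX=[X,Y]$; it is a left $\mathcal U(\mathfrak g_0)$-module by left multiplication and a supercoalgebra, with coproduct the morphism of superalgebras $\Delta$ such that $\Delta X=X\otimes 1+1\otimes X$ for $X\in\mathfrak g$. The exterior algebra $\wedge(\mathfrak g_1)$ is likewise a superalgebra and a supercoalgebra, with $\Delta v=v\otimes 1+1\otimes v$ for $v\in\mathfrak g_1$. If $C$ is one of these two supercoalgebras and $R$ is a commutative (purely even) algebra, linear maps $C\to R$ are multiplied by $f_1\cdot f_2=m_R\circ(f_1\otimes f_2)\circ\Delta$, where $(f_1\otimes f_2)(a\otimes b)=(-1)^{|f_2||a|}f_1(a)f_2(b)$; a map has parity $i$ if it vanishes on the part of $C$ of parity $i+1$. In particular $\wedge(\mathfrak g_1)^*=\mathrm{Hom}(\wedge(\mathfrak g_1),k)$ is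 a superalgebra. A super Harish-Chandra pair $(G_0,\mathfrak g)$ consists of a group $G_0$ and a finite-dimensional Lie superalgebra $\mathfrak g$ over a field $k$ of characteristic $0$, where $G_0$ is either an analytic Lie group over $k$ (with $k$ a complete nontrivially normed field, for instance $\mathbb R$ or $\mathbb C$) or an affine algebraic group over $k$, together with an isomorphism of Lie algebras $\mathfrak g_0\cong\mathrm{Lie}(G_0)$ and an (analytic, respectively algebraic) action of $G_0$ on $\mathfrak g$ by automorphisms of the Lie superalgebra, which restricts to the adjoint action on $\mathfrak g_0$ and whose differential is the bracket $\mathfrak g_0\times\mathfrak g\to\mathfrak g$. Let $\mathcal O_{G_0}$ be the sheaf of analytic (respectively regular) functions on $G_0$, on which $\mathcal U(\mathfrak g_0)$ acts by left invariant differential operators. For $U\subseteq G_0$ open, $\mathcal O_G(U)=\mathrm{Hom}_{\mathcal U(\mathfrak g_0)}(\mathcal U(\mathfrak g),\mathcal O_{G_0}(U))$ is the superalgebra of the $\mathcal U(\mathfrak g_0)$-linear maps $\mathcal U(\mathfrak g)\to\mathcal O_{G_0}(U)$ with the product above; its restriction maps are composition with those of $\mathcal O_{G_0}$. Theorem. (1)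 Let $\mathfrak g$ be a Lie superalgebra over a field of characteristic $0$, and let $\gamma:\wedge(\mathfrak g_1)\to\mathcal U(\mathfrak g)$ be the linear map $$X_1\wedge\dots\wedge X_p\mapsto\frac1{p!}\sum_{\tau\in S_p}(-1)^{|\tau|}X_{\tau(1)}\cdots X_{\tau(p)} .$$ Then $\widehat\gamma:\mathcal U(\mathfrak g_0)\otimes\wedge(\mathfrak g_1)\to\mathcal U(\mathfrak g)$, $X\otimes Y\mapsto X\cdot\gamma(Y)$, is an isomorphism of left $\mathcal U(\mathfrak g_0)$-modules that identifies the homogeneous parts of each parity. (2) Let $(G_0,\mathfrak g)$ be an analytic or algebraic super Harish-Chandra pair. For each open $U\subseteq G_0$ there are isomorphisms of superalgebras $$\mathcal O_G(U)\simeq\mathrm{Hom}\big(\wedge(\mathfrak g_1),\mathcal O_{G_0}(U)\big)\simeq\mathcal O_{G_0}(U)\otimes\wedge(\mathfrak g_1)^*,$$ compatible with the restriction maps; the first is $f\mapsto f\circ\gamma$, and the inverse of the second is $r\otimes\eta\mapsto(Y\mapsto\eta(Y)\,r)$. Hence $\mathcal O_G$ carries a $\mathbb Z$-gradation: $\mathcal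 O_G(U)$ is a $\mathbb Z$-graded algebra, where $f$ has degree $n$ if and only if $f\circ\gamma$ vanishes on $\wedge^m(\mathfrak g_1)$ for all $m\neq n$; elements of degree $n$ have parity $n\bmod 2$, and restriction maps preserve degrees. -/

import Mathlib

open scoped TensorProduct DirectSum

set_option linter.unusedSectionVars false

noncomputable section

section Graded

variable {k : Type*} [Field k] {C : Type*} [AddCommGroup C] [Module k C]
  (𝒞 : ZMod 2 → Submodule k C) [DirectSum.Decomposition 𝒞]

/-- The projection of a `ℤ/2`-graded vector space onto its component of parity `i`. -/
def gradedProj (i : ZMod 2) : C →ₗ[k] 𝒞 i :=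
  DirectSum.component k _ _ i ∘ₗ (DirectSum.decomposeLinearEquiv 𝒞).toLinearMap

lemma gradedProj_of_mem {i : ZMod 2} {x : C} (hx : x ∈ 𝒞 i) :
    (gradedProj 𝒞 i x : C) = x :=
  DirectSum.decompose_of_mem_same 𝒞 hx

lemma gradedProj_of_ne {i j : ZMod 2} {x : C} (hx : x ∈ 𝒞 i) (h : i ≠ j) :
    (gradedProj 𝒞 j x : C) = 0 :=
  DirectSum.decompose_of_mem_ne 𝒞 hx h

lemma gradedProj_add (x : C) : (gradedProj 𝒞 0 x : C) + gradedProj 𝒞 1 x = x := by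
  induction x using DirectSum.Decomposition.inductionOn 𝒞 with
  | zero => simp
  | add x y hx hy =>
    rw [map_add, map_add]
    conv_rhs => rw [← hx, ← hy]
    push_cast
    abel
  | homogeneous x =>
    rename_i i
    have : i = 0 ∨ i = 1 := (by decide : ∀ i : ZMod 2, i = 0 ∨ i = 1) i
    rcases this with rfl | rfl
    · rw [gradedProj_of_mem 𝒞 x.2, gradedProj_of_ne 𝒞 x.2 (by decide), add_zero]
    · rw [gradedProj_of_mem 𝒞 x.2, gradedProj_of_ne 𝒞 x.2 (by decide), zero_add]

end Graded

/-- A Lie superalgebra over a field `k` of characteristic zero: a `ℤ/2`-graded vector space with an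
even bilinear bracket which is super skew-symmetric and satisfies the super Jacobi identity. -/
class LieSuperalgebra (k : Type*) [Field k] (𝔤 : Type*) [AddCommGroup 𝔤] [Module k 𝔤] where
  gr : ZMod 2 → Submodule k 𝔤
  decomposition : DirectSum.Decomposition gr
  bracket : 𝔤 →ₗ[k] 𝔤 →ₗ[k] 𝔤
  bracket_mem : ∀ {i j : ZMod 2} {x y : 𝔤}, x ∈ gr i → y ∈ gr j → bracket x y ∈ gr (i + j)
  bracket_skew : ∀ {i j : ZMod 2} {x y : 𝔤}, x ∈ gr i → y ∈ gr j →
    bracket x y = -((-1 : ℤˣ) ^ (i * j) • bracket y x)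
  jacobi : ∀ {i j : ZMod 2} {x y : 𝔤} (z : 𝔤), x ∈ gr i → y ∈ gr j →
    bracket x (bracket y z) =
      bracket (bracket x y) z + (-1 : ℤˣ) ^ (i * j) • bracket y (bracket x z)

section LieSuper

variable (k : Type*) [Field k] (𝔤 : Type*) [AddCommGroup 𝔤] [Module k 𝔤] [LieSuperalgebra k 𝔤]

/-- The homogeneous part `𝔤_i` of a Lie superalgebra. -/
abbrev superPart (i : ZMod 2) : Submodule k 𝔤 := LieSuperalgebra.gr (k := k) (𝔤 := 𝔤) i

/-- The bracket of a Lie superalgebra. -/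
abbrev superBracket : 𝔤 →ₗ[k] 𝔤 →ₗ[k] 𝔤 := LieSuperalgebra.bracket

instance : DirectSum.Decomposition (superPart k 𝔤) := LieSuperalgebra.decomposition

variable [CharZero k]

/-- The even part `𝔤₀` is a Lie algebra. -/
instance : LieRing (superPart k 𝔤 0) where
  bracket x y := ⟨superBracket k 𝔤 x y, by
    simpa using LieSuperalgebra.bracket_mem x.2 y.2⟩
  add_lie x y z := by ext; simp
  lie_add x y z := by ext; simp
  lie_self x := by
    ext
    have h := LieSuperalgebra.bracket_skew x.2 x.2
    simp only [mul_zero, uzpow_zero, one_smul] at h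
    have h2 : (2 : k) • superBracket k 𝔤 (x : 𝔤) x = 0 := by
      rw [two_smul]; exact eq_neg_iff_add_eq_zero.mp h
    simpa using h2
  leibniz_lie x y z := by
    ext
    simpa using LieSuperalgebra.jacobi (z : 𝔤) x.2 y.2

instance : LieAlgebra k (superPart k 𝔤 0) where
  lie_smul c x y := by ext; simp [Bracket.bracket]

end LieSuper

section UEA

variable (k : Type*) [Field k] (𝔤 : Type*) [AddCommGroup 𝔤] [Module k 𝔤] [LieSuperalgebra k 𝔤]

/-- The defining relations of the universal enveloping superalgebra,
`x y - (-1)^{|x||y|} y x = [x, y]` for homogeneous `x` and `y`. -/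
inductive SuperUEA.Rel : TensorAlgebra k 𝔤 → TensorAlgebra k 𝔤 → Prop
  | mk (i j : ZMod 2) (x y : 𝔤) (hx : x ∈ superPart k 𝔤 i) (hy : y ∈ superPart k 𝔤 j) :
      SuperUEA.Rel (TensorAlgebra.ι k x * TensorAlgebra.ι k y)
        ((-1 : ℤˣ) ^ (i * j) • (TensorAlgebra.ι k y * TensorAlgebra.ι k x) +
          TensorAlgebra.ι k (superBracket k 𝔤 x y))

/-- The universal enveloping superalgebra `U(𝔤)`. -/
def SuperUEA : Type _ := RingQuot (SuperUEA.Rel k 𝔤)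

namespace SuperUEA

instance : Ring (SuperUEA k 𝔤) := inferInstanceAs (Ring (RingQuot (SuperUEA.Rel k 𝔤)))

instance : Algebra k (SuperUEA k 𝔤) :=
  inferInstanceAs (Algebra k (RingQuot (SuperUEA.Rel k 𝔤)))

/-- The canonical map `𝔤 → U(𝔤)`. -/
def ι : 𝔤 →ₗ[k] SuperUEA k 𝔤 :=
  (RingQuot.mkAlgHom k (SuperUEA.Rel k 𝔤)).toLinearMap ∘ₗ TensorAlgebra.ι k

lemma ι_mul_ι {i j : ZMod 2} {x y : 𝔤} (hx : x ∈ superPart k 𝔤 i) (hy : y ∈ superPart k 𝔤 j) :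
    ι k 𝔤 x * ι k 𝔤 y =
      (-1 : ℤˣ) ^ (i * j) • (ι k 𝔤 y * ι k 𝔤 x) + ι k 𝔤 (superBracket k 𝔤 x y) := by
  have h := RingQuot.mkAlgHom_rel k (Rel.mk i j x y hx hy)
  rw [map_mul, map_add, Units.smul_def, map_zsmul, map_mul, ← Units.smul_def] at h
  exact h

variable {𝔤} {A : Type*} [Ring A] [Algebra k A]

/-- The universal property of `U(𝔤)`. -/
def lift (f : 𝔤 →ₗ[k] A)
    (hf : ∀ (i j : ZMod 2) (x y : 𝔤), x ∈ superPart k 𝔤 i → y ∈ superPart k 𝔤 j →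
      f x * f y = (-1 : ℤˣ) ^ (i * j) • (f y * f x) + f (superBracket k 𝔤 x y)) :
    SuperUEA k 𝔤 →ₐ[k] A :=
  RingQuot.liftAlgHom k ⟨TensorAlgebra.lift k f, by
    rintro _ _ ⟨i, j, x, y, hx, hy⟩
    rw [map_mul, map_add, Units.smul_def, map_zsmul, map_mul, ← Units.smul_def]
    simpa using hf i j x y hx hy⟩

lemma lift_ι (f : 𝔤 →ₗ[k] A) (hf) (x : 𝔤) : lift k f hf (ι k 𝔤 x) = f x := by
  simp only [lift, ι]
  erw [RingQuot.liftAlgHom_mkAlgHom_apply]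
  simp

lemma hom_ext {f g : SuperUEA k 𝔤 →ₐ[k] A} (h : ∀ x, f (ι k 𝔤 x) = g (ι k 𝔤 x)) : f = g := by
  apply RingQuot.ringQuot_ext'
  ext x
  exact h x

lemma adjoin_range_ι : Algebra.adjoin k (Set.range (ι k 𝔤)) = ⊤ := by
  have h : Set.range (ι k 𝔤) =
      (RingQuot.mkAlgHom k (SuperUEA.Rel k 𝔤)) '' Set.range (TensorAlgebra.ι k) := by
    rw [← Set.range_comp]; rfl
  rw [h]
  erw [Algebra.adjoin_image, TensorAlgebra.adjoin_range_ι, Algebra.map_top,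
    (AlgHom.range_eq_top _).mpr (RingQuot.mkAlgHom_surjective k (SuperUEA.Rel k 𝔤))]
  rfl

variable (𝔤)

/-- The homogeneous part of `U(𝔤)` of parity `i`, spanned by the products of homogeneous elements
of `𝔤` whose parities add up to `i`. -/
def gr (i : ZMod 2) : Submodule k (SuperUEA k 𝔤) :=
  Submodule.span k {u | ∃ l : List (Σ j : ZMod 2, superPart k 𝔤 j),
    (l.map fun p => p.1).sum = i ∧ u = (l.map fun p => ι k 𝔤 (p.2 : 𝔤)).prod}

lemma ι_mem_gr {i : ZMod 2} {x : 𝔤} (hx : x ∈ superPart k 𝔤 i) : ι k 𝔤 x ∈ gr k 𝔤 i :=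
  Submodule.subset_span ⟨[⟨i, x, hx⟩], by simp, by simp⟩

instance : SetLike.GradedMonoid (gr k 𝔤) where
  one_mem := Submodule.subset_span ⟨[], by simp, by simp⟩
  mul_mem i j x y hx hy := by
    have h := Submodule.mul_mem_mul hx hy
    rw [gr, gr, Submodule.span_mul_span] at h
    refine Submodule.span_mono ?_ h
    rintro _ ⟨_, ⟨l, rfl, rfl⟩, _, ⟨l', rfl, rfl⟩, rfl⟩
    exact ⟨l ++ l', by simp, by simp⟩

/-- The map `𝔤 → ⨁ᵢ U(𝔤)_i` used to split `U(𝔤)` into its homogeneous parts. -/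
def gradedι : 𝔤 →ₗ[k] ⨁ i, gr k 𝔤 i :=
  DirectSum.toModule k (ZMod 2) _ (fun i => DirectSum.lof k (ZMod 2) (fun i => gr k 𝔤 i) i ∘ₗ
    ((ι k 𝔤 ∘ₗ (superPart k 𝔤 i).subtype).codRestrict (gr k 𝔤 i) fun x => ι_mem_gr k 𝔤 x.2)) ∘ₗ
  (DirectSum.decomposeLinearEquiv (superPart k 𝔤)).toLinearMap

lemma gradedι_apply {i : ZMod 2} {x : 𝔤} (hx : x ∈ superPart k 𝔤 i) :
    gradedι k 𝔤 x = DirectSum.of (fun i => gr k 𝔤 i) i ⟨ι k 𝔤 x, ι_mem_gr k 𝔤 hx⟩ := by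
  lift x to superPart k 𝔤 i using hx
  simp only [gradedι, LinearMap.comp_apply, LinearEquiv.coe_coe,
    DirectSum.decomposeLinearEquiv_apply, DirectSum.decompose_coe]
  rw [← DirectSum.lof_eq_of k, DirectSum.toModule_lof, ← DirectSum.lof_eq_of k]
  rfl

lemma gradedι_rel (i j : ZMod 2) (x y : 𝔤) (hx : x ∈ superPart k 𝔤 i)
    (hy : y ∈ superPart k 𝔤 j) :
    gradedι k 𝔤 x * gradedι k 𝔤 y = (-1 : ℤˣ) ^ (i * j) • (gradedι k 𝔤 y * gradedι k 𝔤 x) +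
      gradedι k 𝔤 (superBracket k 𝔤 x y) := by
  rw [gradedι_apply k 𝔤 hx, gradedι_apply k 𝔤 hy,
    gradedι_apply k 𝔤 (LieSuperalgebra.bracket_mem hx hy), DirectSum.of_mul_of,
    DirectSum.of_mul_of]
  have e : (DirectSum.of (fun i => gr k 𝔤 i) (j + i))
      (GradedMonoid.GMul.mul (A := fun i => gr k 𝔤 i)
        ⟨ι k 𝔤 y, ι_mem_gr k 𝔤 hy⟩ ⟨ι k 𝔤 x, ι_mem_gr k 𝔤 hx⟩) =
      DirectSum.of (fun i => gr k 𝔤 i) (i + j) ⟨ι k 𝔤 y * ι k 𝔤 x, by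
        rw [add_comm]
        exact SetLike.mul_mem_graded (ι_mem_gr k 𝔤 hy) (ι_mem_gr k 𝔤 hx)⟩ :=
    DirectSum.of_eq_of_gradedMonoid_eq (Sigma.subtype_ext (add_comm _ _) rfl)
  rw [e, Units.smul_def, ← map_zsmul (DirectSum.of (fun i => gr k 𝔤 i) (i + j)), ← map_add]
  congr 1
  ext
  simpa [Units.smul_def] using! ι_mul_ι k 𝔤 hx hy

/-- The splitting of `U(𝔤)` into its homogeneous parts. -/
def toGraded : SuperUEA k 𝔤 →ₐ[k] ⨁ i, gr k 𝔤 i :=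
  lift k (A := ⨁ i, gr k 𝔤 i) (gradedι k 𝔤) (gradedι_rel k 𝔤)

lemma toGraded_prod (l : List (Σ j : ZMod 2, superPart k 𝔤 j)) :
    toGraded k 𝔤 (l.map fun p => ι k 𝔤 (p.2 : 𝔤)).prod =
      DirectSum.of (fun i => gr k 𝔤 i) (l.map fun p => p.1).sum
        ⟨(l.map fun p => ι k 𝔤 (p.2 : 𝔤)).prod, Submodule.subset_span ⟨l, rfl, rfl⟩⟩ := by
  induction l with
  | nil => simp; rfl
  | cons p l ih =>
    simp only [List.map_cons, List.prod_cons, map_mul, ih]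
    rw [toGraded, lift_ι, gradedι_apply k 𝔤 p.2.2, DirectSum.of_mul_of]
    exact DirectSum.of_eq_of_gradedMonoid_eq (Sigma.subtype_ext rfl rfl)

instance : GradedAlgebra (gr k 𝔤) :=
  GradedAlgebra.ofAlgHom (gr k 𝔤) (toGraded k 𝔤)
    (by
      apply hom_ext
      intro x
      induction x using DirectSum.Decomposition.inductionOn (superPart k 𝔤) with
      | zero => simp
      | add x y hx hy => simp only [map_add, hx, hy]
      | homogeneous x =>
        simp only [AlgHom.comp_apply, toGraded, lift_ι, gradedι_apply k 𝔤 x.2]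
        simp)
    (by
      rintro i ⟨x, hx⟩
      induction hx using Submodule.span_induction with
      | mem x h =>
        obtain ⟨l, rfl, rfl⟩ := h
        exact toGraded_prod k 𝔤 l
      | zero => simp; exact (map_zero _).symm
      | add x y hx hy ihx ihy =>
        dsimp only at ihx ihy ⊢
        rw [map_add, ihx, ihy, ← map_add]; rfl
      | smul c x hx ih =>
        dsimp only at ih ⊢
        rw [map_smul, ih, ← DirectSum.lof_eq_of k, ← map_smul]; rfl)

end SuperUEA

end UEA

section SuperHomBasic

variable {k : Type*} [Field k] {C : Type*} [Ring C] [Algebra k C]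

/-- The linear maps `C → R` from a super (co)algebra `C` to an algebra `R`, where `R` is regarded as
a purely even superalgebra. -/
def SuperHom (_ : ZMod 2 → Submodule k C) (R : Type*) [CommRing R] [Algebra k R] : Type _ :=
  C →ₗ[k] R

namespace SuperHom

variable (𝒞 : ZMod 2 → Submodule k C) {R : Type*} [CommRing R] [Algebra k R]

instance : AddCommGroup (SuperHom 𝒞 R) := inferInstanceAs (AddCommGroup (C →ₗ[k] R))
instance : Module k (SuperHom 𝒞 R) := inferInstanceAs (Module k (C →ₗ[k] R))
instance : FunLike (SuperHom 𝒞 R) C R := inferInstanceAs (FunLike (C →ₗ[k] R) C R)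
instance : LinearMapClass (SuperHom 𝒞 R) k C R :=
  inferInstanceAs (LinearMapClass (C →ₗ[k] R) k C R)

/-- A linear map, regarded as an element of `SuperHom`. -/
def mk (f : C →ₗ[k] R) : SuperHom 𝒞 R := f

variable {𝒞}

/-- The linear map underlying an element of `SuperHom`. -/
def toLin (f : SuperHom 𝒞 R) : C →ₗ[k] R := f

@[simp] lemma mk_apply (f : C →ₗ[k] R) (c : C) : mk 𝒞 f c = f c := rfl
@[simp] lemma toLin_apply (f : SuperHom 𝒞 R) (c : C) : f.toLin c = f c := rfl
@[simp] lemma add_apply (f g : SuperHom 𝒞 R) (c : C) : (f + g) c = f c + g c := rfl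
@[simp] lemma zero_apply (c : C) : (0 : SuperHom 𝒞 R) c = 0 := rfl
@[simp] lemma smul_apply (a : k) (f : SuperHom 𝒞 R) (c : C) : (a • f) c = a • f c := rfl

@[ext] lemma ext {f g : SuperHom 𝒞 R} (h : ∀ c, f c = g c) : f = g := LinearMap.ext h

/-- The elements of parity `i`: since `R` is purely even, these are the maps that vanish on the
homogeneous part of `C` of the other parity. -/
def parity (𝒞 : ZMod 2 → Submodule k C) (R : Type*) [CommRing R] [Algebra k R] (i : ZMod 2) :
    Submodule k (SuperHom 𝒞 R) where
  carrier := {f | ∀ j, j ≠ i → ∀ c ∈ 𝒞 j, f c = 0}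
  add_mem' hf hg j hj c hc := by rw [add_apply, hf j hj c hc, hg j hj c hc, add_zero]
  zero_mem' _ _ _ _ := rfl
  smul_mem' a f hf j hj c hc := by rw [smul_apply, hf j hj c hc, smul_zero]

/-- The map `c ↦ f (s c)`. -/
def shift (s : C) (f : SuperHom 𝒞 R) : SuperHom 𝒞 R := mk 𝒞 (f.toLin ∘ₗ LinearMap.mulLeft k s)

@[simp] lemma shift_apply (s : C) (f : SuperHom 𝒞 R) (c : C) : shift s f c = f (s * c) := rfl

end SuperHom

end SuperHomBasic

section SuperBialgebra

open GradedTensorProduct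

variable {k : Type*} [Field k] {C : Type*} [Ring C] [Algebra k C]
  (𝒞 : ZMod 2 → Submodule k C) [GradedAlgebra 𝒞]

/-- A super bialgebra generated by homogeneous primitive elements: a superalgebra `C` with
superalgebra morphisms `Δ : C → C ⊗ C` (graded tensor product) and `ε : C → k`, generated as an
algebra by homogeneous elements `s` with `Δ s = s ⊗ 1 + 1 ⊗ s` and `ε s = 0`. -/
class PrimitivelyGenerated where
  comul : C →ₐ[k] 𝒞 ᵍ⊗[k] 𝒞
  counit : C →ₐ[k] k
  adjoin_primitive : Algebra.adjoin k {s : C | (∃ i, s ∈ 𝒞 i) ∧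
    comul s = s ᵍ⊗ₜ[k] (1 : C) + (1 : C) ᵍ⊗ₜ[k] s ∧ counit s = 0} = ⊤

/-- The map `c ↦ (-1)^{i|c|} c`. -/
def signTwist (i : ZMod 2) : C →ₗ[k] C :=
  (𝒞 0).subtype ∘ₗ gradedProj 𝒞 0 +
    ((((-1 : ℤˣ) ^ i : ℤˣ) : ℤ) : k) • ((𝒞 1).subtype ∘ₗ gradedProj 𝒞 1)

lemma signTwist_of_mem (i : ZMod 2) {j : ZMod 2} {c : C} (hc : c ∈ 𝒞 j) :
    signTwist 𝒞 i c = (-1 : ℤˣ) ^ (i * j) • c := by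
  have hj : j = 0 ∨ j = 1 := (by decide : ∀ i : ZMod 2, i = 0 ∨ i = 1) j
  rcases hj with rfl | rfl
  · simp [signTwist, gradedProj_of_mem 𝒞 hc, gradedProj_of_ne 𝒞 hc (show (0 : ZMod 2) ≠ 1 by decide)]
  · simp [signTwist, gradedProj_of_mem 𝒞 hc, gradedProj_of_ne 𝒞 hc (show (1 : ZMod 2) ≠ 0 by decide),
      Units.smul_def, Int.cast_smul_eq_zsmul]

lemma signTwist_mul (p : ZMod 2) {i : ZMod 2} {s : C} (hs : s ∈ 𝒞 i) (c : C) :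
    signTwist 𝒞 p (s * c) = (-1 : ℤˣ) ^ (p * i) • (s * signTwist 𝒞 p c) := by
  induction c using DirectSum.Decomposition.inductionOn 𝒞 with
  | zero => simp
  | add x y hx hy => simp only [map_add, mul_add, smul_add, hx, hy]
  | homogeneous c =>
    rw [signTwist_of_mem 𝒞 p (SetLike.mul_mem_graded hs c.2), signTwist_of_mem 𝒞 p c.2,
      mul_smul_comm, smul_smul, mul_add, uzpow_add]

namespace SuperHom

variable {𝒞} {R : Type*} [CommRing R] [Algebra k R]

/-- The map `c ↦ f ((-1)^{i|c|} c)`. -/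
def twist (i : ZMod 2) (f : SuperHom 𝒞 R) : SuperHom 𝒞 R := mk 𝒞 (f.toLin ∘ₗ signTwist 𝒞 i)

@[simp] lemma twist_apply (i : ZMod 2) (f : SuperHom 𝒞 R) (c : C) :
    twist i f c = f (signTwist 𝒞 i c) := rfl

/-- The map `m ∘ (f ⊗ g) : C ⊗ C → R`, where `m` is the product of `R` and `f ⊗ g` is formed with
the Koszul sign rule, `(f ⊗ g)(a ⊗ b) = (-1)^{|g||a|} f(a) ⊗ g(b)`. The even and odd components of
`g` are its restrictions to the even and odd parts of `C`. -/
def koszulMul : SuperHom 𝒞 R →ₗ[k] SuperHom 𝒞 R →ₗ[k] (𝒞 ᵍ⊗[k] 𝒞) →ₗ[k] R :=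
  LinearMap.mk₂ k (fun f g =>
    (LinearMap.mul' k R ∘ₗ
      (TensorProduct.map f.toLin (g.toLin ∘ₗ (𝒞 0).subtype ∘ₗ gradedProj 𝒞 0) +
        TensorProduct.map (f.toLin ∘ₗ signTwist 𝒞 1)
          (g.toLin ∘ₗ (𝒞 1).subtype ∘ₗ gradedProj 𝒞 1))) ∘ₗ
      (GradedTensorProduct.of k 𝒞 𝒞).symm.toLinearMap)
    (fun f f' g => by
      apply GradedTensorProduct.hom_ext; ext a b; simp [add_mul]; ring)
    (fun c f g => by
      apply GradedTensorProduct.hom_ext; ext a b; simp)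
    (fun f g g' => by
      apply GradedTensorProduct.hom_ext; ext a b; simp [mul_add]; ring)
    (fun c f g => by
      apply GradedTensorProduct.hom_ext; ext a b; simp)

lemma koszulMul_tmul (f g : SuperHom 𝒞 R) (a b : C) :
    koszulMul f g (a ᵍ⊗ₜ[k] b) =
      f a * g (gradedProj 𝒞 0 b) + f (signTwist 𝒞 1 a) * g (gradedProj 𝒞 1 b) := rfl

lemma koszulMul_of_mem (f g : SuperHom 𝒞 R) {i j : ZMod 2} {a b : C} (ha : a ∈ 𝒞 i)
    (hb : b ∈ 𝒞 j) : koszulMul f g (a ᵍ⊗ₜ[k] b) = (-1 : ℤˣ) ^ (i * j) • (f a * g b) := by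
  rw [koszulMul_tmul, signTwist_of_mem 𝒞 1 ha]
  have hj : j = 0 ∨ j = 1 := (by decide : ∀ i : ZMod 2, i = 0 ∨ i = 1) j
  rcases hj with rfl | rfl
  · simp [gradedProj_of_mem 𝒞 hb, gradedProj_of_ne 𝒞 hb (show (0 : ZMod 2) ≠ 1 by decide)]
  · rw [gradedProj_of_mem 𝒞 hb, gradedProj_of_ne 𝒞 hb (show (1 : ZMod 2) ≠ 0 by decide), one_mul,
      mul_one, Units.smul_def, map_zsmul, ← Units.smul_def, smul_mul_assoc, map_zero, mul_zero,
      zero_add]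

lemma koszulMul_prim_mul (f g : SuperHom 𝒞 R) {i : ZMod 2} {s : C} (hs : s ∈ 𝒞 i)
    (t : 𝒞 ᵍ⊗[k] 𝒞) :
    koszulMul f g ((s ᵍ⊗ₜ[k] (1 : C) + (1 : C) ᵍ⊗ₜ[k] s) * t) =
      koszulMul (shift s f) (twist i g) t + koszulMul f (shift s g) t := by
  obtain ⟨t, rfl⟩ := (GradedTensorProduct.of k 𝒞 𝒞).surjective t
  induction t using TensorProduct.induction_on with
  | zero => simp
  | add x y hx hy =>
    simp only [map_add, mul_add] at hx hy ⊢
    linear_combination hx + hy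
  | tmul a b =>
    induction a using DirectSum.Decomposition.inductionOn 𝒞 with
    | zero => simp
    | add x y hx hy =>
      simp only [TensorProduct.add_tmul, map_add, mul_add] at hx hy ⊢
      linear_combination hx + hy
    | homogeneous a =>
    rename_i p
    obtain ⟨a, ha⟩ := a
    induction b using DirectSum.Decomposition.inductionOn 𝒞 with
    | zero => simp
    | add x y hx hy =>
      simp only [TensorProduct.tmul_add, map_add, mul_add] at hx hy ⊢
      linear_combination hx + hy
    | homogeneous b =>
    rename_i q
    obtain ⟨b, hb⟩ := b
    rw [add_mul, map_add]
    have e1 : (s ᵍ⊗ₜ[k] (1 : C) * a ᵍ⊗ₜ[k] b : 𝒞 ᵍ⊗[k] 𝒞) = (s * a) ᵍ⊗ₜ[k] b :=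
      tmul_one_mul_coe_tmul 𝒞 𝒞 s ⟨a, ha⟩ b
    have e2 : ((1 : C) ᵍ⊗ₜ[k] s * a ᵍ⊗ₜ[k] b : 𝒞 ᵍ⊗[k] 𝒞) =
        (-1 : ℤˣ) ^ (i * p) • (a ᵍ⊗ₜ[k] (s * b)) := by
      have := tmul_coe_mul_coe_tmul 𝒞 𝒞 (1 : C) (⟨s, hs⟩ : 𝒞 i) (⟨a, ha⟩ : 𝒞 p) b
      rwa [one_mul] at this
    have two : (2 : ZMod 2) = 0 := rfl
    rw [e1, e2, Units.smul_def, map_zsmul, ← Units.smul_def,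
      koszulMul_of_mem f g (SetLike.mul_mem_graded hs ha) hb,
      koszulMul_of_mem f g ha (SetLike.mul_mem_graded hs hb),
      koszulMul_of_mem _ _ ha hb, koszulMul_of_mem _ _ ha hb]
    simp only [shift_apply, twist_apply, signTwist_of_mem 𝒞 i hb]
    rw [Units.smul_def ((-1 : ℤˣ) ^ (i * q)), map_zsmul, ← Units.smul_def, mul_smul_comm,
      smul_smul, smul_smul, ← uzpow_add, ← uzpow_add,
      show i * p + p * (i + q) = p * q by linear_combination (i * p) * two,
      show (i + p) * q = p * q + i * q by ring]

variable [PrimitivelyGenerated 𝒞]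

/-- The product `f · g = m ∘ (f ⊗ g) ∘ Δ`. -/
instance : Mul (SuperHom 𝒞 R) where
  mul f g := mk 𝒞 (koszulMul f g ∘ₗ (PrimitivelyGenerated.comul (𝒞 := 𝒞)).toLinearMap)

/-- The unit is the counit of `C` followed by `k → R`. -/
instance : One (SuperHom 𝒞 R) where
  one := mk 𝒞 (Algebra.linearMap k R ∘ₗ (PrimitivelyGenerated.counit (𝒞 := 𝒞)).toLinearMap)

lemma mul_apply (f g : SuperHom 𝒞 R) (c : C) :
    (f * g) c = koszulMul f g (PrimitivelyGenerated.comul (𝒞 := 𝒞) c) := rfl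

lemma one_apply (c : C) :
    (1 : SuperHom 𝒞 R) c = algebraMap k R (PrimitivelyGenerated.counit (𝒞 := 𝒞) c) := rfl


/-- To compare two bilinear expressions it is enough to compare them on products of homogeneous
primitive elements. -/
lemma word_induction {p : C → Prop} (one : p 1) (add : ∀ a b, p a → p b → p (a + b))
    (smul : ∀ (c : k) a, p a → p (c • a))
    (mul : ∀ (i : ZMod 2) (s a : C), s ∈ 𝒞 i →
      PrimitivelyGenerated.comul (𝒞 := 𝒞) s = s ᵍ⊗ₜ[k] (1 : C) + (1 : C) ᵍ⊗ₜ[k] s →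
      PrimitivelyGenerated.counit (𝒞 := 𝒞) s = 0 → p a → p (s * a)) (c : C) : p c := by
  have hc : c ∈ Algebra.adjoin k {s : C | (∃ i, s ∈ 𝒞 i) ∧
      PrimitivelyGenerated.comul (𝒞 := 𝒞) s = s ᵍ⊗ₜ[k] (1 : C) + (1 : C) ᵍ⊗ₜ[k] s ∧
      PrimitivelyGenerated.counit (𝒞 := 𝒞) s = 0} := by
    rw [PrimitivelyGenerated.adjoin_primitive]; trivial
  rw [← Subalgebra.mem_toSubmodule, Algebra.adjoin_eq_span] at hc
  induction hc using Submodule.span_induction with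
  | mem x hx =>
    induction hx using Submonoid.closure_induction_left with
    | one => exact one
    | mul_left s hs y hy ih =>
      obtain ⟨⟨i, hi⟩, h1, h2⟩ := hs
      exact mul i s y hi h1 h2 ih
  | zero => simpa using smul 0 1 one
  | add x y _ _ hx hy => exact add x y hx hy
  | smul c x _ hx => exact smul c x hx

lemma shift_mul {i : ZMod 2} {s : C} (hs : s ∈ 𝒞 i)
    (h1 : PrimitivelyGenerated.comul (𝒞 := 𝒞) s = s ᵍ⊗ₜ[k] (1 : C) + (1 : C) ᵍ⊗ₜ[k] s)
    (f g : SuperHom 𝒞 R) :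
    shift s (f * g) = shift s f * twist i g + f * shift s g := by
  ext c
  rw [shift_apply, mul_apply, map_mul, h1, koszulMul_prim_mul f g hs]
  rfl

lemma shift_twist {i : ZMod 2} {s : C} (hs : s ∈ 𝒞 i) (p : ZMod 2) (f : SuperHom 𝒞 R) :
    shift s (twist p f) = ((((-1 : ℤˣ) ^ (p * i) : ℤˣ) : ℤ) : k) • twist p (shift s f) := by
  ext c
  simp only [shift_apply, twist_apply, smul_apply]
  rw [signTwist_mul _ _ hs, Units.smul_def, map_zsmul, Int.cast_smul_eq_zsmul]

lemma twist_comm (i j : ZMod 2) (f : SuperHom 𝒞 R) : twist i (twist j f) = twist j (twist i f) := by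
  ext c
  simp only [twist_apply]
  congr 1
  induction c using DirectSum.Decomposition.inductionOn 𝒞 with
  | zero => simp
  | add x y hx hy => simp only [map_add, hx, hy]
  | homogeneous c =>
    rename_i q
    obtain ⟨c, hc⟩ := c
    have h : ∀ i j : ZMod 2, signTwist 𝒞 i (signTwist 𝒞 j c) =
        (-1 : ℤˣ) ^ (j * q) • (-1 : ℤˣ) ^ (i * q) • c := fun i j => by
      rw [signTwist_of_mem 𝒞 j hc, Units.smul_def, map_zsmul, signTwist_of_mem 𝒞 i hc,
        ← Units.smul_def]
    rw [h, h, smul_comm]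

lemma mul_apply_one (f g : SuperHom 𝒞 R) : (f * g) 1 = f 1 * g 1 := by
  rw [mul_apply, map_one]
  have := koszulMul_of_mem f g (SetLike.GradedOne.one_mem (A := 𝒞))
    (SetLike.GradedOne.one_mem (A := 𝒞))
  simpa using! this

instance : NonUnitalNonAssocRing (SuperHom 𝒞 R) where
  left_distrib f g h := by ext c; simp [mul_apply]
  right_distrib f g h := by ext c; simp [mul_apply]
  zero_mul f := by ext c; simp [mul_apply]
  mul_zero f := by ext c; simp [mul_apply]

instance : IsScalarTower k (SuperHom 𝒞 R) (SuperHom 𝒞 R) where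
  smul_assoc a f g := by ext c; simp [mul_apply]

instance : SMulCommClass k (SuperHom 𝒞 R) (SuperHom 𝒞 R) where
  smul_comm a f g := by ext c; simp [mul_apply]

lemma twist_mul (p : ZMod 2) (f g : SuperHom 𝒞 R) : twist p (f * g) = twist p f * twist p g := by
  ext c
  induction c using word_induction (𝒞 := 𝒞) generalizing f g with
  | one =>
    have h1 : signTwist 𝒞 p (1 : C) = 1 := by
      rw [signTwist_of_mem 𝒞 p (SetLike.GradedOne.one_mem (A := 𝒞))]; simp
    simp only [mul_apply_one, twist_apply, h1]
  | add a b ha hb => simp only [map_add, ha, hb]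
  | smul r a ha => simp only [map_smul, ha]
  | mul i s a hs h1 h2 ih =>
    rw [← shift_apply, ← shift_apply, shift_twist hs, shift_mul hs h1, shift_mul hs h1,
      shift_twist hs, shift_twist hs, smul_mul_assoc, mul_smul_comm, ← smul_add, smul_apply,
      smul_apply, add_apply, twist_comm i p, ← ih, ← ih]
    simp

lemma shift_one {s : C} (h2 : PrimitivelyGenerated.counit (𝒞 := 𝒞) s = 0) :
    shift s (1 : SuperHom 𝒞 R) = 0 := by
  ext c
  simp [one_apply, h2]

lemma twist_one (p : ZMod 2) : twist p (1 : SuperHom 𝒞 R) = 1 := by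
  ext c
  induction c using word_induction (𝒞 := 𝒞) with
  | one =>
    have h1 : signTwist 𝒞 p (1 : C) = 1 := by
      rw [signTwist_of_mem 𝒞 p (SetLike.GradedOne.one_mem (A := 𝒞))]; simp
    simp only [twist_apply, h1]
  | add a b ha hb => simp only [map_add, ha, hb]
  | smul r a ha => simp only [map_smul, ha]
  | mul i s a hs h1 h2 ih =>
    rw [← shift_apply, ← shift_apply, shift_twist hs, shift_one h2]
    simp

protected lemma mul_assoc' (f g h : SuperHom 𝒞 R) : f * g * h = f * (g * h) := by
  ext c
  induction c using word_induction (𝒞 := 𝒞) generalizing f g h with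
  | one => simp only [mul_apply_one, mul_assoc]
  | add a b ha hb => simp only [map_add, ha, hb]
  | smul r a ha => simp only [map_smul, ha]
  | mul i s a hs h1 h2 ih =>
    rw [← shift_apply, ← shift_apply]
    simp only [shift_mul hs h1, twist_mul, add_mul, mul_add, add_apply, ih]
    ring

protected lemma one_mul' (f : SuperHom 𝒞 R) : 1 * f = f := by
  ext c
  induction c using word_induction (𝒞 := 𝒞) generalizing f with
  | one => simp [mul_apply_one, one_apply]
  | add a b ha hb => simp only [map_add, ha, hb]
  | smul r a ha => simp only [map_smul, ha]
  | mul i s a hs h1 h2 ih =>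
    rw [← shift_apply, ← shift_apply, shift_mul hs h1, shift_one h2, zero_mul, zero_add,
      ih]

protected lemma mul_one' (f : SuperHom 𝒞 R) : f * 1 = f := by
  ext c
  induction c using word_induction (𝒞 := 𝒞) generalizing f with
  | one => simp [mul_apply_one, one_apply]
  | add a b ha hb => simp only [map_add, ha, hb]
  | smul r a ha => simp only [map_smul, ha]
  | mul i s a hs h1 h2 ih =>
    rw [← shift_apply, ← shift_apply, shift_mul hs h1, shift_one h2, mul_zero, add_zero,
      twist_one, ih]

instance : Ring (SuperHom 𝒞 R) where
  mul_assoc := SuperHom.mul_assoc'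
  one_mul := SuperHom.one_mul'
  mul_one := SuperHom.mul_one'

instance : Algebra k (SuperHom 𝒞 R) :=
  Algebra.ofModule (fun a f g => smul_mul_assoc a f g) (fun a f g => mul_smul_comm a f g)

lemma map_koszulMul {R' : Type*} [CommRing R'] [Algebra k R'] (φ : R →ₐ[k] R')
    (f g : SuperHom 𝒞 R) (t : 𝒞 ᵍ⊗[k] 𝒞) : φ (koszulMul f g t) =
      koszulMul (mk 𝒞 (φ.toLinearMap ∘ₗ f.toLin)) (mk 𝒞 (φ.toLinearMap ∘ₗ g.toLin)) t := by
  obtain ⟨t, rfl⟩ := (GradedTensorProduct.of k 𝒞 𝒞).surjective t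
  induction t using TensorProduct.induction_on with
  | zero => simp
  | add x y hx hy => simp only [map_add, hx, hy]
  | tmul a b => simp [koszulMul_tmul]

lemma twist_zero (f : SuperHom 𝒞 R) : twist 0 f = f := by
  ext c
  induction c using DirectSum.Decomposition.inductionOn 𝒞 with
  | zero => simp
  | add x y hx hy => simp only [map_add, hx, hy]
  | homogeneous c => simp [signTwist_of_mem 𝒞 _ c.2]

/-- A derivation of `R` acts on `SuperHom` by derivations. -/
lemma derivation_mul (D : Derivation k R R) (f g : SuperHom 𝒞 R) (c : C) :
    (mk 𝒞 ((D : R →ₗ[k] R) ∘ₗ f.toLin) * g + f * mk 𝒞 ((D : R →ₗ[k] R) ∘ₗ g.toLin)) c =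
      D ((f * g) c) := by
  rw [add_apply, mul_apply, mul_apply, mul_apply]
  generalize PrimitivelyGenerated.comul (𝒞 := 𝒞) c = t
  obtain ⟨t, rfl⟩ := (GradedTensorProduct.of k 𝒞 𝒞).surjective t
  induction t using TensorProduct.induction_on with
  | zero => simp
  | add x y hx hy => simp only [map_add] at hx hy ⊢; linear_combination hx + hy
  | tmul a b => simp [koszulMul_tmul]; ring

/-- Composition with a morphism of algebras `R → R'`. -/
def map {R' : Type*} [CommRing R'] [Algebra k R'] (φ : R →ₐ[k] R') :
    SuperHom 𝒞 R →ₐ[k] SuperHom 𝒞 R' :=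
  AlgHom.ofLinearMap
    { toFun := fun f => mk 𝒞 (φ.toLinearMap ∘ₗ f.toLin)
      map_add' := fun f g => by ext c; simp
      map_smul' := fun a f => by ext c; simp }
    (by ext c; simp [one_apply])
    (fun f g => by ext c; exact map_koszulMul φ f g _)

@[simp] lemma map_apply {R' : Type*} [CommRing R'] [Algebra k R'] (φ : R →ₐ[k] R')
    (f : SuperHom 𝒞 R) (c : C) : map φ f c = φ (f c) := rfl

end SuperHom

end SuperBialgebra

section Coproducts

open GradedTensorProduct

variable (k : Type*) [Field k]

/-- The map `x ↦ ι x ⊗ 1 + 1 ⊗ ι x` from `𝔤` to `U(𝔤) ⊗ U(𝔤)`. -/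
def SuperUEA.primitive (𝔤 : Type*) [AddCommGroup 𝔤] [Module k 𝔤] [LieSuperalgebra k 𝔤] :
    𝔤 →ₗ[k] SuperUEA.gr k 𝔤 ᵍ⊗[k] SuperUEA.gr k 𝔤 :=
  ((includeLeft (SuperUEA.gr k 𝔤) (SuperUEA.gr k 𝔤)).toLinearMap +
    (includeRight (SuperUEA.gr k 𝔤) (SuperUEA.gr k 𝔤)).toLinearMap) ∘ₗ SuperUEA.ι k 𝔤

lemma SuperUEA.primitive_apply {𝔤 : Type*} [AddCommGroup 𝔤] [Module k 𝔤] [LieSuperalgebra k 𝔤]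
    (x : 𝔤) : SuperUEA.primitive k 𝔤 x =
      SuperUEA.ι k 𝔤 x ᵍ⊗ₜ[k] (1 : SuperUEA k 𝔤) + (1 : SuperUEA k 𝔤) ᵍ⊗ₜ[k] SuperUEA.ι k 𝔤 x := rfl

lemma primitive_mul_primitive {C : Type*} [Ring C] [Algebra k C] (𝒞 : ZMod 2 → Submodule k C)
    [GradedAlgebra 𝒞] {i j : ZMod 2} {x y : C} (hx : x ∈ 𝒞 i) (hy : y ∈ 𝒞 j) :
    ((x ᵍ⊗ₜ[k] (1 : C) + (1 : C) ᵍ⊗ₜ[k] x) * (y ᵍ⊗ₜ[k] (1 : C) + (1 : C) ᵍ⊗ₜ[k] y) :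
        𝒞 ᵍ⊗[k] 𝒞) =
      (x * y) ᵍ⊗ₜ[k] (1 : C) + x ᵍ⊗ₜ[k] y + (-1 : ℤˣ) ^ (i * j) • (y ᵍ⊗ₜ[k] x) +
        (1 : C) ᵍ⊗ₜ[k] (x * y) := by
  have e1 : (x ᵍ⊗ₜ[k] (1 : C) * y ᵍ⊗ₜ[k] (1 : C) : 𝒞 ᵍ⊗[k] 𝒞) = (x * y) ᵍ⊗ₜ[k] (1 : C) :=
    tmul_one_mul_coe_tmul 𝒞 𝒞 x ⟨y, hy⟩ 1
  have e2 : (x ᵍ⊗ₜ[k] (1 : C) * (1 : C) ᵍ⊗ₜ[k] y : 𝒞 ᵍ⊗[k] 𝒞) = x ᵍ⊗ₜ[k] y :=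
    tmul_one_mul_one_tmul 𝒞 𝒞 x y
  have e3 : ((1 : C) ᵍ⊗ₜ[k] x * y ᵍ⊗ₜ[k] (1 : C) : 𝒞 ᵍ⊗[k] 𝒞) =
      (-1 : ℤˣ) ^ (i * j) • (y ᵍ⊗ₜ[k] x) := by
    have := tmul_coe_mul_coe_tmul 𝒞 𝒞 (1 : C) (⟨x, hx⟩ : 𝒞 i) (⟨y, hy⟩ : 𝒞 j) 1
    rwa [one_mul, mul_one] at this
  have e4 : ((1 : C) ᵍ⊗ₜ[k] x * (1 : C) ᵍ⊗ₜ[k] y : 𝒞 ᵍ⊗[k] 𝒞) = (1 : C) ᵍ⊗ₜ[k] (x * y) :=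
    tmul_coe_mul_one_tmul 𝒞 𝒞 (1 : C) (⟨x, hx⟩ : 𝒞 i) y
  rw [add_mul, mul_add, mul_add, e1, e2, e3, e4]
  abel

/-- `U(𝔤)` is a super bialgebra, with `Δ x = x ⊗ 1 + 1 ⊗ x` and `ε x = 0` for `x ∈ 𝔤`. -/
instance (𝔤 : Type*) [AddCommGroup 𝔤] [Module k 𝔤] [LieSuperalgebra k 𝔤] :
    PrimitivelyGenerated (SuperUEA.gr k 𝔤) where
  comul := SuperUEA.lift k (A := SuperUEA.gr k 𝔤 ᵍ⊗[k] SuperUEA.gr k 𝔤)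
    (SuperUEA.primitive k 𝔤) (by
      intro i j x y hx hy
      have hx' := SuperUEA.ι_mem_gr k 𝔤 hx
      have hy' := SuperUEA.ι_mem_gr k 𝔤 hy
      simp only [SuperUEA.primitive_apply]
      rw [primitive_mul_primitive k (SuperUEA.gr k 𝔤) hx' hy',
        primitive_mul_primitive k (SuperUEA.gr k 𝔤) hy' hx', SuperUEA.ι_mul_ι k 𝔤 hx hy]
      have L : ∀ c : SuperUEA k 𝔤, (c ᵍ⊗ₜ[k] (1 : SuperUEA k 𝔤) :
          SuperUEA.gr k 𝔤 ᵍ⊗[k] SuperUEA.gr k 𝔤) = includeLeft _ _ c := fun _ => rfl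
      have R : ∀ c : SuperUEA k 𝔤, ((1 : SuperUEA k 𝔤) ᵍ⊗ₜ[k] c :
          SuperUEA.gr k 𝔤 ᵍ⊗[k] SuperUEA.gr k 𝔤) = includeRight _ _ c := fun _ => rfl
      rw [L, L, L, R, R, R]
      simp only [smul_add, smul_smul, map_add]
      rw [mul_comm j i, ← uzpow_add, show i * j + i * j = 0 from CharTwo.add_self_eq_zero _,
        uzpow_zero, one_smul, Units.smul_def, Units.smul_def, Units.smul_def, Units.smul_def,
        map_zsmul, map_zsmul]
      abel)
  counit := SuperUEA.lift k 0 (by simp)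
  adjoin_primitive := by
    rw [eq_top_iff, ← SuperUEA.adjoin_range_ι k, Algebra.adjoin_le_iff]
    rintro _ ⟨x, rfl⟩
    rw [SetLike.mem_coe, ← gradedProj_add (superPart k 𝔤) x, map_add]
    exact add_mem
      (Algebra.subset_adjoin ⟨⟨0, SuperUEA.ι_mem_gr k 𝔤 (Subtype.mem _)⟩,
        SuperUEA.lift_ι .., SuperUEA.lift_ι ..⟩)
      (Algebra.subset_adjoin ⟨⟨1, SuperUEA.ι_mem_gr k 𝔤 (Subtype.mem _)⟩,
        SuperUEA.lift_ι .., SuperUEA.lift_ι ..⟩)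

/-- The `ℤ/2`-grading of the exterior algebra `⋀(V)` of a purely odd vector space `V`. -/
abbrev extParity (V : Type*) [AddCommGroup V] [Module k V] :
    ZMod 2 → Submodule k (ExteriorAlgebra k V) :=
  CliffordAlgebra.evenOdd (0 : QuadraticForm k V)

instance (V : Type*) [AddCommGroup V] [Module k V] : GradedAlgebra (extParity k V) :=
  CliffordAlgebra.gradedAlgebra _

/-- `⋀(V)` is a super bialgebra, with `Δ v = v ⊗ 1 + 1 ⊗ v` and `ε v = 0` for `v ∈ V`. -/
instance (V : Type*) [AddCommGroup V] [Module k V] : PrimitivelyGenerated (extParity k V) where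
  comul := ExteriorAlgebra.lift k (A := extParity k V ᵍ⊗[k] extParity k V)
    ⟨((includeLeft (extParity k V) (extParity k V)).toLinearMap +
      (includeRight (extParity k V) (extParity k V)).toLinearMap) ∘ₗ ExteriorAlgebra.ι k, by
      intro v
      have hv : ExteriorAlgebra.ι k v ∈ extParity k V 1 :=
        CliffordAlgebra.ι_mem_evenOdd_one _ v
      refine (primitive_mul_primitive k (extParity k V) hv hv).trans ?_
      have L : ((0 : ExteriorAlgebra k V) ᵍ⊗ₜ[k] (1 : ExteriorAlgebra k V) :
          extParity k V ᵍ⊗[k] extParity k V) = 0 := map_zero (includeLeft _ _)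
      have R : ((1 : ExteriorAlgebra k V) ᵍ⊗ₜ[k] (0 : ExteriorAlgebra k V) :
          extParity k V ᵍ⊗[k] extParity k V) = 0 := map_zero (includeRight _ _)
      rw [ExteriorAlgebra.ι_sq_zero, mul_one, uzpow_one, L, R]
      simp [Units.smul_def]⟩
  counit := ExteriorAlgebra.algebraMapInv
  adjoin_primitive := by
    rw [eq_top_iff, ← CliffordAlgebra.adjoin_range_ι, Algebra.adjoin_le_iff]
    rintro _ ⟨v, rfl⟩
    exact Algebra.subset_adjoin ⟨⟨1, CliffordAlgebra.ι_mem_evenOdd_one _ v⟩,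
      ExteriorAlgebra.lift_ι_apply .., ExteriorAlgebra.lift_ι_apply ..⟩

end Coproducts

section Gamma

attribute [local instance 100] LieRing.ofAssociativeRing

variable (k : Type*) [Field k] [CharZero k] (𝔤 : Type*) [AddCommGroup 𝔤] [Module k 𝔤]
  [LieSuperalgebra k 𝔤]

/-- The Lie algebra morphism `𝔤₀ → U(𝔤)`. -/
def evenToUEA : superPart k 𝔤 0 →ₗ⁅k⁆ SuperUEA k 𝔤 :=
  { SuperUEA.ι k 𝔤 ∘ₗ (superPart k 𝔤 0).subtype with
    map_lie' := fun {x y} => by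
      have h := SuperUEA.ι_mul_ι k 𝔤 x.2 y.2
      rw [mul_zero, uzpow_zero, one_smul] at h
      rw [LieRing.of_associative_ring_bracket]
      exact (sub_eq_of_eq_add' h).symm }

/-- The algebra morphism `U(𝔤₀) → U(𝔤)` induced by the inclusion `𝔤₀ → 𝔤`. -/
def evenInclusion : UniversalEnvelopingAlgebra k (superPart k 𝔤 0) →ₐ[k] SuperUEA k 𝔤 :=
  UniversalEnvelopingAlgebra.lift k (evenToUEA k 𝔤)

lemma evenInclusion_ι (Z : superPart k 𝔤 0) :
    evenInclusion k 𝔤 (UniversalEnvelopingAlgebra.ι k Z) = SuperUEA.ι k 𝔤 (Z : 𝔤) :=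
  UniversalEnvelopingAlgebra.lift_ι_apply k _ Z

/-- `U(𝔤)` is a left `U(𝔤₀)`-module by left multiplication. -/
instance : Module (UniversalEnvelopingAlgebra k (superPart k 𝔤 0)) (SuperUEA k 𝔤) :=
  Module.compHom _ (evenInclusion k 𝔤).toRingHom

lemma evenInclusion_smul (a : UniversalEnvelopingAlgebra k (superPart k 𝔤 0))
    (u : SuperUEA k 𝔤) : a • u = evenInclusion k 𝔤 a * u := rfl

instance : IsScalarTower k (UniversalEnvelopingAlgebra k (superPart k 𝔤 0)) (SuperUEA k 𝔤) where
  smul_assoc c a u := by simp [evenInclusion_smul]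

/-- The antisymmetrizer `γ : ⋀(𝔤₁) → U(𝔤)`,
`X₁ ∧ ⋯ ∧ X_p ↦ (1 / p!) ∑_τ (-1)^{|τ|} X_{τ(1)} ⋯ X_{τ(p)}`. -/
def antisymmetrizer : ExteriorAlgebra k (superPart k 𝔤 1) →ₗ[k] SuperUEA k 𝔤 :=
  ExteriorAlgebra.liftAlternating fun p => ((p.factorial : k)⁻¹) •
    MultilinearMap.alternatization ((MultilinearMap.mkPiAlgebraFin k p (SuperUEA k 𝔤)).compLinearMap
      fun _ => SuperUEA.ι k 𝔤 ∘ₗ (superPart k 𝔤 1).subtype)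

lemma antisymmetrizer_ιMulti (p : ℕ) (X : Fin p → superPart k 𝔤 1) :
    antisymmetrizer k 𝔤 (ExteriorAlgebra.ιMulti k p X) =
      ((p.factorial : k)⁻¹) • ∑ τ : Equiv.Perm (Fin p),
        Equiv.Perm.sign τ • (List.ofFn fun i => SuperUEA.ι k 𝔤 (X (τ i) : 𝔤)).prod := by
  rw [antisymmetrizer, ExteriorAlgebra.liftAlternating_apply_ιMulti, AlternatingMap.smul_apply,
    MultilinearMap.alternatization_apply]
  rfl

/-- The map `γ̂ : U(𝔤₀) ⊗ ⋀(𝔤₁) → U(𝔤)`, `X ⊗ Y ↦ X · γ(Y)`, of left `U(𝔤₀)`-modules. -/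
def gammaHat : UniversalEnvelopingAlgebra k (superPart k 𝔤 0) ⊗[k]
      ExteriorAlgebra k (superPart k 𝔤 1) →ₗ[UniversalEnvelopingAlgebra k (superPart k 𝔤 0)]
    SuperUEA k 𝔤 :=
  TensorProduct.AlgebraTensorModule.lift
    { toFun := fun a =>
        LinearMap.mulLeft k (evenInclusion k 𝔤 a) ∘ₗ antisymmetrizer k 𝔤
      map_add' := fun a b => by ext; simp [add_mul]
      map_smul' := fun a b => by ext; simp [evenInclusion_smul] }

lemma gammaHat_tmul (a : UniversalEnvelopingAlgebra k (superPart k 𝔤 0))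
    (Y : ExteriorAlgebra k (superPart k 𝔤 1)) :
    gammaHat k 𝔤 (a ⊗ₜ Y) = evenInclusion k 𝔤 a * antisymmetrizer k 𝔤 Y := rfl

end Gamma

section OG

attribute [local instance 100] LieRing.ofAssociativeRing

variable {k : Type*} [Field k] [CharZero k] {𝔤 : Type*} [AddCommGroup 𝔤] [Module k 𝔤]
  [LieSuperalgebra k 𝔤] {R : Type*} [CommRing R] [Algebra k R]
  (δ : superPart k 𝔤 0 →ₗ⁅k⁆ Derivation k R R)

/-- The action of `U(𝔤₀)` on `R` that extends an action of `𝔤₀` on `R` by derivations. -/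
def evenAction : UniversalEnvelopingAlgebra k (superPart k 𝔤 0) →ₐ[k] Module.End k R :=
  UniversalEnvelopingAlgebra.lift k ((LieModule.toEnd k (Derivation k R R) R).comp δ)

lemma evenAction_ι (Z : superPart k 𝔤 0) (r : R) :
    evenAction δ (UniversalEnvelopingAlgebra.ι k Z) r = δ Z r :=
  LinearMap.congr_fun (UniversalEnvelopingAlgebra.lift_ι_apply k _ Z) r

/-- A map out of `U(𝔤)` is `U(𝔤₀)`-linear as soon as it commutes with the action of `𝔤₀`. -/
lemma evenLinear_iff (f : SuperHom (SuperUEA.gr k 𝔤) R) :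
    (∀ (a : UniversalEnvelopingAlgebra k (superPart k 𝔤 0)) (u : SuperUEA k 𝔤),
      f (a • u) = evenAction δ a (f u)) ↔
    ∀ (Z : superPart k 𝔤 0) (u : SuperUEA k 𝔤), f (SuperUEA.ι k 𝔤 (Z : 𝔤) * u) = δ Z (f u) := by
  constructor
  · intro h Z u
    rw [← evenAction_ι δ, ← h, evenInclusion_smul, evenInclusion_ι]
  · intro h a
    let S : Subalgebra k (UniversalEnvelopingAlgebra k (superPart k 𝔤 0)) :=
      { carrier := {a | ∀ u : SuperUEA k 𝔤, f (a • u) = evenAction δ a (f u)}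
        mul_mem' := fun {a b} ha hb u => by
          rw [mul_smul, ha, hb, map_mul]; rfl
        add_mem' := fun {a b} ha hb u => by
          rw [add_smul, map_add, ha, hb, map_add]; rfl
        algebraMap_mem' := fun c u => by
          simp [Algebra.algebraMap_eq_smul_one] }
    have hι : ∀ Z, UniversalEnvelopingAlgebra.ι k Z ∈ S := fun Z u => by
      rw [evenAction_ι, evenInclusion_smul, evenInclusion_ι, h]
    have hS : S.val.comp (UniversalEnvelopingAlgebra.lift k (LieHom.mk
        ((UniversalEnvelopingAlgebra.ι k).toLinearMap.codRestrict S.toSubmodule hι)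
        (fun {x y} => Subtype.ext (((UniversalEnvelopingAlgebra.ι k).map_lie x y).trans
          (LieRing.of_associative_ring_bracket _ _))))) = AlgHom.id k _ := by
      apply UniversalEnvelopingAlgebra.hom_ext
      ext Z
      simp only [LieHom.comp_apply, AlgHom.coe_toLieHom, AlgHom.comp_apply,
        UniversalEnvelopingAlgebra.lift_ι_apply]
      rfl
    have := AlgHom.congr_fun hS a
    rw [AlgHom.comp_apply, AlgHom.id_apply] at this
    rw [← this]
    exact SetLike.coe_mem (p := S) _

/-- The superalgebra `Hom_{U(𝔤₀)}(U(𝔤), R)`, with the product `f · g = m ∘ (f ⊗ g) ∘ Δ`. -/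
def superSections : Subalgebra k (SuperHom (SuperUEA.gr k 𝔤) R) where
  carrier := {f | ∀ (a : UniversalEnvelopingAlgebra k (superPart k 𝔤 0)) (u : SuperUEA k 𝔤),
    f (a • u) = evenAction δ a (f u)}
  add_mem' {f g} hf hg a u := by
    rw [SuperHom.add_apply, SuperHom.add_apply, hf, hg, map_add]
  mul_mem' {f g} hf hg := by
    rw [Set.mem_ofPred_eq, evenLinear_iff] at hf hg ⊢
    intro Z u
    have hZ := SuperUEA.ι_mem_gr k 𝔤 Z.2
    have hs : ∀ {f : SuperHom (SuperUEA.gr k 𝔤) R},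
        (∀ (Z : superPart k 𝔤 0) (u : SuperUEA k 𝔤), f (SuperUEA.ι k 𝔤 (Z : 𝔤) * u) = δ Z (f u)) →
        SuperHom.shift (SuperUEA.ι k 𝔤 (Z : 𝔤)) f =
          SuperHom.mk _ ((δ Z : R →ₗ[k] R) ∘ₗ f.toLin) := fun hf => SuperHom.ext fun c => hf Z c
    rw [← SuperHom.shift_apply, SuperHom.shift_mul hZ (SuperUEA.lift_ι ..), hs hf, hs hg,
      SuperHom.twist_zero]
    exact SuperHom.derivation_mul (δ Z) f g u
  algebraMap_mem' c := by
    rw [Set.mem_ofPred_eq, evenLinear_iff]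
    intro Z u
    have e : PrimitivelyGenerated.counit (𝒞 := SuperUEA.gr k 𝔤) (SuperUEA.ι k 𝔤 (Z : 𝔤)) = 0 :=
      SuperUEA.lift_ι ..
    rw [Algebra.algebraMap_eq_smul_one, SuperHom.smul_apply, SuperHom.smul_apply,
      SuperHom.one_apply, SuperHom.one_apply, map_mul, e, zero_mul]
    simp

end OG

section AnalyticGroup

open scoped Manifold ContDiff
open VectorField Filter Topology

variable {𝕜 : Type*} [NontriviallyNormedField 𝕜] {E : Type*} [NormedAddCommGroup E]
  [NormedSpace 𝕜 E] {G : Type*} [TopologicalSpace G] [ChartedSpace E G] [Group G]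
  [LieGroup 𝓘(𝕜, E) ω G]

/-- Left invariant vector fields on an analytic group are analytic. -/
lemma contMDiff_leftInvariant (Z : GroupLieAlgebra 𝓘(𝕜, E) G) :
    ContMDiff 𝓘(𝕜, E) 𝓘(𝕜, E).tangent ω
      (fun g : G => (⟨g, mulInvariantVectorField Z g⟩ : TangentBundle 𝓘(𝕜, E) G)) := by
  let fg : G → TangentBundle 𝓘(𝕜, E) G := fun g => ⟨g, 0⟩
  have sfg : ContMDiff 𝓘(𝕜, E) 𝓘(𝕜, E).tangent ω fg := Bundle.contMDiff_zeroSection _ _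
  let fv : G → TangentBundle 𝓘(𝕜, E) G := fun _ => ⟨1, Z⟩
  have sfv : ContMDiff 𝓘(𝕜, E) 𝓘(𝕜, E).tangent ω fv := contMDiff_const
  let F₁ : G → (TangentBundle 𝓘(𝕜, E) G × TangentBundle 𝓘(𝕜, E) G) := fun g => (fg g, fv g)
  have S₁ : ContMDiff 𝓘(𝕜, E) (𝓘(𝕜, E).tangent.prod 𝓘(𝕜, E).tangent) ω F₁ := sfg.prodMk sfv
  let F₂ := (equivTangentBundleProd 𝓘(𝕜, E) G 𝓘(𝕜, E) G).symm
  have S₂ : ContMDiff (𝓘(𝕜, E).tangent.prod 𝓘(𝕜, E).tangent)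
      (𝓘(𝕜, E).prod 𝓘(𝕜, E)).tangent ω F₂ := contMDiff_equivTangentBundleProd_symm
  let F₃ := tangentMap (𝓘(𝕜, E).prod 𝓘(𝕜, E)) 𝓘(𝕜, E) (fun p : G × G => p.1 * p.2)
  have S₃ : ContMDiff (𝓘(𝕜, E).prod 𝓘(𝕜, E)).tangent 𝓘(𝕜, E).tangent ω F₃ :=
    ContMDiff.contMDiff_tangentMap (contMDiff_mul 𝓘(𝕜, E) ω) (m := ω) le_rfl
  let S := (S₃.comp S₂).comp S₁
  convert! S with g
  · simp [F₁, F₂, F₃, fg, fv]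
  · simp only [Function.comp_apply, tangentMap, F₃, F₂, F₁, fg, fv]
    rw [mfderiv_prod_eq_add_apply ((contMDiff_mul 𝓘(𝕜, E) ω).mdifferentiableAt (by simp))]
    change mulInvariantVectorField Z g = mfderiv 𝓘(𝕜, E) 𝓘(𝕜, E) (fun z : G => z * 1) g 0 +
      mfderiv 𝓘(𝕜, E) 𝓘(𝕜, E) (fun z : G => g * z) 1 Z
    rw [mulInvariantVectorField]
    exact ((congrArg₂ (· + ·) (map_zero _) rfl).trans (zero_add _)).symm

variable (𝕜 E) in
/-- The derivative of `f` along the left invariant vector field with value `Z` at the identity,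
`x ↦ d/dt f(x e^{tZ})|_{t = 0}`. -/
def leftDeriv (Z : GroupLieAlgebra 𝓘(𝕜, E) G) (f : G → 𝕜) (x : G) : 𝕜 :=
  mvfderiv 𝓘(𝕜, E) f x (mulInvariantVectorField Z x)

lemma contMDiffOn_leftDeriv (Z : GroupLieAlgebra 𝓘(𝕜, E) G) {f : G → 𝕜} {U : Set G}
    (hU : IsOpen U) (hf : ContMDiffOn 𝓘(𝕜, E) 𝓘(𝕜, 𝕜) ω f U) :
    ContMDiffOn 𝓘(𝕜, E) 𝓘(𝕜, 𝕜) ω (leftDeriv 𝕜 E Z f) U := by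
  have h1 := hf.contMDiffOn_tangentMapWithin (m := ω) le_rfl hU.uniqueMDiffOn
  have h2 := h1.comp (contMDiff_leftInvariant Z).contMDiffOn (s := U) (fun x hx => hx)
  have h3 := (contMDiff_snd_tangentBundle_modelSpace 𝕜 𝓘(𝕜, 𝕜) (n := ω)).comp_contMDiffOn h2
  refine h3.congr fun x hx => ?_
  simp only [leftDeriv, mvfderiv]
  have e := mfderivWithin_of_isOpen (I := 𝓘(𝕜, E)) (I' := 𝓘(𝕜, 𝕜)) (f := f) hU hx
  rw [← e]
  rfl

lemma leftDeriv_congr (Z : GroupLieAlgebra 𝓘(𝕜, E) G) {f g : G → 𝕜} {x : G}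
    (h : f =ᶠ[𝓝 x] g) : leftDeriv 𝕜 E Z f x = leftDeriv 𝕜 E Z g x := by
  have := h.mfderiv_eq (I := 𝓘(𝕜, E)) (I' := 𝓘(𝕜, 𝕜))
  simp only [leftDeriv, mvfderiv]
  rw [this]
  rfl

variable [CompleteSpace E]

lemma mulInvariant_injective (x : G) {Z : GroupLieAlgebra 𝓘(𝕜, E) G}
    (h : mulInvariantVectorField Z x = 0) : Z = 0 := by
  have hm : ∀ (g y : G), MDifferentiableAt 𝓘(𝕜, E) 𝓘(𝕜, E) (fun z : G => g * z) y := fun g y =>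
    (contMDiff_mul_left (I := 𝓘(𝕜, E)) (n := ω)).contMDiffAt.mdifferentiableAt (by simp)
  have e := mfderiv_comp_apply (I := 𝓘(𝕜, E)) (I' := 𝓘(𝕜, E)) (I'' := 𝓘(𝕜, E)) (1 : G)
    (hm x⁻¹ (x * 1)) (hm x 1) Z
  have e2 : (fun z : G => x⁻¹ * z) ∘ (fun z : G => x * z) = id := by ext; simp
  rw [e2, mfderiv_id] at e
  refine e.trans ?_
  rw [mulInvariantVectorField] at h
  rw [h]
  exact map_zero _

lemma mdifferentiableAt_leftInvariant (Z : GroupLieAlgebra 𝓘(𝕜, E) G) (x : G) :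
    MDifferentiableAt 𝓘(𝕜, E) 𝓘(𝕜, E).tangent
      (fun g : G => (⟨g, mulInvariantVectorField Z g⟩ : TangentBundle 𝓘(𝕜, E) G)) x :=
  (contMDiff_leftInvariant Z).mdifferentiable (by simp) x

lemma mlieBracket_smul_leftInvariant (V W : GroupLieAlgebra 𝓘(𝕜, E) G) {f : G → 𝕜} {x : G}
    (hf : MDifferentiableAt 𝓘(𝕜, E) 𝓘(𝕜, 𝕜) f x) :
    mlieBracket 𝓘(𝕜, E) (mulInvariantVectorField V) (f • mulInvariantVectorField W) x =
      leftDeriv 𝕜 E V f x • mulInvariantVectorField W x +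
        f x • mulInvariantVectorField ⁅V, W⁆ x := by
  rw [mlieBracket_smul_right hf (mdifferentiableAt_leftInvariant W x), GroupLieAlgebra.bracket_def,
    mulInvariantVector_mlieBracket]
  rfl

lemma leftDeriv_lie (V W : GroupLieAlgebra 𝓘(𝕜, E) G) {f : G → 𝕜} {U : Set G}
    (hU : IsOpen U) (hf : ContMDiffOn 𝓘(𝕜, E) 𝓘(𝕜, 𝕜) ω f U) {x : G} (hx : x ∈ U) :
    leftDeriv 𝕜 E ⁅V, W⁆ f x =
      leftDeriv 𝕜 E V (leftDeriv 𝕜 E W f) x - leftDeriv 𝕜 E W (leftDeriv 𝕜 E V f) x := by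
  have hd : ∀ {h : G → 𝕜}, ContMDiffOn 𝓘(𝕜, E) 𝓘(𝕜, 𝕜) ω h U → ∀ {y}, y ∈ U →
      MDifferentiableAt 𝓘(𝕜, E) 𝓘(𝕜, 𝕜) h y := fun hh y hy =>
    (hh.contMDiffAt (hU.mem_nhds hy)).mdifferentiableAt (by simp)
  have hV := contMDiffOn_leftDeriv V hU hf
  have hW := contMDiffOn_leftDeriv W hU hf
  by_cases hE : ∃ X : GroupLieAlgebra 𝓘(𝕜, E) G, X ≠ 0
  swap
  · push Not at hE
    have h0 : ∀ (Z : GroupLieAlgebra 𝓘(𝕜, E) G) (h : G → 𝕜), leftDeriv 𝕜 E Z h x = 0 := by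
      intro Z h
      rw [leftDeriv, show mulInvariantVectorField Z x = 0 from hE _, map_zero]
    simp [h0]
  obtain ⟨X, hX⟩ := hE
  have hX : mulInvariantVectorField X x ≠ 0 := fun h => hX (mulInvariant_injective x h)
  have sm : ∀ (P Q : GroupLieAlgebra 𝓘(𝕜, E) G),
      mlieBracket 𝓘(𝕜, E) (mulInvariantVectorField P) (mlieBracket 𝓘(𝕜, E)
        (mulInvariantVectorField Q) (f • mulInvariantVectorField X)) x =
      (leftDeriv 𝕜 E P (leftDeriv 𝕜 E Q f) x • mulInvariantVectorField X x +
        leftDeriv 𝕜 E Q f x • mulInvariantVectorField ⁅P, X⁆ x) +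
      (leftDeriv 𝕜 E P f x • mulInvariantVectorField ⁅Q, X⁆ x +
        f x • mulInvariantVectorField ⁅P, ⁅Q, X⁆⁆ x) := by
    intro P Q
    have hQ := contMDiffOn_leftDeriv Q hU hf
    have e : mlieBracket 𝓘(𝕜, E) (mulInvariantVectorField Q) (f • mulInvariantVectorField X)
        =ᶠ[𝓝 x] leftDeriv 𝕜 E Q f • mulInvariantVectorField X +
          f • mulInvariantVectorField ⁅Q, X⁆ := by
      filter_upwards [hU.mem_nhds hx] with y hy
      exact mlieBracket_smul_leftInvariant Q X (hd hf hy)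
    refine (EventuallyEq.mlieBracket_vectorField_eq (I := 𝓘(𝕜, E))
      (EventuallyEq.refl (𝓝 x) (mulInvariantVectorField P)) e).trans ?_
    rw [mlieBracket_add_right ((hd hQ hx).smul_section (mdifferentiableAt_leftInvariant X x))
        ((hd hf hx).smul_section (mdifferentiableAt_leftInvariant ⁅Q, X⁆ x)),
      mlieBracket_smul_leftInvariant _ _ (hd hQ hx), mlieBracket_smul_leftInvariant _ _ (hd hf hx)]
  have sX : ContMDiffAt 𝓘(𝕜, E) 𝓘(𝕜, E).tangent (minSmoothness 𝕜 2)
      (fun g : G => (⟨g, (f • mulInvariantVectorField X) g⟩ : TangentBundle 𝓘(𝕜, E) G)) x :=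
    ((hf.contMDiffAt (hU.mem_nhds hx)).smul_section
      (contMDiff_leftInvariant X).contMDiffAt).of_le le_top
  have J := leibniz_identity_mlieBracket_apply
    ((contMDiff_leftInvariant V).contMDiffAt.of_le le_top)
    ((contMDiff_leftInvariant W).contMDiffAt.of_le le_top) sX
  rw [← mulInvariantVector_mlieBracket, ← GroupLieAlgebra.bracket_def, sm, sm,
    mlieBracket_smul_leftInvariant _ _ (hd hf hx), leibniz_lie V W X,
    mulInvariantVectorField_add, Pi.add_apply, smul_add] at J
  have K : (leftDeriv 𝕜 E ⁅V, W⁆ f x -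
      (leftDeriv 𝕜 E V (leftDeriv 𝕜 E W f) x - leftDeriv 𝕜 E W (leftDeriv 𝕜 E V f) x)) •
      mulInvariantVectorField X x = 0 := by
    rw [sub_smul, sub_smul]
    linear_combination (norm := module) -J
  exact sub_eq_zero.mp ((smul_eq_zero.mp K).resolve_right hX)

open TopologicalSpace

variable (𝕜 E) in
/-- The algebra `O_{G₀}(U)` of analytic functions on an open subset `U` of `G₀`. -/
abbrev AnalyticSections (U : Opens G) : Type _ := C^ω⟮𝓘(𝕜, E), U; 𝓘(𝕜, 𝕜), 𝕜⟯

namespace AnalyticSections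

/-- Extension of an analytic function on `U` by zero. -/
def extend {U : Opens G} (f : AnalyticSections 𝕜 E U) : G → 𝕜 :=
  Function.extend (Subtype.val : U → G) f 0

lemma extend_coe {U : Opens G} (f : AnalyticSections 𝕜 E U) (x : U) : f.extend (x : G) = f x :=
  Subtype.val_injective.extend_apply _ _ x

lemma contMDiffOn_extend {U : Opens G} (f : AnalyticSections 𝕜 E U) :
    ContMDiffOn 𝓘(𝕜, E) 𝓘(𝕜, 𝕜) ω f.extend U := by
  intro x hx
  refine ContMDiffAt.contMDiffWithinAt ?_
  rw [← contMDiffAt_subtype_iff (x := (⟨x, hx⟩ : U))]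
  have : (fun y : U => f.extend y) = f := funext f.extend_coe
  rw [this]
  exact f.contMDiff.contMDiffAt

lemma mdifferentiableAt_extend {U : Opens G} (f : AnalyticSections 𝕜 E U) (x : U) :
    MDifferentiableAt 𝓘(𝕜, E) 𝓘(𝕜, 𝕜) f.extend (x : G) :=
  (f.contMDiffOn_extend.contMDiffAt (U.isOpen.mem_nhds x.2)).mdifferentiableAt (by simp)

/-- The restriction `O_{G₀}(U) → O_{G₀}(V)` for `V ⊆ U`. -/
def res {U V : Opens G} (h : V ≤ U) : AnalyticSections 𝕜 E U →ₐ[𝕜] AnalyticSections 𝕜 E V where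
  toFun f := f.comp ⟨Opens.inclusion h, contMDiff_inclusion h⟩
  map_one' := rfl
  map_mul' _ _ := rfl
  map_zero' := rfl
  map_add' _ _ := rfl
  commutes' _ := rfl

lemma res_apply {U V : Opens G} (h : V ≤ U) (f : AnalyticSections 𝕜 E U) (x : V) :
    res h f x = f ⟨x, h x.2⟩ := rfl

/-- The action of the Lie algebra of `G₀` on `O_{G₀}(U)` by left invariant vector fields. -/
def action (U : Opens G) : GroupLieAlgebra 𝓘(𝕜, E) G →ₗ⁅𝕜⁆
    Derivation 𝕜 (AnalyticSections 𝕜 E U) (AnalyticSections 𝕜 E U) :=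
  let D : GroupLieAlgebra 𝓘(𝕜, E) G → AnalyticSections 𝕜 E U → AnalyticSections 𝕜 E U :=
    fun Z f => ⟨fun x => leftDeriv 𝕜 E Z f.extend x, fun x =>
      contMDiffAt_subtype_iff.mpr ((contMDiffOn_leftDeriv Z U.isOpen f.contMDiffOn_extend).contMDiffAt
        (U.isOpen.mem_nhds x.2))⟩
  have hD : ∀ Z f (x : U), D Z f x = leftDeriv 𝕜 E Z f.extend x := fun _ _ _ => rfl
  have hev : ∀ {f : AnalyticSections 𝕜 E U} {g : G → 𝕜}, (∀ x : U, f x = g x) → ∀ x : U,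
      f.extend =ᶠ[𝓝 (x : G)] g := fun {f g} hfg x => by
    filter_upwards [U.isOpen.mem_nhds x.2] with y hy
    exact (f.extend_coe ⟨y, hy⟩).trans (hfg ⟨y, hy⟩)
  { toFun := fun Z => Derivation.mk'
      { toFun := D Z
        map_add' := fun f g => by
          ext x
          rw [hD, leftDeriv_congr Z (hev (g := f.extend + g.extend) (fun y => by
            simp [extend_coe]) x), leftDeriv, mvfderiv_add (f.mdifferentiableAt_extend x)
            (g.mdifferentiableAt_extend x)]
          rfl
        map_smul' := fun c f => by
          ext x
          rw [hD, leftDeriv_congr Z (hev (g := (fun _ => c) * f.extend) (fun y => by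
            simp [extend_coe]) x), leftDeriv, mvfderiv_mul mdifferentiableAt_const
            (f.mdifferentiableAt_extend x), mvfderiv_const]
          simp [hD, leftDeriv] }
      (fun f g => by
        ext x
        change D Z (f * g) x = f x * D Z g x + g x * D Z f x
        rw [hD, leftDeriv_congr Z (hev (g := f.extend * g.extend) (fun y => by
            simp [extend_coe]) x), leftDeriv, mvfderiv_mul (f.mdifferentiableAt_extend x)
            (g.mdifferentiableAt_extend x)]
        simp [hD, leftDeriv, extend_coe])
    map_add' := fun Z W => by
      ext f x
      change leftDeriv 𝕜 E (Z + W) f.extend x = leftDeriv 𝕜 E Z f.extend x +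
        leftDeriv 𝕜 E W f.extend x
      rw [leftDeriv, mulInvariantVectorField_add]
      exact map_add _ _ _
    map_smul' := fun c Z => by
      ext f x
      change leftDeriv 𝕜 E (c • Z) f.extend x = c • leftDeriv 𝕜 E Z f.extend x
      rw [leftDeriv, mulInvariantVectorField_smul]
      exact map_smul _ _ _
    map_lie' := fun {Z W} => by
      ext f x
      change leftDeriv 𝕜 E ⁅Z, W⁆ f.extend x = leftDeriv 𝕜 E Z (D W f).extend x -
        leftDeriv 𝕜 E W (D Z f).extend x
      rw [leftDeriv_congr Z (hev (hD W f) x), leftDeriv_congr W (hev (hD Z f) x)]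
      exact leftDeriv_lie Z W U.isOpen f.contMDiffOn_extend x.2 }

lemma action_apply {U : Opens G} (Z : GroupLieAlgebra 𝓘(𝕜, E) G) (f : AnalyticSections 𝕜 E U)
    (x : U) : action U Z f x = leftDeriv 𝕜 E Z f.extend x := rfl

lemma res_action {U V : Opens G} (h : V ≤ U) (Z : GroupLieAlgebra 𝓘(𝕜, E) G)
    (f : AnalyticSections 𝕜 E U) : res h (action U Z f) = action V Z (res h f) := by
  ext x
  rw [res_apply, action_apply, action_apply]
  refine leftDeriv_congr Z ?_
  filter_upwards [V.isOpen.mem_nhds x.2] with y hy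
  exact (f.extend_coe ⟨y, h hy⟩).trans ((res h f).extend_coe ⟨y, hy⟩).symm

end AnalyticSections

end AnalyticGroup

section LocalizedDerivation

variable {k : Type*} [Field k] {A : Type*} [CommRing A] [Algebra k A]

/-- The extension of a derivation to a localization, `D(a / s) = (s D(a) - a D(s)) / s²`. -/
def locDeriv (D : Derivation k A A) (S : Submonoid A) (x : LocalizedModule S A) :
    LocalizedModule S A :=
  x.liftOn (fun p => LocalizedModule.mk ((p.2 : A) * D p.1 - p.1 * D (p.2 : A)) (p.2 * p.2)) <| by
    rintro ⟨a, s⟩ ⟨a', s'⟩ ⟨u, h⟩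
    simp only [Submonoid.smul_def, smul_eq_mul] at h
    have hD := congrArg D h
    simp only [Derivation.leibniz, smul_eq_mul] at hD
    refine LocalizedModule.mk_eq.mpr ⟨u * u, ?_⟩
    simp only [Submonoid.smul_def, smul_eq_mul, Submonoid.coe_mul]
    linear_combination (u : A) * s * s' * hD - (s * s' * D (u : A) + u * (s' * D (s : A)
      + s * D (s' : A))) * h

lemma locDeriv_mk (D : Derivation k A A) (S : Submonoid A) (a : A) (s : S) :
    locDeriv D S (LocalizedModule.mk a s) =
      LocalizedModule.mk ((s : A) * D a - a * D (s : A)) (s * s) :=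
  LocalizedModule.liftOn_mk _ _ _

lemma locDeriv_add_right (D : Derivation k A A) (S : Submonoid A) (x y : LocalizedModule S A) :
    locDeriv D S (x + y) = locDeriv D S x + locDeriv D S y := by
  induction x, y using LocalizedModule.induction_on₂ with | _ a b s t
  rw [LocalizedModule.mk_add_mk, locDeriv_mk, locDeriv_mk, locDeriv_mk, LocalizedModule.mk_add_mk]
  refine LocalizedModule.mk_eq.mpr ⟨1, ?_⟩
  simp only [Submonoid.smul_def, smul_eq_mul, Submonoid.coe_mul, Derivation.leibniz, map_add]
  ring

lemma locDeriv_mul (D : Derivation k A A) (S : Submonoid A) (x y : LocalizedModule S A) :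
    locDeriv D S (x * y) = x * locDeriv D S y + y * locDeriv D S x := by
  induction x, y using LocalizedModule.induction_on₂ with | _ a b s t
  have hm : ∀ (a b : A) (s t : S), (LocalizedModule.mk a s * LocalizedModule.mk b t :
      LocalizedModule S A) = LocalizedModule.mk (a * b) (s * t) :=
    fun _ _ _ _ => LocalizedModule.mk_mul_mk
  simp only [hm, locDeriv_mk, LocalizedModule.mk_add_mk]
  refine LocalizedModule.mk_eq.mpr ⟨1, ?_⟩
  simp only [Submonoid.smul_def, smul_eq_mul, Submonoid.coe_mul, Derivation.leibniz]
  ring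

lemma locDeriv_algebraMap_smul (D : Derivation k A A) (S : Submonoid A) (c : k)
    (x : LocalizedModule S A) :
    locDeriv D S (algebraMap k A c • x) = algebraMap k A c • locDeriv D S x := by
  induction x with | _ a s
  rw [LocalizedModule.smul'_mk, locDeriv_mk, locDeriv_mk, LocalizedModule.smul'_mk]
  congr 1
  simp only [smul_eq_mul, Derivation.leibniz, Derivation.map_algebraMap]
  ring

lemma locDeriv_add_left (D D' : Derivation k A A) (S : Submonoid A) (x : LocalizedModule S A) :
    locDeriv (D + D') S x = locDeriv D S x + locDeriv D' S x := by
  induction x with | _ a s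
  simp only [locDeriv_mk, LocalizedModule.mk_add_mk]
  refine LocalizedModule.mk_eq.mpr ⟨1, ?_⟩
  simp only [Submonoid.smul_def, smul_eq_mul, Submonoid.coe_mul, Derivation.add_apply]
  ring

lemma locDeriv_smul_left (c : k) (D : Derivation k A A) (S : Submonoid A)
    (x : LocalizedModule S A) :
    locDeriv (c • D) S x = algebraMap k A c • locDeriv D S x := by
  induction x with | _ a s
  rw [locDeriv_mk, locDeriv_mk, LocalizedModule.smul'_mk]
  congr 1
  simp only [smul_eq_mul, Derivation.smul_apply, Algebra.smul_def]
  ring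

lemma locDeriv_lie (D D' : Derivation k A A) (S : Submonoid A) (x : LocalizedModule S A) :
    locDeriv ⁅D, D'⁆ S x = locDeriv D S (locDeriv D' S x) - locDeriv D' S (locDeriv D S x) := by
  induction x with | _ a s
  simp only [locDeriv_mk, sub_eq_add_neg, ← LocalizedModule.mk_neg, LocalizedModule.mk_add_mk]
  refine LocalizedModule.mk_eq.mpr ⟨1, ?_⟩
  simp only [Submonoid.smul_def, smul_eq_mul, Submonoid.coe_mul, Derivation.commutator_apply,
    Derivation.leibniz, map_add, map_neg]
  ring

end LocalizedDerivation

section AlgebraicGroup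

open AlgebraicGeometry TopologicalSpace CategoryTheory

universe u v

/-- The ring `O_{G₀}(U)` of sections of the structure sheaf of `G₀ = Spec A` over an open
subset `U`. -/
def AlgebraicSections (A : Type u) [CommRing A] (U : Opens (PrimeSpectrum.Top A)) : Type u :=
  (structureSheafInType A A).obj.obj (Opposite.op U)

namespace AlgebraicSections

variable {k : Type v} [Field k] {A : Type u} [CommRing A] [Algebra k A]

instance (U : Opens (PrimeSpectrum.Top A)) : CommRing (AlgebraicSections A U) :=
  inferInstanceAs (CommRing ((structureSheafInType A A).obj.obj (Opposite.op U)))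

instance (U : Opens (PrimeSpectrum.Top A)) : Algebra A (AlgebraicSections A U) :=
  inferInstanceAs (Algebra A ((structureSheafInType A A).obj.obj (Opposite.op U)))

instance (U : Opens (PrimeSpectrum.Top A)) : Algebra k (AlgebraicSections A U) :=
  Algebra.compHom _ (algebraMap k A)

variable {U V : Opens (PrimeSpectrum.Top A)}

@[ext] lemma ext {f g : AlgebraicSections A U} (h : ∀ x, f.1 x = g.1 x) : f = g :=
  Subtype.ext (funext h)

/-- The restriction `O_{G₀}(U) → O_{G₀}(V)` for `V ⊆ U`. -/
def res (h : V ≤ U) : AlgebraicSections A U →ₐ[k] AlgebraicSections A V where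
  toFun f := (structureSheafInType A A).1.map (homOfLE h).op f
  map_one' := rfl
  map_mul' _ _ := rfl
  map_zero' := rfl
  map_add' _ _ := rfl
  commutes' _ := rfl

lemma res_apply (h : V ≤ U) (f : AlgebraicSections A U) (x : V) :
    (res (k := k) h f).1 x = f.1 ⟨x, h x.2⟩ := rfl

/-- The extension to `O_{G₀}(U)` of a derivation of the coordinate ring `A`. -/
def extendDerivation (U : Opens (PrimeSpectrum.Top A)) :
    Derivation k A A →ₗ⁅k⁆ Derivation k (AlgebraicSections A U) (AlgebraicSections A U) :=
  let E : Derivation k A A → AlgebraicSections A U → AlgebraicSections A U := fun D f =>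
    ⟨fun x => locDeriv D _ (f.1 x), fun x => by
      obtain ⟨W, hxW, hWU, a, s, hf⟩ := f.2 x
      refine ⟨W, hxW, hWU, s * D a - a * D s, s * s, fun y => ?_⟩
      obtain ⟨hs, hy⟩ := hf y
      exact ⟨fun h => ((PrimeSpectrum.isPrime y.1).mem_or_mem h).elim hs hs,
        (congrArg (locDeriv D _) hy).trans (locDeriv_mk D _ a ⟨s, hs⟩)⟩⟩
  { toFun := fun D => Derivation.mk'
      { toFun := E D
        map_add' := fun f g => ext fun x => locDeriv_add_right D _ (f.1 x) (g.1 x)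
        map_smul' := fun c f => ext fun x => locDeriv_algebraMap_smul D _ c (f.1 x) }
      (fun f g => ext fun x => locDeriv_mul D _ (f.1 x) (g.1 x))
    map_add' := fun D D' => by
      ext f x
      exact locDeriv_add_left D D' _ (f.1 x)
    map_smul' := fun c D => by
      ext f x
      exact locDeriv_smul_left c D _ (f.1 x)
    map_lie' := fun {D D'} => by
      ext f x
      exact locDeriv_lie D D' _ (f.1 x) }

lemma extendDerivation_apply (D : Derivation k A A) (f : AlgebraicSections A U) (x : U) :
    (extendDerivation U D f).1 x = locDeriv D _ (f.1 x) := rfl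

lemma res_extendDerivation (h : V ≤ U) (D : Derivation k A A) (f : AlgebraicSections A U) :
    res (k := k) h (extendDerivation U D f) = extendDerivation V D (res (k := k) h f) := rfl

end AlgebraicSections

end AlgebraicGroup

section GradedParts

attribute [local instance 100] LieRing.ofAssociativeRing

variable (k : Type*) [Field k] [CharZero k] (𝔤 : Type*) [AddCommGroup 𝔤] [Module k 𝔤]
  [LieSuperalgebra k 𝔤]

/-- The homogeneous part of parity `i` of `U(𝔤₀) ⊗ ⋀(𝔤₁)`, where `U(𝔤₀)` is purely even. -/
def gammaDomainParity (i : ZMod 2) : Submodule k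
    (UniversalEnvelopingAlgebra k (superPart k 𝔤 0) ⊗[k] ExteriorAlgebra k (superPart k 𝔤 1)) :=
  LinearMap.range (LinearMap.lTensor (UniversalEnvelopingAlgebra k (superPart k 𝔤 0))
    (extParity k (superPart k 𝔤 1) i).subtype)

/-- The homogeneous part of parity `i` of `R ⊗ ⋀(V)^*`, where `R` is purely even. -/
def dualTensorParity (V : Type*) [AddCommGroup V] [Module k V] (R : Type*) [CommRing R]
    [Algebra k R] (i : ZMod 2) : Submodule k (R ⊗[k] SuperHom (extParity k V) k) :=
  LinearMap.range (LinearMap.lTensor R (SuperHom.parity (extParity k V) k i).subtype)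

variable {k 𝔤} {R : Type*} [CommRing R] [Algebra k R]

/-- The homogeneous part of parity `i` of `Hom_{U(𝔤₀)}(U(𝔤), R)`. -/
def superSections.parity (δ : superPart k 𝔤 0 →ₗ⁅k⁆ Derivation k R R) (i : ZMod 2) :
    Submodule k (superSections δ) :=
  (SuperHom.parity (SuperUEA.gr k 𝔤) R i).comap (superSections δ).val.toLinearMap

/-- The elements of degree `n` of `Hom_{U(𝔤₀)}(U(𝔤), R)`: the `f` such that `f ∘ γ` vanishes on
`⋀ᵐ(𝔤₁)` for all `m ≠ n`. -/
def superSections.degree (δ : superPart k 𝔤 0 →ₗ⁅k⁆ Derivation k R R) (n : ℤ) :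
    Submodule k (superSections δ) where
  carrier := {f | ∀ m : ℕ, (m : ℤ) ≠ n → ∀ Y ∈ ⋀[k]^m (superPart k 𝔤 1),
    f.1 (antisymmetrizer k 𝔤 Y) = 0}
  add_mem' {f g} hf hg m hm Y hY := by
    rw [Subalgebra.coe_add, SuperHom.add_apply, hf m hm Y hY, hg m hm Y hY, add_zero]
  zero_mem' _ _ _ _ := rfl
  smul_mem' a f hf m hm Y hY := by
    rw [Subalgebra.coe_smul, SuperHom.smul_apply, hf m hm Y hY, smul_zero]

/-- The morphism `f ↦ φ ∘ f` from `Hom_{U(𝔤₀)}(U(𝔤), R)` to `Hom_{U(𝔤₀)}(U(𝔤), R')` for a morphism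
`φ : R → R'` that commutes with the actions of `𝔤₀`. -/
def superSections.map {R' : Type*} [CommRing R'] [Algebra k R']
    {δ : superPart k 𝔤 0 →ₗ⁅k⁆ Derivation k R R} {δ' : superPart k 𝔤 0 →ₗ⁅k⁆ Derivation k R' R'}
    (φ : R →ₐ[k] R') (h : ∀ Z r, φ (δ Z r) = δ' Z (φ r)) :
    superSections δ →ₐ[k] superSections δ' :=
  ((SuperHom.map φ).comp (superSections δ).val).codRestrict (superSections δ') fun f =>
    (evenLinear_iff δ' _).mpr fun Z u => by
      have := (evenLinear_iff δ f.1).mp f.2 Z u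
      change φ (f.1 _) = δ' Z (φ (f.1 u))
      rw [this, h]

lemma superSections.map_apply {R' : Type*} [CommRing R'] [Algebra k R']
    {δ : superPart k 𝔤 0 →ₗ⁅k⁆ Derivation k R R} {δ' : superPart k 𝔤 0 →ₗ⁅k⁆ Derivation k R' R'}
    (φ : R →ₐ[k] R') (h : ∀ Z r, φ (δ Z r) = δ' Z (φ r)) (f : superSections δ)
    (u : SuperUEA k 𝔤) : (superSections.map φ h f).1 u = φ (f.1 u) := rfl

open TopologicalSpace

/-- Let `O` be a presheaf of commutative algebras on `X` on which `𝔤₀` acts by derivations `δ`,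
compatibly with the restrictions `res`. The presheaf of superalgebras
`U ↦ O_G(U) = Hom_{U(𝔤₀)}(U(𝔤), O(U))` is globally split: there are isomorphisms of superalgebras
`O_G(U) ≃ Hom(⋀(𝔤₁), O(U)) ≃ O(U) ⊗ ⋀(𝔤₁)^*` for each open `U`, the first one being `f ↦ f ∘ γ` and
the second one the canonical one, which commute with the restrictions; and `O_G` carries the
resulting `ℤ`-gradation, in which `f` has degree `n` if `f ∘ γ` is concentrated on `⋀ⁿ(𝔤₁)`. -/
def GloballySplit {X : Type*} [TopologicalSpace X] (O : Opens X → Type*) [∀ U, CommRing (O U)]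
    [∀ U, Algebra k (O U)] (δ : ∀ U, superPart k 𝔤 0 →ₗ⁅k⁆ Derivation k (O U) (O U))
    (res : ∀ {U V : Opens X}, V ≤ U → O U →ₐ[k] O V)
    (hres : ∀ {U V : Opens X} (h : V ≤ U) Z r, res h (δ U Z r) = δ V Z (res h r)) : Prop :=
  ∃ (φ : ∀ U, superSections (δ U) ≃ₐ[k] SuperHom (extParity k (superPart k 𝔤 1)) (O U))
    (ψ : ∀ U, SuperHom (extParity k (superPart k 𝔤 1)) (O U) ≃ₐ[k]
      O U ⊗[k] SuperHom (extParity k (superPart k 𝔤 1)) k),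
    (∀ U f Y, φ U f Y = f.1 (antisymmetrizer k 𝔤 Y)) ∧
    (∀ U r (η : SuperHom (extParity k (superPart k 𝔤 1)) k) Y,
      (ψ U).symm (r ⊗ₜ[k] η) Y = η Y • r) ∧
    (∀ U i, (superSections.parity (δ U) i).map (φ U).toLinearMap =
      SuperHom.parity (extParity k (superPart k 𝔤 1)) (O U) i) ∧
    (∀ U i, (SuperHom.parity (extParity k (superPart k 𝔤 1)) (O U) i).map (ψ U).toLinearMap =
      dualTensorParity k (superPart k 𝔤 1) (O U) i) ∧
    (∀ U V (h : V ≤ U) f,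
      φ V (superSections.map (res h) (hres h) f) = SuperHom.map (res h) (φ U f)) ∧
    (∀ U V (h : V ≤ U) f, ψ V (SuperHom.map (res h) f) =
      Algebra.TensorProduct.map (res h) (AlgHom.id k _) (ψ U f)) ∧
    (∀ U, Nonempty (GradedAlgebra (superSections.degree (δ U)))) ∧
    (∀ U n, superSections.degree (δ U) n ≤ superSections.parity (δ U) (n : ZMod 2)) ∧
    (∀ U V (h : V ≤ U) n f, f ∈ superSections.degree (δ U) n →
      superSections.map (res h) (hres h) f ∈ superSections.degree (δ V) n)

end GradedParts

section AnalyticSHCP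

open scoped Manifold ContDiff
open TopologicalSpace

/-- An analytic super Harish-Chandra pair `(G₀, 𝔤)`: an analytic Lie group `G₀` and a Lie
superalgebra `𝔤`, with an identification of `𝔤₀` with the Lie algebra of `G₀` and an analytic
action `Ad` of `G₀` on `𝔤` by automorphisms that induces the adjoint action on `𝔤₀` and whose
differential is the bracket. -/
structure AnalyticSHCP (𝕜 : Type*) [NontriviallyNormedField 𝕜] [CharZero 𝕜] (E : Type*)
    [NormedAddCommGroup E] [NormedSpace 𝕜 E] [CompleteSpace E] (G : Type*) [TopologicalSpace G]
    [ChartedSpace E G] [Group G] [LieGroup 𝓘(𝕜, E) ω G] (𝔤 : Type*) [AddCommGroup 𝔤] [Module 𝕜 𝔤]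
    [LieSuperalgebra 𝕜 𝔤] where
  lieEquiv : superPart 𝕜 𝔤 0 ≃ₗ⁅𝕜⁆ GroupLieAlgebra 𝓘(𝕜, E) G
  Ad : G →* (𝔤 →ₗ[𝕜] 𝔤)
  Ad_mem : ∀ (g : G) {i : ZMod 2} {X : 𝔤}, X ∈ superPart 𝕜 𝔤 i → Ad g X ∈ superPart 𝕜 𝔤 i
  Ad_bracket : ∀ (g : G) (X Y : 𝔤),
    Ad g (superBracket 𝕜 𝔤 X Y) = superBracket 𝕜 𝔤 (Ad g X) (Ad g Y)
  contMDiff_Ad : ∀ (ℓ : Module.Dual 𝕜 𝔤) (X : 𝔤),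
    ContMDiff 𝓘(𝕜, E) 𝓘(𝕜, 𝕜) ω fun g : G => ℓ (Ad g X)
  Ad_even : ∀ (g : G) (Z : superPart 𝕜 𝔤 0),
    (lieEquiv ⟨Ad g Z, Ad_mem g Z.2⟩ : E) =
      mfderiv 𝓘(𝕜, E) 𝓘(𝕜, E) (fun y : G => g * y * g⁻¹) 1 (lieEquiv Z)
  deriv_Ad : ∀ (ℓ : Module.Dual 𝕜 𝔤) (Z : superPart 𝕜 𝔤 0) (X : 𝔤),
    mvfderiv 𝓘(𝕜, E) (fun g : G => ℓ (Ad g X)) 1 (lieEquiv Z) = ℓ (superBracket 𝕜 𝔤 Z X)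

namespace AnalyticSHCP

variable {𝕜 : Type*} [NontriviallyNormedField 𝕜] [CharZero 𝕜] {E : Type*}
  [NormedAddCommGroup E] [NormedSpace 𝕜 E] [CompleteSpace E] {G : Type*} [TopologicalSpace G]
  [ChartedSpace E G] [Group G] [LieGroup 𝓘(𝕜, E) ω G] {𝔤 : Type*} [AddCommGroup 𝔤] [Module 𝕜 𝔤]
  [LieSuperalgebra 𝕜 𝔤] (S : AnalyticSHCP 𝕜 E G 𝔤)

/-- The action of `𝔤₀` on `O_{G₀}(U)` by left invariant vector fields. -/
def action (U : Opens G) : superPart 𝕜 𝔤 0 →ₗ⁅𝕜⁆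
    Derivation 𝕜 (AnalyticSections 𝕜 E U) (AnalyticSections 𝕜 E U) :=
  (AnalyticSections.action U).comp S.lieEquiv.toLieHom

lemma res_action {U V : Opens G} (h : V ≤ U) (Z : superPart 𝕜 𝔤 0)
    (f : AnalyticSections 𝕜 E U) :
    AnalyticSections.res h (S.action U Z f) = S.action V Z (AnalyticSections.res h f) :=
  AnalyticSections.res_action h (S.lieEquiv Z) f

end AnalyticSHCP

end AnalyticSHCP

section AlgebraicSHCP

open AlgebraicGeometry TopologicalSpace Coalgebra

variable (k : Type*) [Field k] (A : Type*) [CommRing A] [HopfAlgebra k A]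

/-- The Lie algebra of the affine group `G₀ = Spec A`: the derivations `D` of `A` that are left
invariant, `Δ ∘ D = (id ⊗ D) ∘ Δ`. -/
def leftInvariantDerivations : LieSubalgebra k (Derivation k A A) where
  carrier := {D | ∀ a, comul (R := k) (D a) = LinearMap.lTensor A (D : A →ₗ[k] A) (comul a)}
  add_mem' {D D'} hD hD' a := by
    rw [Derivation.add_apply, map_add, hD, hD', Derivation.coe_add_linearMap, LinearMap.lTensor_add]
    rfl
  zero_mem' a := by simp
  smul_mem' c D hD a := by
    rw [Derivation.smul_apply, map_smul, hD, Derivation.coe_smul_linearMap, LinearMap.lTensor_smul]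
    rfl
  lie_mem' {D D'} hD hD' a := by
    have e : ((⁅D, D'⁆ : Derivation k A A) : A →ₗ[k] A) =
        (D : A →ₗ[k] A) ∘ₗ (D' : A →ₗ[k] A) - (D' : A →ₗ[k] A) ∘ₗ (D : A →ₗ[k] A) := by
      ext; exact Derivation.commutator_apply ..
    rw [Derivation.commutator_apply, map_sub, hD, hD', hD', hD, e, LinearMap.lTensor_sub,
      LinearMap.lTensor_comp, LinearMap.lTensor_comp]
    rfl

variable {k A}

/-- The tangent vector `ε ∘ D` at the identity of a left invariant derivation `D`. -/
def tangentVector : leftInvariantDerivations k A →ₗ[k] A →ₗ[k] k where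
  toFun D := counit ∘ₗ ((D : Derivation k A A) : A →ₗ[k] A)
  map_add' D D' := by ext; simp
  map_smul' c D := by ext; simp

/-- The map `f ↦ ∑ f₁ S(f₃) z(f₂)`; its value at `g ∈ G₀` is the tangent vector `z` at the identity
applied to the function `y ↦ f(g y g⁻¹)`. -/
def adjointPullback (z : A →ₗ[k] k) : A →ₗ[k] A :=
  LinearMap.mul' k A ∘ₗ
    LinearMap.lTensor A ((TensorProduct.lid k A).toLinearMap ∘ₗ
      TensorProduct.map z (HopfAlgebra.antipode k)) ∘ₗ
    LinearMap.lTensor A comul ∘ₗ comul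

/-- An algebraic super Harish-Chandra pair `(G₀, 𝔤)`: an affine algebraic group `G₀ = Spec A` and a
Lie superalgebra `𝔤`, with an identification of `𝔤₀` with the Lie algebra of `G₀` and an algebraic
action of `G₀` on `𝔤` by automorphisms (given by a coaction of `A`) that induces the adjoint action
on `𝔤₀` and whose differential is the bracket. -/
structure AlgebraicSHCP (k : Type*) [Field k] [CharZero k] (A : Type*) [CommRing A]
    [HopfAlgebra k A] (𝔤 : Type*) [AddCommGroup 𝔤] [Module k 𝔤] [LieSuperalgebra k 𝔤] where
  lieEquiv : superPart k 𝔤 0 ≃ₗ⁅k⁆ leftInvariantDerivations k A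
  coact : 𝔤 →ₗ[k] 𝔤 ⊗[k] A
  coact_coassoc : (TensorProduct.assoc k 𝔤 A A).toLinearMap ∘ₗ LinearMap.rTensor A coact ∘ₗ coact =
    LinearMap.lTensor 𝔤 comul ∘ₗ coact
  coact_counit : (TensorProduct.rid k 𝔤).toLinearMap ∘ₗ LinearMap.lTensor 𝔤 counit ∘ₗ coact =
    LinearMap.id
  coact_mem : ∀ {i : ZMod 2} {X : 𝔤}, X ∈ superPart k 𝔤 i →
    coact X ∈ LinearMap.range (LinearMap.rTensor A (superPart k 𝔤 i).subtype)
  coact_bracket : ∀ X Y : 𝔤, coact (superBracket k 𝔤 X Y) =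
    TensorProduct.map (TensorProduct.lift (superBracket k 𝔤)) (LinearMap.mul' k A)
      (TensorProduct.tensorTensorTensorComm k 𝔤 A 𝔤 A (coact X ⊗ₜ[k] coact Y))
  coact_even : ∀ (Z : superPart k 𝔤 0) (f : A),
    adjointPullback (tangentVector (lieEquiv Z)) f =
      TensorProduct.lid k A (LinearMap.rTensor A (tangentVector.flip f ∘ₗ
        lieEquiv.toLinearMap ∘ₗ gradedProj (superPart k 𝔤) 0) (coact Z))
  deriv_coact : ∀ (Z : superPart k 𝔤 0) (X : 𝔤),
    TensorProduct.rid k 𝔤 (LinearMap.lTensor 𝔤 (tangentVector (lieEquiv Z)) (coact X)) =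
      superBracket k 𝔤 Z X

namespace AlgebraicSHCP

variable [CharZero k] {𝔤 : Type*} [AddCommGroup 𝔤] [Module k 𝔤] [LieSuperalgebra k 𝔤]
  (S : AlgebraicSHCP k A 𝔤)

/-- The action of `𝔤₀` on `O_{G₀}(U)` by left invariant derivations. -/
def action (U : Opens (PrimeSpectrum.Top A)) : superPart k 𝔤 0 →ₗ⁅k⁆
    Derivation k (AlgebraicSections A U) (AlgebraicSections A U) :=
  (AlgebraicSections.extendDerivation U).comp
    ((leftInvariantDerivations k A).incl.comp S.lieEquiv.toLieHom)

lemma res_action {U V : Opens (PrimeSpectrum.Top A)} (h : V ≤ U) (Z : superPart k 𝔤 0)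
    (f : AlgebraicSections A U) :
    AlgebraicSections.res (k := k) h (S.action U Z f) =
      S.action V Z (AlgebraicSections.res (k := k) h f) := rfl

end AlgebraicSHCP

end AlgebraicSHCP

end

open scoped Manifold ContDiff

/-! Put `M = U(𝔤₀) ⊗ ⋀(𝔤₁)`. Bijectivity of `gammaHat` is proved by constructing its inverse: right
multiplication of `U(𝔤)` on itself is transported to `M`, and the orbit map `u ↦ (1 ⊗ 1) · u` then
gives the inverse. `U(𝔤₀)` only plays the role of a coefficient ring, so no basis of it is used.

An even `Z` acts by `Y · Z = Z ⊗ Y - 1 ⊗ [Z, Y]`, an odd `x` by `Y · x = x ∧ Y + C(x, Y)` with `C`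
of lower degree. Wedging on the left matches multiplying on the right because the order-reversing
antisymmetrization `γ'` is used (`gammaRev`); it differs from `gammaHat` by the reversal of `⋀(𝔤₁)`.
For `Y = y₁ ∧ ⋯ ∧ yₚ`, with `Yᵢ` obtained by omitting `yᵢ`, the identity `p γ'(Y) = ∑ ± γ'(Yᵢ) yᵢ`
forces `(p + 1) C(x, Y) = -∑ ± (C(x, Yᵢ) · yᵢ - Yᵢ · [x, yᵢ])`. This recursion defines `C` (`corr`,
`corr_recursion`). All such alternating sums are values of one operator, `contract`.

It remains to check the relations of `𝔤` on `M`. Those involving an even element amount to the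
`𝔤₀`-equivariance of `C` (`innerAd_corr`). For odd `x`, `y`, let `D(x, y)` be the operator measuring
the failure of `x · y + y · x = [x, y]`. The recursion only says that `D` vanishes after contraction
in one variable (`contract_defectForm`); the Jacobi identity says that a cyclic sum of values of `D`
vanishes (`defect_jacobi`). Together, by induction on `p`, they give `(p + 2) D = 0` on `1 ⊗ ⋀ᵖ` for
`p > 0`, and `D = 0` since the characteristic is zero (`oddAct_oddAct`). Finally `gammaRev`
intertwines the right actions (`gammaRev_rightAct`), so it and the orbit map are mutually inverse.

For the second half, a `U(𝔤₀)`-linear map on `U(𝔤)` is the same as an arbitrary linear map on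
`⋀(𝔤₁)`, by the first half. That `f ↦ f ∘ γ` is multiplicative (`pullGamma_mul`) expresses that `γ`
respects coproducts: translation by an odd primitive element is a superderivation of the convolution
algebra, and both sides satisfy the same recursion on degree. Finite dimension of `𝔤` then gives the
tensor product form and the finiteness of the decomposition into degrees. -/

noncomputable section

/-! ### Contractions and derivations on exterior algebras. -/

section ExteriorContraction

variable {k : Type*} [Field k] {V : Type*} [AddCommGroup V] [Module k V]
  {N : Type*} [AddCommGroup N] [Module k N] {N' : Type*} [AddCommGroup N'] [Module k N']

namespace ExteriorAlgebra

/-- The component `⋀(V) → V ⊗ ⋀(V)` of the coproduct,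
`y₁ ∧ ⋯ ∧ yₚ ↦ ∑ᵢ (-1)^(i-1) yᵢ ⊗ y₁ ∧ ⋯ ŷᵢ ⋯ ∧ yₚ`. -/
def coderiv : ExteriorAlgebra k V →ₗ[k] V ⊗[k] ExteriorAlgebra k V :=
  CliffordAlgebra.foldr' (0 : QuadraticForm k V)
    (LinearMap.mk₂ k (fun (v : V) (p : ExteriorAlgebra k V × (V ⊗[k] ExteriorAlgebra k V)) =>
      v ⊗ₜ[k] p.1 - LinearMap.lTensor V (LinearMap.mulLeft k (ι k v)) p.2)
      (fun v w p => by
        have : LinearMap.mulLeft k (ι k (v + w)) =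
          LinearMap.mulLeft k (ι k v) + LinearMap.mulLeft k (ι k w) := by ext; simp [add_mul]
        rw [this, LinearMap.lTensor_add, TensorProduct.add_tmul, LinearMap.add_apply]; abel)
      (fun c v p => by
        have : LinearMap.mulLeft k (ι k (c • v)) = c • LinearMap.mulLeft k (ι k v) := by
          ext; simp
        rw [this, LinearMap.lTensor_smul, LinearMap.smul_apply, smul_sub, TensorProduct.smul_tmul'])
      (fun v p q => by simp [TensorProduct.tmul_add]; abel)
      (fun c v p => by simp [smul_sub]))
    -- Folding twice with the same `v` must give zero: the two terms `v ⊗ (v ∧ Y)` cancel, and `v ∧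
    -- v = 0` kills the rest.
    (fun v Y t => by
      have : LinearMap.mulLeft k (ι k v) ∘ₗ LinearMap.mulLeft k (ι k v) = 0 := by
        ext Z; simp [← mul_assoc]
      simp only [LinearMap.mk₂_apply, map_sub, LinearMap.lTensor_tmul, ← LinearMap.comp_apply,
        ← LinearMap.lTensor_comp, this]
      simp [ι])
    0

lemma coderiv_one : coderiv (1 : ExteriorAlgebra k V) = 0 := by
  rw [coderiv, ← map_one (algebraMap k (ExteriorAlgebra k V)), CliffordAlgebra.foldr'_algebraMap,
    smul_zero]

lemma coderiv_ι_mul (v : V) (Y : ExteriorAlgebra k V) : coderiv (ι k v * Y) =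
    v ⊗ₜ[k] Y - LinearMap.lTensor V (LinearMap.mulLeft k (ι k v)) (coderiv Y) :=
  CliffordAlgebra.foldr'_ι_mul (0 : QuadraticForm k V) _ _ _ _ _

/-- `contract B (y₁ ∧ ⋯ ∧ yₚ) = ∑ᵢ (-1)^(i-1) B yᵢ (y₁ ∧ ⋯ ŷᵢ ⋯ ∧ yₚ)`. -/
def contract : (V →ₗ[k] ExteriorAlgebra k V →ₗ[k] N) →ₗ[k] ExteriorAlgebra k V →ₗ[k] N :=
  LinearMap.lcomp k N coderiv ∘ₗ (TensorProduct.uncurry (.id k) V (ExteriorAlgebra k V) N)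

lemma contract_one (B : V →ₗ[k] ExteriorAlgebra k V →ₗ[k] N) : contract B 1 = 0 := by
  simp [contract, coderiv_one]

lemma contract_ι_mul (B : V →ₗ[k] ExteriorAlgebra k V →ₗ[k] N) (v : V) (Y : ExteriorAlgebra k V) :
    contract B (ι k v * Y) = B v Y - contract (B.compl₂ (LinearMap.mulLeft k (ι k v))) Y := by
  simp only [contract, LinearMap.comp_apply, LinearMap.lcomp_apply, coderiv_ι_mul, map_sub]
  congr 1
  generalize coderiv Y = t
  induction t using TensorProduct.induction_on with
  | zero => simp
  | add x y hx hy => simp only [map_add, hx, hy]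
  | tmul a b => simp

lemma contract_neg (B : V →ₗ[k] ExteriorAlgebra k V →ₗ[k] N) (Y : ExteriorAlgebra k V) :
    contract (-B) Y = -contract B Y := by rw [map_neg, LinearMap.neg_apply]

lemma contract_sub (B B' : V →ₗ[k] ExteriorAlgebra k V →ₗ[k] N) (Y : ExteriorAlgebra k V) :
    contract (B - B') Y = contract B Y - contract B' Y := by rw [map_sub, LinearMap.sub_apply]

lemma contract_add (B B' : V →ₗ[k] ExteriorAlgebra k V →ₗ[k] N) (Y : ExteriorAlgebra k V) :
    contract (B + B') Y = contract B Y + contract B' Y := by rw [map_add, LinearMap.add_apply]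

lemma contract_smul (c : k) (B : V →ₗ[k] ExteriorAlgebra k V →ₗ[k] N) (Y : ExteriorAlgebra k V) :
    contract (c • B) Y = c • contract B Y := by rw [map_smul, LinearMap.smul_apply]

lemma map_contract (g : N →ₗ[k] N') (B : V →ₗ[k] ExteriorAlgebra k V →ₗ[k] N)
    (Y : ExteriorAlgebra k V) : g (contract B Y) = contract (B.compr₂ g) Y := by
  simp only [contract, LinearMap.comp_apply, LinearMap.lcomp_apply]
  generalize coderiv Y = t
  induction t using TensorProduct.induction_on with
  | zero => simp
  | add x y hx hy => simp only [map_add, hx, hy]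
  | tmul a b => simp

lemma ι_mul_induction {P : ExteriorAlgebra k V → Prop} (one : P 1)
    (add : ∀ x y, P x → P y → P (x + y)) (smul : ∀ (c : k) x, P x → P (c • x))
    (ι_mul : ∀ v x, P x → P (ι k v * x)) (x : ExteriorAlgebra k V) : P x := by
  induction x using CliffordAlgebra.left_induction with
  | algebraMap r => rw [Algebra.algebraMap_eq_smul_one]; exact smul r 1 one
  | add x y hx hy => exact add x y hx hy
  | ι_mul x m hx => exact ι_mul m x hx

/-- Removing two factors in the opposite order changes the sign. Symmetric forms therefore have zero
double contraction, which is the cancellation behind `contract_corr`. -/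
lemma contract_contract (B : V →ₗ[k] V →ₗ[k] ExteriorAlgebra k V →ₗ[k] N)
    (Y : ExteriorAlgebra k V) :
    contract (contract ∘ₗ B) Y = -contract (contract ∘ₗ B.flip) Y := by
  induction Y using ι_mul_induction generalizing B with
  | one => simp [contract_one]
  | add x y hx hy => rw [map_add, map_add, hx, hy]; abel
  | smul c x hx => rw [map_smul, map_smul, hx, smul_neg]
  | ι_mul v Y ih =>
    let W (B : V →ₗ[k] V →ₗ[k] ExteriorAlgebra k V →ₗ[k] N) :=
      B.compr₂ (LinearMap.lcomp k N (LinearMap.mulLeft k (ι k v)))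
    -- The three terms: `v` is the first factor removed, the second one, or neither. The first two
    -- are exchanged, up to sign, by flipping `B`; the last is left to the induction.
    have key : ∀ B, contract (contract ∘ₗ B) (ι k v * Y) =
        contract (B v) Y - contract (B.flip v) Y + contract (contract ∘ₗ W B) Y := by
      intro B
      have e : (contract ∘ₗ B).compl₂ (LinearMap.mulLeft k (ι k v)) =
          B.flip v - contract ∘ₗ W B := by
        refine LinearMap.ext fun y => LinearMap.ext fun Y' => ?_
        simp only [LinearMap.compl₂_apply, LinearMap.comp_apply, LinearMap.mulLeft_apply,
          contract_ι_mul]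
        rfl
      rw [contract_ι_mul, e, map_sub, LinearMap.sub_apply, LinearMap.comp_apply]
      abel
    have h := ih (W B)
    rw [show (W B).flip = W B.flip from rfl] at h
    rw [key, key, h, LinearMap.flip_flip]
    abel

lemma ι_mul_mem {p : ℕ} (v : V) {Y : ExteriorAlgebra k V} (hY : Y ∈ ⋀[k]^p V) :
    ι k v * Y ∈ ⋀[k]^(p + 1) V := by
  rw [exteriorPower, pow_succ']
  exact Submodule.mul_mem_mul ⟨v, rfl⟩ hY

@[elab_as_elim]
lemma exteriorPower_zero_induction {P : ∀ Y : ExteriorAlgebra k V, Y ∈ ⋀[k]^0 V → Prop}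
    (algebraMap : ∀ (c : k) (h : algebraMap k _ c ∈ ⋀[k]^0 V), P (algebraMap k _ c) h)
    {Y : ExteriorAlgebra k V} (hY : Y ∈ ⋀[k]^0 V) : P Y hY := by
  obtain ⟨c, rfl⟩ := Submodule.mem_one.mp (show Y ∈ (1 : Submodule k _) from hY)
  exact algebraMap c hY

@[elab_as_elim]
lemma exteriorPower_succ_induction {p : ℕ}
    {P : ∀ Y : ExteriorAlgebra k V, Y ∈ ⋀[k]^(p + 1) V → Prop}
    (add : ∀ x hx y hy, P x hx → P y hy → P (x + y) (add_mem hx hy))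
    (ι_mul : ∀ v x (hx : x ∈ ⋀[k]^p V), P (ι k v * x) (ι_mul_mem v hx))
    {Y : ExteriorAlgebra k V} (hY : Y ∈ ⋀[k]^(p + 1) V) : P Y hY := by
  have hY' : Y ∈ LinearMap.range (ι k (M := V)) * ⋀[k]^p V := by
    rwa [exteriorPower, pow_succ'] at hY
  induction hY' using Submodule.mul_induction_on' with
  | mem_mul_mem m hm n hn =>
    obtain ⟨v, rfl⟩ := hm
    exact ι_mul v n hn
  | add x hx y hy ihx ihy =>
    have e : LinearMap.range (ι k (M := V)) * ⋀[k]^p V = ⋀[k]^(p + 1) V := (pow_succ' _ _).symm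
    exact add x (e ▸ hx) y (e ▸ hy) (ihx _) (ihy _)

lemma contract_of_mem_zero (B : V →ₗ[k] ExteriorAlgebra k V →ₗ[k] N) {Y : ExteriorAlgebra k V}
    (hY : Y ∈ ⋀[k]^0 V) : contract B Y = 0 := by
  induction hY using exteriorPower_zero_induction with
  | algebraMap c => rw [Algebra.algebraMap_eq_smul_one, map_smul, contract_one, smul_zero]

lemma contract_mem (S : Submodule k N) {p : ℕ} {B : V →ₗ[k] ExteriorAlgebra k V →ₗ[k] N}
    (hB : ∀ y, ∀ Y ∈ ⋀[k]^p V, B y Y ∈ S) {Y : ExteriorAlgebra k V} (hY : Y ∈ ⋀[k]^(p + 1) V) :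
    contract B Y ∈ S := by
  induction p generalizing B Y with
  | zero =>
    induction hY using exteriorPower_succ_induction with
    | add x _ y _ hx hy => rw [map_add]; exact add_mem hx hy
    | ι_mul v Y hY =>
      rw [contract_ι_mul, contract_of_mem_zero _ hY, sub_zero]
      exact hB v Y hY
  | succ p ih =>
    induction hY using exteriorPower_succ_induction with
    | add x _ y _ hx hy => rw [map_add]; exact add_mem hx hy
    | ι_mul v Y hY =>
      rw [contract_ι_mul]
      exact sub_mem (hB v Y hY) (ih (fun y Y' hY' => by
        simpa using hB y _ (ι_mul_mem v hY')) hY)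

/-- Apply `contract_mem` to `B - B'` and the zero subspace. This is how inductions on degree are run
below: an identity of contractions on `⋀ᵖ⁺¹` only has to be checked on pairs of a vector and an
element of `⋀ᵖ`. -/
lemma contract_congr {p : ℕ} {B B' : V →ₗ[k] ExteriorAlgebra k V →ₗ[k] N}
    (hB : ∀ y, ∀ Y ∈ ⋀[k]^p V, B y Y = B' y Y) {Y : ExteriorAlgebra k V}
    (hY : Y ∈ ⋀[k]^(p + 1) V) : contract B Y = contract B' Y := by
  have := contract_mem (⊥ : Submodule k N) (B := B - B')
    (fun y Y hY => by simp [hB y Y hY]) hY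
  rw [Submodule.mem_bot, map_sub, LinearMap.sub_apply] at this
  exact sub_eq_zero.mp this

/-- The derivation of `⋀(V)` that extends a linear endomorphism of `V`. -/
def extDer : (V →ₗ[k] V) →ₗ[k] ExteriorAlgebra k V →ₗ[k] ExteriorAlgebra k V :=
  contract ∘ₗ LinearMap.llcomp k V _ _ (LinearMap.mul k (ExteriorAlgebra k V) ∘ₗ ι k)

lemma extDer_one (T : V →ₗ[k] V) : extDer T (1 : ExteriorAlgebra k V) = 0 := contract_one _

/-- The minus sign in `contract_ι_mul` is absorbed by moving `v` past `T y`. -/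
lemma extDer_ι_mul (T : V →ₗ[k] V) (v : V) (Y : ExteriorAlgebra k V) :
    extDer T (ι k v * Y) = ι k (T v) * Y + ι k v * extDer T Y := by
  simp only [extDer, LinearMap.comp_apply]
  rw [contract_ι_mul, ← LinearMap.mulLeft_apply (R := k) (ι k v) (contract _ Y), map_contract,
    sub_eq_add_neg, ← LinearMap.neg_apply, ← map_neg]
  congr 3
  refine LinearMap.ext fun y => LinearMap.ext fun Y' => ?_
  have h : ι k (T y) * ι k v = -(ι k v * ι k (T y)) := by
    rw [eq_neg_iff_add_eq_zero]; exact ι_add_mul_swap _ _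
  simp [← mul_assoc, h]

lemma extDer_mem (T : V →ₗ[k] V) {p : ℕ} {Y : ExteriorAlgebra k V} (hY : Y ∈ ⋀[k]^p V) :
    extDer T Y ∈ ⋀[k]^p V := by
  cases p with
  | zero => rw [extDer, LinearMap.comp_apply, contract_of_mem_zero _ hY]; exact zero_mem _
  | succ p => exact contract_mem _ (fun y Y hY => ι_mul_mem _ hY) hY

/-- Leibniz rule: the derivation acts either on the removed factor or on the remaining ones. -/
lemma contract_extDer (B : V →ₗ[k] ExteriorAlgebra k V →ₗ[k] N) (T : V →ₗ[k] V)
    (Y : ExteriorAlgebra k V) :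
    contract B (extDer T Y) = contract (B ∘ₗ T) Y + contract (B.compl₂ (extDer T)) Y := by
  induction Y using ι_mul_induction generalizing B with
  | one => simp [contract_one, extDer_one]
  | add x y hx hy => simp only [map_add, hx, hy]; abel
  | smul c x hx => simp only [map_smul, hx, smul_add]
  | ι_mul v Y ih =>
    have e : (B.compl₂ (extDer T)).compl₂ (LinearMap.mulLeft k (ι k v)) =
        B.compl₂ (LinearMap.mulLeft k (ι k (T v))) +
          (B.compl₂ (LinearMap.mulLeft k (ι k v))).compl₂ (extDer T) := by
      refine LinearMap.ext fun y => LinearMap.ext fun Y' => ?_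
      simp [extDer_ι_mul]
    rw [extDer_ι_mul, map_add, contract_ι_mul, contract_ι_mul, contract_ι_mul, contract_ι_mul, ih,
      e, map_add]
    simp only [LinearMap.comp_apply, LinearMap.add_apply, LinearMap.compl₂_apply]
    rw [show (B ∘ₗ T).compl₂ (LinearMap.mulLeft k (ι k v)) =
      (B.compl₂ (LinearMap.mulLeft k (ι k v))) ∘ₗ T from rfl]
    abel

lemma extDer_comm (S T : V →ₗ[k] V) (Y : ExteriorAlgebra k V) :
    extDer (S ∘ₗ T - T ∘ₗ S) Y = extDer S (extDer T Y) - extDer T (extDer S Y) := by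
  induction Y using ι_mul_induction with
  | one => simp [extDer_one]
  | add x y hx hy => simp only [map_add (extDer _), hx, hy]; abel
  | smul c x hx => simp only [map_smul (extDer _), hx, smul_sub]
  | ι_mul v Y ih =>
    rw [extDer_ι_mul, ih]
    simp only [extDer_ι_mul, map_add (extDer _), LinearMap.sub_apply, LinearMap.comp_apply,
      map_sub (ι k)]
    noncomm_ring

/-- The operator on `⋀(V)` that acts on `⋀ᵖ(V)` as multiplication by `p`. -/
def degOp : ExteriorAlgebra k V →ₗ[k] ExteriorAlgebra k V :=
  contract (LinearMap.mul k (ExteriorAlgebra k V) ∘ₗ ι k)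

lemma degOp_eq : degOp (k := k) (V := V) = extDer LinearMap.id := by
  simp only [degOp, extDer, LinearMap.comp_apply]
  congr 1

lemma degOp_ι_mul (v : V) (Y : ExteriorAlgebra k V) :
    degOp (ι k v * Y) = ι k v * Y + ι k v * degOp Y := by
  rw [degOp_eq, extDer_ι_mul, LinearMap.id_apply]

lemma degOp_of_mem {p : ℕ} {Y : ExteriorAlgebra k V} (hY : Y ∈ ⋀[k]^p V) :
    degOp Y = (p : k) • Y := by
  induction p generalizing Y with
  | zero => rw [degOp, contract_of_mem_zero _ hY]; simp
  | succ p ih =>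
    induction hY using exteriorPower_succ_induction with
    | add x _ y _ hx hy => rw [map_add, hx, hy, smul_add]
    | ι_mul v Y hY =>
      rw [degOp_ι_mul, ih hY, mul_smul_comm, Nat.cast_succ, add_smul, one_smul, add_comm]

/-- The linear map on `⋀(V)` given by `f p` on `⋀ᵖ(V)`. -/
def gradedMap (f : ℕ → ExteriorAlgebra k V →ₗ[k] N) : ExteriorAlgebra k V →ₗ[k] N :=
  DirectSum.toModule k ℕ N (fun p => f p ∘ₗ (⋀[k]^p V).subtype) ∘ₗ
    (DirectSum.decomposeLinearEquiv fun p : ℕ => ⋀[k]^p V).toLinearMap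

lemma gradedMap_of_mem (f : ℕ → ExteriorAlgebra k V →ₗ[k] N) {p : ℕ} {Y : ExteriorAlgebra k V}
    (hY : Y ∈ ⋀[k]^p V) : gradedMap f Y = f p Y := by
  lift Y to ⋀[k]^p V using hY
  simp only [gradedMap, LinearMap.comp_apply, LinearEquiv.coe_coe,
    DirectSum.decomposeLinearEquiv_apply, DirectSum.decompose_coe]
  rw [← DirectSum.lof_eq_of k, DirectSum.toModule_lof]
  rfl

lemma hom_ext_exteriorPower {f g : ExteriorAlgebra k V →ₗ[k] N}
    (h : ∀ p, ∀ Y ∈ ⋀[k]^p V, f Y = g Y) : f = g := by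
  refine LinearMap.ext fun Y => ?_
  induction Y using DirectSum.Decomposition.inductionOn (fun p : ℕ => ⋀[k]^p V) with
  | zero => simp
  | add x y hx hy => rw [map_add, map_add, hx, hy]
  | homogeneous Y => exact h _ _ Y.2

/-- The explicit alternating sum is needed only to compare contractions with sums over permutations,
in `antisym_degOp`. -/
lemma contract_ιMulti (B : V →ₗ[k] ExteriorAlgebra k V →ₗ[k] N) (p : ℕ) (X : Fin (p + 1) → V) :
    contract B (ιMulti k (p + 1) X) =
      ∑ i : Fin (p + 1), (-1 : ℤ) ^ (i : ℕ) • B (X i) (ιMulti k p (i.removeNth X)) := by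
  induction p generalizing B with
  | zero =>
    rw [ιMulti_succ_apply, contract_ι_mul,
      contract_of_mem_zero _ (ιMulti_range k 0 ⟨Matrix.vecTail X, rfl⟩)]
    simp
  | succ p ih =>
    rw [ιMulti_succ_apply, contract_ι_mul, ih, Fin.sum_univ_succ (n := p + 1), sub_eq_add_neg,
      ← Finset.sum_neg_distrib]
    congr 1
    · simp
      rfl
    refine Finset.sum_congr rfl fun i _ => ?_
    have h0 : i.succ.removeNth X 0 = X 0 := by simp [Fin.removeNth]
    have ht : Matrix.vecTail (i.succ.removeNth X) = i.removeNth (Matrix.vecTail X) := by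
      funext j; simp [Fin.removeNth, Matrix.vecTail]
    rw [ιMulti_succ_apply (v := i.succ.removeNth X), h0, ht, Fin.val_succ, pow_succ, mul_neg_one,
      neg_smul]
    rfl

end ExteriorAlgebra

end ExteriorContraction

/-! ### Construction of the right action of the odd part, by recursion on degree. -/

/-- A Lie algebra `L` with a morphism `j` to an associative algebra `A`, and the data on a vector
space `V` that make `L ⊕ V` a Lie superalgebra with odd part `V`. -/
structure OddExtension (k : Type*) [Field k] (L : Type*) [LieRing L] [LieAlgebra k L]
    (V : Type*) [AddCommGroup V] [Module k V] (A : Type*) [Ring A] [Algebra k A] where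
  j : L →ₗ[k] A
  act : L →ₗ[k] V →ₗ[k] V
  br : V →ₗ[k] V →ₗ[k] L
  j_lie : ∀ Z W, j ⁅Z, W⁆ = j Z * j W - j W * j Z
  act_lie : ∀ Z W, act ⁅Z, W⁆ = act Z ∘ₗ act W - act W ∘ₗ act Z
  br_symm : ∀ x y, br x y = br y x
  lie_br : ∀ Z x y, ⁅Z, br x y⁆ = br (act Z x) y + br x (act Z y)
  jacobi : ∀ x y z, act (br x y) z + act (br y z) x + act (br z x) y = 0

namespace OddExtension

open ExteriorAlgebra

variable {k : Type*} [Field k] {L : Type*} [LieRing L] [LieAlgebra k L]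
  {V : Type*} [AddCommGroup V] [Module k V] {A : Type*} [Ring A] [Algebra k A]

/-- The `A`-linear extension to `A ⊗ ⋀(V)` of a linear map on `⋀(V)`. -/
def leftExt : (ExteriorAlgebra k V →ₗ[k] A ⊗[k] ExteriorAlgebra k V) →ₗ[k]
    A ⊗[k] ExteriorAlgebra k V →ₗ[k] A ⊗[k] ExteriorAlgebra k V where
  toFun f := TensorProduct.lift
    ((Algebra.lsmul k k (A ⊗[k] ExteriorAlgebra k V)).toLinearMap.compl₂ f)
  map_add' f g := TensorProduct.ext' fun a Y => by simp
  map_smul' c f := TensorProduct.ext' fun a Y => by simp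

lemma leftExt_tmul (f : ExteriorAlgebra k V →ₗ[k] A ⊗[k] ExteriorAlgebra k V) (a : A)
    (Y : ExteriorAlgebra k V) : leftExt f (a ⊗ₜ Y) = a • f Y := rfl

lemma leftExt_smul (f : ExteriorAlgebra k V →ₗ[k] A ⊗[k] ExteriorAlgebra k V) (a : A)
    (m : A ⊗[k] ExteriorAlgebra k V) : leftExt f (a • m) = a • leftExt f m := by
  induction m using TensorProduct.induction_on with
  | zero => simp
  | add x y hx hy => simp only [smul_add, map_add, hx, hy]
  | tmul b Y => rw [TensorProduct.smul_tmul', leftExt_tmul, leftExt_tmul, smul_eq_mul, mul_smul]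

variable (A) in
/-- The subspace `A ⊗ ⨁_{q < p} ⋀^q(V)`. -/
def degLT (p : ℕ) : Submodule k (A ⊗[k] ExteriorAlgebra k V) :=
  Submodule.span k {m | ∃ q < p, ∃ (a : A), ∃ Y ∈ ⋀[k]^q V, m = a ⊗ₜ Y}

lemma tmul_mem_degLT {p q : ℕ} (h : q < p) (a : A) {Y : ExteriorAlgebra k V} (hY : Y ∈ ⋀[k]^q V) :
    a ⊗ₜ[k] Y ∈ degLT A p := Submodule.subset_span ⟨q, h, a, Y, hY, rfl⟩

lemma degLT_mono {p q : ℕ} (h : p ≤ q) : degLT A (k := k) (V := V) p ≤ degLT A q :=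
  Submodule.span_mono fun _ ⟨r, hr, a, Y, hY, e⟩ => ⟨r, hr.trans_le h, a, Y, hY, e⟩

lemma smul_mem_degLT {p : ℕ} (a : A) {m : A ⊗[k] ExteriorAlgebra k V} (hm : m ∈ degLT A p) :
    a • m ∈ degLT A p := by
  induction hm using Submodule.span_induction with
  | mem x h =>
    obtain ⟨q, hq, b, Y, hY, rfl⟩ := h
    exact tmul_mem_degLT hq _ hY
  | zero => simp
  | add x y _ _ hx hy => rw [smul_add]; exact add_mem hx hy
  | smul c x _ hx => rw [smul_comm]; exact Submodule.smul_mem _ c hx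

lemma leftExt_mem {f : ExteriorAlgebra k V →ₗ[k] A ⊗[k] ExteriorAlgebra k V} {p r : ℕ}
    (hf : ∀ q < p, ∀ Y ∈ ⋀[k]^q V, f Y ∈ degLT A r) {m : A ⊗[k] ExteriorAlgebra k V}
    (hm : m ∈ degLT A p) : leftExt f m ∈ degLT A r := by
  induction hm using Submodule.span_induction with
  | mem x h =>
    obtain ⟨q, hq, b, Y, hY, rfl⟩ := h
    exact smul_mem_degLT _ (hf q hq Y hY)
  | zero => simp
  | add x y _ _ hx hy => rw [map_add]; exact add_mem hx hy
  | smul c x _ hx => rw [map_smul]; exact Submodule.smul_mem _ c hx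

lemma leftExt_congr {f g : ExteriorAlgebra k V →ₗ[k] A ⊗[k] ExteriorAlgebra k V} {p : ℕ}
    (hf : ∀ q < p, ∀ Y ∈ ⋀[k]^q V, f Y = g Y) {m : A ⊗[k] ExteriorAlgebra k V}
    (hm : m ∈ degLT A p) : leftExt f m = leftExt g m := by
  induction hm using Submodule.span_induction with
  | mem x h =>
    obtain ⟨q, hq, b, Y, hY, rfl⟩ := h
    rw [leftExt_tmul, leftExt_tmul, hf q hq Y hY]
  | zero => simp
  | add x y _ _ hx hy => rw [map_add, map_add, hx, hy]
  | smul c x _ hx => rw [map_smul, map_smul, hx]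

variable (k V A) in
/-- The map `(v, Y) ↦ 1 ⊗ (v ∧ Y)`. -/
def wedge : V →ₗ[k] ExteriorAlgebra k V →ₗ[k] A ⊗[k] ExteriorAlgebra k V :=
  (LinearMap.mul k (ExteriorAlgebra k V) ∘ₗ ι k).compr₂ (TensorProduct.mk k A _ 1)

lemma wedge_apply (v : V) (Y : ExteriorAlgebra k V) :
    wedge k V A v Y = 1 ⊗ₜ[k] (ι k v * Y) := rfl

/-- The operators on `A ⊗ ⋀(V)` that extend `Y ↦ v ∧ Y + C v Y`. -/
def oddOp (C : V →ₗ[k] ExteriorAlgebra k V →ₗ[k] A ⊗[k] ExteriorAlgebra k V) :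
    V →ₗ[k] A ⊗[k] ExteriorAlgebra k V →ₗ[k] A ⊗[k] ExteriorAlgebra k V :=
  leftExt ∘ₗ (wedge k V A + C)

lemma oddOp_one_tmul (C : V →ₗ[k] ExteriorAlgebra k V →ₗ[k] A ⊗[k] ExteriorAlgebra k V) (v : V)
    (Y : ExteriorAlgebra k V) : oddOp C v (1 ⊗ₜ Y) = 1 ⊗ₜ (ι k v * Y) + C v Y := by
  rw [oddOp, LinearMap.comp_apply, leftExt_tmul, one_smul]; rfl

variable (k V) in
/-- The operator on `⋀(V)` that acts on `⋀ᵖ(V)` as multiplication by `1 / (p + 1)`. -/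
def degInv : ExteriorAlgebra k V →ₗ[k] ExteriorAlgebra k V :=
  gradedMap fun p => ((p : k) + 1)⁻¹ • LinearMap.id

lemma degInv_of_mem {p : ℕ} {Y : ExteriorAlgebra k V} (hY : Y ∈ ⋀[k]^p V) :
    degInv k V Y = ((p : k) + 1)⁻¹ • Y := gradedMap_of_mem _ hY

lemma degInv_extDer (T : V →ₗ[k] V) (Y : ExteriorAlgebra k V) :
    degInv k V (extDer T Y) = extDer T (degInv k V Y) := by
  have : degInv k V ∘ₗ extDer T = extDer T ∘ₗ degInv k V :=
    hom_ext_exteriorPower fun p Y hY => by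
      simp only [LinearMap.comp_apply]
      rw [degInv_of_mem hY, degInv_of_mem (extDer_mem T hY), map_smul]
  exact LinearMap.congr_fun this Y

variable (S : OddExtension k L V A)

/-- The map `(Z, Y) ↦ Z ⊗ Y - 1 ⊗ [Z, Y]`. -/
def evenCore : L →ₗ[k] ExteriorAlgebra k V →ₗ[k] A ⊗[k] ExteriorAlgebra k V :=
  TensorProduct.mk k A (ExteriorAlgebra k V) ∘ₗ S.j -
    (extDer ∘ₗ S.act).compr₂ (TensorProduct.mk k A _ 1)

lemma evenCore_apply (Z : L) (Y : ExteriorAlgebra k V) :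
    S.evenCore Z Y = S.j Z ⊗ₜ[k] Y - 1 ⊗ₜ[k] extDer (S.act Z) Y := rfl

/-- The right action of `L` on `A ⊗ ⋀(V)`. -/
def evenOp : L →ₗ[k] A ⊗[k] ExteriorAlgebra k V →ₗ[k] A ⊗[k] ExteriorAlgebra k V :=
  leftExt ∘ₗ S.evenCore

lemma evenOp_tmul (Z : L) (a : A) (Y : ExteriorAlgebra k V) :
    S.evenOp Z (a ⊗ₜ Y) = (a * S.j Z) ⊗ₜ[k] Y - a ⊗ₜ[k] extDer (S.act Z) Y := by
  rw [evenOp, LinearMap.comp_apply, leftExt_tmul, evenCore_apply, smul_sub,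
    TensorProduct.smul_tmul', TensorProduct.smul_tmul', smul_eq_mul, smul_eq_mul, mul_one]

/-- The form `(x, y, Y) ↦ (C x Y) · y - Y · [x, y]`. -/
def stepForm (C : V →ₗ[k] ExteriorAlgebra k V →ₗ[k] A ⊗[k] ExteriorAlgebra k V) :
    V →ₗ[k] V →ₗ[k] ExteriorAlgebra k V →ₗ[k] A ⊗[k] ExteriorAlgebra k V :=
  LinearMap.mk₂ k (fun x y => oddOp C y ∘ₗ C x - S.evenCore (S.br x y))
    (fun x x' y => by simp only [map_add, LinearMap.comp_add, LinearMap.add_apply]; abel)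
    (fun c x y => by simp only [map_smul, LinearMap.comp_smul, LinearMap.smul_apply, smul_sub])
    (fun x y y' => by simp only [map_add, LinearMap.add_comp]; abel)
    (fun c x y => by simp only [map_smul, LinearMap.smul_comp, smul_sub])

lemma stepForm_apply (C : V →ₗ[k] ExteriorAlgebra k V →ₗ[k] A ⊗[k] ExteriorAlgebra k V) (x y : V)
    (Y : ExteriorAlgebra k V) :
    S.stepForm C x y Y = oddOp C y (C x Y) - S.evenCore (S.br x y) Y := rfl

/-- Successive approximations of the correction `x ↦ (Y ↦ Y · x - x ∧ Y)`. -/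
def corrApprox : ℕ → V →ₗ[k] ExteriorAlgebra k V →ₗ[k] A ⊗[k] ExteriorAlgebra k V
  | 0 => 0
  -- In degree `p` this solves `(p + 1) C(x, Y) = -∑ ± (C(x, Yᵢ) · yᵢ - Yᵢ · [x, yᵢ])` for the
  -- left-hand side. The right-hand side involves `C` only in degrees below `p`.
  | n + 1 => -(contract ∘ₗ S.stepForm (corrApprox n)).compl₂ (degInv k V)

lemma corrApprox_succ (n : ℕ) (x : V) (Y : ExteriorAlgebra k V) : S.corrApprox (n + 1) x Y =
    -contract (S.stepForm (S.corrApprox n) x) (degInv k V Y) := rfl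

lemma corrApprox_succ_of_mem (n : ℕ) (x : V) {p : ℕ} {Y : ExteriorAlgebra k V}
    (hY : Y ∈ ⋀[k]^p V) : S.corrApprox (n + 1) x Y =
    -(((p : k) + 1)⁻¹ • contract (S.stepForm (S.corrApprox n) x) Y) := by
  rw [corrApprox_succ, degInv_of_mem hY, map_smul]

lemma oddOp_mem {C : V →ₗ[k] ExteriorAlgebra k V →ₗ[k] A ⊗[k] ExteriorAlgebra k V}
    (hC : ∀ x p, ∀ Y ∈ ⋀[k]^p V, C x Y ∈ degLT A p) (x : V) {p : ℕ}
    {m : A ⊗[k] ExteriorAlgebra k V} (hm : m ∈ degLT A p) : oddOp C x m ∈ degLT A (p + 1) :=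
  leftExt_mem (fun q hq Y hY => add_mem (tmul_mem_degLT (by omega) 1 (ι_mul_mem x hY))
    (degLT_mono (by omega) (hC x q Y hY))) hm

lemma evenCore_mem (Z : L) {p : ℕ} {Y : ExteriorAlgebra k V} (hY : Y ∈ ⋀[k]^p V) :
    S.evenCore Z Y ∈ degLT A (p + 1) :=
  sub_mem (tmul_mem_degLT (by omega) _ hY) (tmul_mem_degLT (by omega) _ (extDer_mem _ hY))

/-- Contraction removes one factor, while acting by the removed vector raises the filtration by at
most one; so the strict drop in degree persists through the recursion. -/
lemma corrApprox_mem (n : ℕ) (x : V) (p : ℕ) (Y : ExteriorAlgebra k V) (hY : Y ∈ ⋀[k]^p V) :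
    S.corrApprox n x Y ∈ degLT A p := by
  induction n generalizing x p Y with
  | zero => exact zero_mem _
  | succ n ih =>
    rw [corrApprox_succ_of_mem _ _ _ hY]
    refine neg_mem (Submodule.smul_mem _ _ ?_)
    cases p with
    | zero => rw [contract_of_mem_zero _ hY]; exact zero_mem _
    | succ p =>
      exact contract_mem _ (fun y Y' hY' =>
        sub_mem (oddOp_mem ih y (ih x p Y' hY')) (S.evenCore_mem _ hY')) hY

/-- In degree `p` the next stage uses the previous one only in degrees below `p`, where it is
already stable. That `oddOp` meets only such degrees is the content of `corrApprox_mem`. -/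
lemma corrApprox_stable {n p : ℕ} (h : p < n) (x : V) {Y : ExteriorAlgebra k V}
    (hY : Y ∈ ⋀[k]^p V) : S.corrApprox (n + 1) x Y = S.corrApprox n x Y := by
  induction n generalizing p x Y with
  | zero => omega
  | succ n ih =>
    rw [corrApprox_succ_of_mem _ _ _ hY, corrApprox_succ_of_mem _ _ _ hY]
    cases p with
    | zero => rw [contract_of_mem_zero _ hY, contract_of_mem_zero _ hY]
    | succ p =>
      congr 2
      refine contract_congr (fun y Y' hY' => ?_) hY
      rw [stepForm_apply, stepForm_apply, ih (by omega) x hY']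
      congr 1
      refine leftExt_congr (fun q hq Z hZ => ?_) (S.corrApprox_mem n x p Y' hY')
      rw [LinearMap.add_apply, LinearMap.add_apply, LinearMap.add_apply, LinearMap.add_apply,
        ih (by omega) y hZ]

/-- The correction `x ↦ (Y ↦ Y · x - x ∧ Y)`. -/
def corr : V →ₗ[k] ExteriorAlgebra k V →ₗ[k] A ⊗[k] ExteriorAlgebra k V :=
  -- Stage `p + 1` is the first one covered by `corrApprox_stable` in degree `p`.
  (gradedMap fun p => (S.corrApprox (p + 1)).flip).flip

lemma corr_of_mem {n p : ℕ} (h : p < n) (x : V) {Y : ExteriorAlgebra k V} (hY : Y ∈ ⋀[k]^p V) :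
    S.corr x Y = S.corrApprox n x Y := by
  have e : S.corr x Y = S.corrApprox (p + 1) x Y := by
    rw [corr, LinearMap.flip_apply, gradedMap_of_mem _ hY, LinearMap.flip_apply]
  rw [e]
  induction n, h using Nat.le_induction with
  | base => rfl
  | succ n hn ih => rw [ih, S.corrApprox_stable hn x hY]

lemma corr_mem (x : V) (p : ℕ) (Y : ExteriorAlgebra k V) (hY : Y ∈ ⋀[k]^p V) :
    S.corr x Y ∈ degLT A p := by
  rw [S.corr_of_mem (Nat.lt_succ_self p) x hY]
  exact S.corrApprox_mem _ x p Y hY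

/-- The limit of the approximations is a fixed point of the recursion. Every later property of
`corr` that is not plain filtration or equivariance comes from this identity. -/
lemma corr_recursion [CharZero k] (x : V) {p : ℕ} {Y : ExteriorAlgebra k V} (hY : Y ∈ ⋀[k]^p V) :
    ((p : k) + 1) • S.corr x Y = -contract (S.stepForm S.corr x) Y := by
  have h0 : (p : k) + 1 ≠ 0 := Nat.cast_add_one_ne_zero p
  rw [S.corr_of_mem (n := p + 1) (by omega) x hY, corrApprox_succ_of_mem _ _ _ hY, smul_neg,
    smul_inv_smul₀ h0]
  cases p with
  | zero => rw [contract_of_mem_zero _ hY, contract_of_mem_zero _ hY]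
  | succ p =>
    congr 1
    refine contract_congr (fun y Y' hY' => ?_) hY
    rw [stepForm_apply, stepForm_apply, S.corr_of_mem (n := p + 1) (by omega) x hY']
    congr 1
    refine leftExt_congr (fun q hq Z hZ => ?_) (S.corrApprox_mem _ x p Y' hY')
    rw [LinearMap.add_apply, LinearMap.add_apply, LinearMap.add_apply, LinearMap.add_apply,
      S.corr_of_mem (n := p + 1) (by omega) y hZ]

end OddExtension

/-! ### The relations satisfied by the right action. -/

namespace OddExtension

open ExteriorAlgebra

variable {k : Type*} [Field k] {L : Type*} [LieRing L] [LieAlgebra k L]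
  {V : Type*} [AddCommGroup V] [Module k V] {A : Type*} [Ring A] [Algebra k A]
  (S : OddExtension k L V A)

/-- The difference of the left and right actions of `L` on `A ⊗ ⋀(V)`. -/
def innerAd (Z : L) : A ⊗[k] ExteriorAlgebra k V →ₗ[k] A ⊗[k] ExteriorAlgebra k V :=
  Algebra.lsmul k k (A ⊗[k] ExteriorAlgebra k V) (S.j Z) - S.evenOp Z

lemma innerAd_apply (Z : L) (m : A ⊗[k] ExteriorAlgebra k V) :
    S.innerAd Z m = S.j Z • m - S.evenOp Z m := rfl

lemma innerAd_tmul (Z : L) (a : A) (Y : ExteriorAlgebra k V) : S.innerAd Z (a ⊗ₜ Y) =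
    (S.j Z * a - a * S.j Z) ⊗ₜ[k] Y + a ⊗ₜ[k] extDer (S.act Z) Y := by
  rw [innerAd_apply, evenOp_tmul, TensorProduct.smul_tmul', smul_eq_mul, TensorProduct.sub_tmul]
  abel

lemma evenOp_smul (Z : L) (a : A) (m : A ⊗[k] ExteriorAlgebra k V) :
    S.evenOp Z (a • m) = a • S.evenOp Z m := leftExt_smul _ a m

lemma oddOp_smul (C : V →ₗ[k] ExteriorAlgebra k V →ₗ[k] A ⊗[k] ExteriorAlgebra k V) (x : V) (a : A)
    (m : A ⊗[k] ExteriorAlgebra k V) : oddOp C x (a • m) = a • oddOp C x m := leftExt_smul _ a m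

lemma innerAd_smul (Z : L) (a : A) (m : A ⊗[k] ExteriorAlgebra k V) :
    S.innerAd Z (a • m) = (S.j Z * a - a * S.j Z) • m + a • S.innerAd Z m := by
  rw [innerAd_apply, innerAd_apply, evenOp_smul, sub_smul, smul_sub, mul_smul, mul_smul]
  abel

/-- `innerAd Z` is a derivation with respect to the commutator with `j Z` on `A`, so its commutator
with an `A`-linear operator is `A`-linear and can be read off on `1 ⊗ ⋀(V)`. -/
lemma innerAd_leftExt {Z : L} {f g : ExteriorAlgebra k V →ₗ[k] A ⊗[k] ExteriorAlgebra k V}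
    (h : ∀ Y, S.innerAd Z (f Y) = f (extDer (S.act Z) Y) + g Y) (m : A ⊗[k] ExteriorAlgebra k V) :
    S.innerAd Z (leftExt f m) = leftExt f (S.innerAd Z m) + leftExt g m := by
  induction m using TensorProduct.induction_on with
  | zero => simp
  | add x y hx hy => simp only [map_add, hx, hy]; abel
  | tmul a Y =>
    rw [leftExt_tmul, innerAd_smul, h, innerAd_tmul, map_add, leftExt_tmul, leftExt_tmul,
      leftExt_tmul, smul_add]
    abel

lemma innerAd_evenCore (Z W : L) (Y : ExteriorAlgebra k V) : S.innerAd Z (S.evenCore W Y) =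
    S.evenCore W (extDer (S.act Z) Y) + S.evenCore ⁅Z, W⁆ Y := by
  rw [evenCore_apply, evenCore_apply, evenCore_apply, map_sub, innerAd_tmul, innerAd_tmul,
    S.act_lie, extDer_comm, S.j_lie, one_mul, mul_one, sub_self, TensorProduct.zero_tmul,
    TensorProduct.tmul_sub]
  abel

lemma innerAd_wedge (Z : L) (v : V) (Y : ExteriorAlgebra k V) : S.innerAd Z (wedge k V A v Y) =
    wedge k V A v (extDer (S.act Z) Y) + wedge k V A (S.act Z v) Y := by
  rw [wedge_apply, wedge_apply, wedge_apply, innerAd_tmul, extDer_ι_mul, one_mul, mul_one, sub_self,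
    TensorProduct.zero_tmul, TensorProduct.tmul_add]
  abel

lemma innerAd_oddOp {C : V →ₗ[k] ExteriorAlgebra k V →ₗ[k] A ⊗[k] ExteriorAlgebra k V} {Z : L}
    (h : ∀ x Y, S.innerAd Z (C x Y) = C x (extDer (S.act Z) Y) + C (S.act Z x) Y) (x : V)
    (m : A ⊗[k] ExteriorAlgebra k V) :
    S.innerAd Z (oddOp C x m) = oddOp C x (S.innerAd Z m) + oddOp C (S.act Z x) m :=
  S.innerAd_leftExt (fun Y => by
    simp only [LinearMap.add_apply, map_add (S.innerAd Z), h, innerAd_wedge]; abel) m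

/-- Every ingredient of the recursion is `L`-equivariant: the bracket by `lie_br`, contraction by
`contract_extDer`, and `degInv` because `extDer` preserves degrees. -/
lemma innerAd_corrApprox (n : ℕ) (Z : L) (x : V) (Y : ExteriorAlgebra k V) :
    S.innerAd Z (S.corrApprox n x Y) =
      S.corrApprox n x (extDer (S.act Z) Y) + S.corrApprox n (S.act Z x) Y := by
  induction n generalizing x Y with
  | zero => simp [corrApprox]
  | succ n ih =>
    have e : (S.stepForm (S.corrApprox n) x).compr₂ (S.innerAd Z) =
        S.stepForm (S.corrApprox n) x ∘ₗ S.act Z +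
          (S.stepForm (S.corrApprox n) x).compl₂ (extDer (S.act Z)) +
          S.stepForm (S.corrApprox n) (S.act Z x) := by
      refine LinearMap.ext fun y => LinearMap.ext fun Y' => ?_
      simp only [LinearMap.compr₂_apply, LinearMap.add_apply, LinearMap.comp_apply,
        LinearMap.compl₂_apply, stepForm_apply]
      rw [map_sub, S.innerAd_oddOp ih, ih, innerAd_evenCore, S.lie_br, map_add, map_add,
        LinearMap.add_apply]
      abel
    rw [corrApprox_succ, corrApprox_succ, corrApprox_succ, map_neg, map_contract, e,
      degInv_extDer, contract_extDer, map_add, map_add, LinearMap.add_apply, LinearMap.add_apply]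
    abel

lemma innerAd_corr (Z : L) (x : V) (Y : ExteriorAlgebra k V) :
    S.innerAd Z (S.corr x Y) = S.corr x (extDer (S.act Z) Y) + S.corr (S.act Z x) Y := by
  have : S.innerAd Z ∘ₗ S.corr x = S.corr x ∘ₗ extDer (S.act Z) + S.corr (S.act Z x) :=
    hom_ext_exteriorPower fun p Y hY => by
      have h := Nat.lt_succ_self p
      simp only [LinearMap.comp_apply, LinearMap.add_apply]
      rw [S.corr_of_mem h x hY, S.corr_of_mem h _ hY, S.corr_of_mem h x (extDer_mem _ hY),
        innerAd_corrApprox]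
  exact LinearMap.congr_fun this Y

/-- The right action of `V` on `A ⊗ ⋀(V)`. -/
abbrev oddAct : V →ₗ[k] A ⊗[k] ExteriorAlgebra k V →ₗ[k] A ⊗[k] ExteriorAlgebra k V := oddOp S.corr

/-- This is the equivariance of the odd action: left multiplication by `j Z` commutes with `oddAct
x`, so only the right actions survive from `innerAd Z`. -/
lemma oddAct_evenOp (x : V) (Z : L) (m : A ⊗[k] ExteriorAlgebra k V) :
    S.oddAct x (S.evenOp Z m) = S.evenOp Z (S.oddAct x m) + S.oddAct (S.act Z x) m := by
  have h := S.innerAd_oddOp (S.innerAd_corr Z) x m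
  rw [innerAd_apply, innerAd_apply, map_sub, oddOp_smul] at h
  rw [← sub_eq_zero] at h ⊢
  rw [← h]
  abel

lemma evenOp_evenOp (W Z : L) (m : A ⊗[k] ExteriorAlgebra k V) :
    S.evenOp W (S.evenOp Z m) = S.evenOp Z (S.evenOp W m) + S.evenOp ⁅Z, W⁆ m := by
  have h : S.innerAd Z (S.evenOp W m) = S.evenOp W (S.innerAd Z m) + S.evenOp ⁅Z, W⁆ m :=
    S.innerAd_leftExt (S.innerAd_evenCore Z W) m
  rw [innerAd_apply, innerAd_apply, map_sub, evenOp_smul] at h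
  rw [← sub_eq_zero] at h ⊢
  rw [← h]
  abel

lemma contract_wedge (Y : ExteriorAlgebra k V) :
    contract (wedge k V A) Y = 1 ⊗ₜ[k] degOp Y :=
  (map_contract (TensorProduct.mk k A (ExteriorAlgebra k V) 1) _ Y).symm

variable [CharZero k]

lemma contract_contract_of_symm {N : Type*} [AddCommGroup N] [Module k N]
    (B : V →ₗ[k] V →ₗ[k] ExteriorAlgebra k V →ₗ[k] N) (hB : B.flip = B) (Y : ExteriorAlgebra k V) :
    contract (contract ∘ₗ B) Y = 0 := by
  have h := contract_contract B Y
  rw [hB, eq_neg_iff_add_eq_zero, ← two_smul k] at h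
  exact (smul_eq_zero.mp h).resolve_left two_ne_zero

/-- By the recursion, a multiple of the left-hand side is a double contraction of `stepForm`. After
exchanging the two contractions, its first term contains a contraction of `corr` one degree lower,
which vanishes by induction, and its second term is symmetric in the two vectors. -/
lemma contract_corr (Y : ExteriorAlgebra k V) : contract S.corr Y = 0 := by
  suffices contract S.corr = 0 from LinearMap.congr_fun this Y
  refine hom_ext_exteriorPower fun p => ?_
  induction p with
  | zero => exact fun Y hY => contract_of_mem_zero _ hY
  | succ p ih =>
    intro Y hY
    have h1 : ((p : k) + 1) • contract S.corr Y =
        -contract (contract ∘ₗ S.stepForm S.corr) Y := by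
      rw [← contract_smul, ← contract_neg]
      exact contract_congr (fun y Y' hY' => S.corr_recursion y hY') hY
    have h2 : contract (contract ∘ₗ (S.stepForm S.corr).flip) Y =
        contract (-(contract ∘ₗ S.br.compr₂ S.evenCore)) Y := by
      refine contract_congr (fun y Y' hY' => ?_) hY
      have e : (S.stepForm S.corr).flip y =
          S.corr.compr₂ (S.oddAct y) - S.br.compr₂ S.evenCore y := by
        refine LinearMap.ext fun x => LinearMap.ext fun Z => ?_
        change S.oddAct y (S.corr x Z) - S.evenCore (S.br x y) Z = _
        rw [S.br_symm x y]
        rfl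
      rw [LinearMap.comp_apply, e, contract_sub, ← map_contract, ih Y' hY']
      simp
    have h3 := contract_contract_of_symm (S.br.compr₂ S.evenCore)
      (LinearMap.ext fun x => LinearMap.ext fun y => by
        change S.evenCore (S.br y x) = S.evenCore (S.br x y)
        rw [S.br_symm]) Y
    rw [contract_contract, h2, contract_neg, h3, neg_zero, neg_zero, neg_zero] at h1
    exact (smul_eq_zero.mp h1).resolve_left (Nat.cast_add_one_ne_zero p)

/-- The corrections cancel in `∑ ± Yᵢ · yᵢ = p Y`. This is the counterpart in `A ⊗ ⋀(V)` of the
recursion for the antisymmetrizer, and so the reason why the orbit map inverts it. -/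
lemma contract_wedge_add_corr (Y : ExteriorAlgebra k V) :
    contract (wedge k V A + S.corr) Y = 1 ⊗ₜ[k] degOp Y := by
  rw [map_add, LinearMap.add_apply, contract_corr, contract_wedge, add_zero]

/-- The obstruction to `x · y + y · x = [x, y]` for the right action of `V` on `A ⊗ ⋀(V)`. -/
def defect : V →ₗ[k] V →ₗ[k] A ⊗[k] ExteriorAlgebra k V →ₗ[k] A ⊗[k] ExteriorAlgebra k V :=
  LinearMap.mk₂ k (fun x y => S.oddAct x ∘ₗ S.oddAct y + S.oddAct y ∘ₗ S.oddAct x -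
      S.evenOp (S.br x y))
    (fun x x' y => by
      simp only [map_add, LinearMap.comp_add, LinearMap.add_comp, LinearMap.add_apply]; abel)
    (fun c x y => by
      simp only [map_smul, LinearMap.comp_smul, LinearMap.smul_comp, LinearMap.smul_apply, smul_sub,
        smul_add])
    (fun x y y' => by simp only [map_add, LinearMap.add_comp, LinearMap.comp_add]; abel)
    (fun c x y => by
      simp only [map_smul, LinearMap.smul_comp, LinearMap.comp_smul, smul_sub, smul_add])

lemma defect_apply (x y : V) (m : A ⊗[k] ExteriorAlgebra k V) : S.defect x y m =
    S.oddAct x (S.oddAct y m) + S.oddAct y (S.oddAct x m) - S.evenOp (S.br x y) m := rfl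

lemma defect_comm (x y : V) (m : A ⊗[k] ExteriorAlgebra k V) :
    S.defect x y m = S.defect y x m := by
  rw [defect_apply, defect_apply, S.br_symm, add_comm]

lemma defect_smul (x y : V) (a : A) (m : A ⊗[k] ExteriorAlgebra k V) :
    S.defect x y (a • m) = a • S.defect x y m := by
  simp only [defect_apply, oddOp_smul, evenOp_smul, smul_add, smul_sub]

/-- The form `(x, y, Y) ↦ defect x y (1 ⊗ Y)`. -/
def defectForm (x : V) : V →ₗ[k] ExteriorAlgebra k V →ₗ[k] A ⊗[k] ExteriorAlgebra k V :=
  (S.defect x).compl₂ (TensorProduct.mk k A (ExteriorAlgebra k V) 1)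

lemma defectForm_apply (x y : V) (Y : ExteriorAlgebra k V) :
    S.defectForm x y Y = S.defect x y (1 ⊗ₜ Y) := rfl

/-- In degree `p` the three terms of `e` contribute `p (x ∧ Y + C(x, Y))`, `x ∧ Y + C(x, Y) - (p +
1) x ∧ Y` and, by `corr_recursion`, `-(p + 1) C(x, Y)`. Their sum is zero: the recursion was
designed for this. -/
lemma contract_defectForm (x : V) (Y : ExteriorAlgebra k V) : contract (S.defectForm x) Y = 0 := by
  suffices contract (S.defectForm x) = 0 from LinearMap.congr_fun this Y
  refine hom_ext_exteriorPower fun p Y hY => ?_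
  have e : S.defectForm x = (wedge k V A + S.corr).compr₂ (S.oddAct x) +
      (wedge k V A + S.corr).compl₂ (LinearMap.mulLeft k (ι k x)) + S.stepForm S.corr x := by
    refine LinearMap.ext fun y => LinearMap.ext fun Z => ?_
    simp only [LinearMap.add_apply, LinearMap.compr₂_apply, LinearMap.compl₂_apply,
      stepForm_apply, LinearMap.mulLeft_apply, defectForm_apply, defect_apply, oddOp_one_tmul,
      map_add, wedge_apply]
    rw [evenOp, LinearMap.comp_apply, leftExt_tmul, one_smul]
    abel
  have h2 : contract ((wedge k V A + S.corr).compl₂ (LinearMap.mulLeft k (ι k x))) Y =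
      (wedge k V A + S.corr) x Y - 1 ⊗ₜ[k] degOp (ι k x * Y) := by
    rw [← contract_wedge_add_corr S, contract_ι_mul]; abel
  have h3 : contract (S.stepForm S.corr x) Y = -(((p : k) + 1) • S.corr x Y) := by
    rw [S.corr_recursion x hY, neg_neg]
  rw [e, map_add, map_add, LinearMap.add_apply, LinearMap.add_apply, h2, h3, ← map_contract,
    contract_wedge_add_corr, degOp_of_mem hY, degOp_of_mem (ι_mul_mem x hY),
    TensorProduct.tmul_smul, map_smul, oddOp_one_tmul, TensorProduct.tmul_smul,
    LinearMap.add_apply, LinearMap.add_apply, wedge_apply, Nat.cast_succ, LinearMap.zero_apply]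
  module

/-- In the cyclic sum the triple products cancel in pairs, and the brackets add up to the action of
the Jacobi sum of `x`, `y`, `z`. -/
lemma defect_jacobi {m : A ⊗[k] ExteriorAlgebra k V} (hm : ∀ x y, S.defect x y m = 0) (x y z : V) :
    S.defect x y (S.oddAct z m) + S.defect y z (S.oddAct x m) + S.defect z x (S.oddAct y m) = 0 := by
  -- The even operator is moved past `z` with `oddAct_evenOp`; since the defect vanishes at `m`, its
  -- action on `m` itself may be replaced by the anticommutator of `x` and `y`.
  have h1 : ∀ x y z, S.defect x y (S.oddAct z m) =
      S.oddAct x (S.oddAct y (S.oddAct z m)) + S.oddAct y (S.oddAct x (S.oddAct z m)) -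
        S.oddAct z (S.oddAct x (S.oddAct y m)) - S.oddAct z (S.oddAct y (S.oddAct x m)) +
        S.oddAct (S.act (S.br x y) z) m := by
    intro x y z
    have h := hm x y
    rw [defect_apply, sub_eq_zero] at h
    have h' := S.oddAct_evenOp z (S.br x y) m
    rw [← h, map_add] at h'
    rw [defect_apply, eq_sub_of_add_eq h'.symm]
    abel
  rw [h1, h1, h1]
  have h2 := congrArg (fun v => S.oddAct v m) (S.jacobi x y z)
  simp only [map_add, map_zero, LinearMap.add_apply, LinearMap.zero_apply] at h2
  rw [← h2]
  abel

/-- The contraction of `defectForm y` at `x ∧ Y` vanishes; expand it by separating the removal of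
`x` from the other removals. -/
lemma contract_defectForm_mulLeft (x y : V) (Y : ExteriorAlgebra k V) :
    contract ((S.defectForm y).compl₂ (LinearMap.mulLeft k (ι k x))) Y = S.defect y x (1 ⊗ₜ Y) := by
  have h := contract_ι_mul (S.defectForm y) x Y
  rw [contract_defectForm] at h
  exact (sub_eq_zero.mp h.symm).symm

/-- Write `D` for the defect. In positive degree `p`, `p D(x, y)(Y)` is the contraction over `z` of
`D(x, y)(z ∧ Y')`. The Jacobi identity trades this for `D(y, z)(x ∧ Y')` and `D(x, z)(y ∧ Y')`,
whose contractions are both `D(x, y)(Y)`. Hence `p D = -2 D`. -/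
lemma defect_one_tmul (p : ℕ) {Y : ExteriorAlgebra k V} (hY : Y ∈ ⋀[k]^p V) (x y : V) :
    S.defect x y (1 ⊗ₜ Y) = 0 := by
  induction p using Nat.strong_induction_on generalizing Y x y with
  | _ p ih =>
  cases p with
  | zero => rw [← contract_defectForm_mulLeft, contract_of_mem_zero _ hY]
  | succ p =>
    -- This allows `z ∧ Y'` to be replaced by `Y' · z` inside the defect, since the correction has
    -- lower degree. Only the latter form fits `defect_jacobi`.
    have h0 : ∀ x y, ∀ m ∈ degLT A p, S.defect x y m = 0 := by
      intro x y m hm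
      induction hm using Submodule.span_induction with
      | mem m h =>
        obtain ⟨q, hq, a, Z, hZ, rfl⟩ := h
        rw [← mul_one a, ← smul_eq_mul, ← TensorProduct.smul_tmul', defect_smul,
          ih q (by omega) hZ, smul_zero]
      | zero => simp
      | add m m' _ _ h h' => rw [map_add, h, h', add_zero]
      | smul c m _ h => rw [map_smul, h, smul_zero]
    have h1 : contract ((wedge k V A).compr₂ (S.defect x y)) Y =
        contract (-((S.defectForm y).compl₂ (LinearMap.mulLeft k (ι k x)) +
          (S.defectForm x).compl₂ (LinearMap.mulLeft k (ι k y)))) Y := by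
      refine contract_congr (fun z Y' hY' => ?_) hY
      have hw : ∀ x y z, S.defect x y (1 ⊗ₜ (ι k z * Y')) = S.defect x y (S.oddAct z (1 ⊗ₜ Y')) := by
        intro x y z
        rw [oddOp_one_tmul, map_add, h0 x y _ (S.corr_mem z p Y' hY'), add_zero]
      have hj := S.defect_jacobi (fun x y => ih p (by omega) hY' x y) x y z
      simp only [LinearMap.compr₂_apply, LinearMap.neg_apply, LinearMap.add_apply,
        LinearMap.compl₂_apply, LinearMap.mulLeft_apply, defectForm_apply, wedge_apply, hw]
      rw [eq_neg_iff_add_eq_zero, S.defect_comm x z, ← add_assoc, hj]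
    rw [← map_contract, contract_wedge, degOp_of_mem hY, TensorProduct.tmul_smul, map_smul,
      contract_neg, contract_add, contract_defectForm_mulLeft, contract_defectForm_mulLeft,
      S.defect_comm y x, eq_neg_iff_add_eq_zero, ← two_smul k,
      ← add_smul] at h1
    refine (smul_eq_zero.mp h1).resolve_left ?_
    -- `p + 1` is the degree of `Y`, and the summand `2` counts the two contractions produced by the
    -- Jacobi identity.
    have : ((p + 1 + 2 : ℕ) : k) ≠ 0 := Nat.cast_ne_zero.mpr (by omega)
    exact_mod_cast this

/-- The odd operators satisfy `x · y + y · x = [x, y]`. -/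
lemma oddAct_oddAct (x y : V) (m : A ⊗[k] ExteriorAlgebra k V) :
    S.oddAct x (S.oddAct y m) = -S.oddAct y (S.oddAct x m) + S.evenOp (S.br x y) m := by
  have h : S.defect x y m = 0 := by
    induction m using TensorProduct.induction_on with
    | zero => simp
    | add m m' h h' => rw [map_add, h, h', add_zero]
    | tmul a Y =>
      rw [← mul_one a, ← smul_eq_mul, ← TensorProduct.smul_tmul', defect_smul]
      have : S.defect x y ∘ₗ TensorProduct.mk k A (ExteriorAlgebra k V) 1 = 0 :=
        hom_ext_exteriorPower fun p Y hY => S.defect_one_tmul p hY x y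
      rw [show S.defect x y (1 ⊗ₜ Y) = 0 from LinearMap.congr_fun this Y, smul_zero]
  rw [defect_apply] at h
  rw [← sub_eq_zero, ← h]
  abel

end OddExtension

/-! ### Recursive description of antisymmetrization. -/

section Antisymmetrization

lemma List.reverse_ofFn_eq {α : Type*} {n : ℕ} (f : Fin n → α) :
    (List.ofFn f).reverse = List.ofFn fun i => f i.rev := by
  refine List.ext_getElem (by simp) fun i h _ => ?_
  simp only [List.length_reverse, List.length_ofFn] at h
  simp only [List.getElem_reverse, List.getElem_ofFn, List.length_ofFn]
  congr 1
  ext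
  simp only [Fin.val_rev]
  omega

/-- Permutations are sorted by the image `i` of `0`: the inverse of `cycleRange i` sends `0` to `i`
and preserves the order of the other indices, and a permutation fixing `0` remains. Injectivity and
a count suffice. -/
lemma sum_perm_fin_succ {N : Type*} [AddCommMonoid N] {n : ℕ} (f : Equiv.Perm (Fin (n + 1)) → N) :
    ∑ τ, f τ = ∑ i : Fin (n + 1), ∑ σ : Equiv.Perm (Fin n),
      f (i.cycleRange.symm * Equiv.Perm.decomposeFin.symm (0, σ)) := by
  rw [← Fintype.sum_prod_type']
  refine (Function.Bijective.sum_comp (g := f) (e := fun q : Fin (n + 1) × Equiv.Perm (Fin n) =>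
    q.1.cycleRange.symm * Equiv.Perm.decomposeFin.symm (0, q.2)) ?_).symm
  rw [Fintype.bijective_iff_injective_and_card]
  refine ⟨fun ⟨i, σ⟩ ⟨i', σ'⟩ h => ?_, by simp [Fintype.card_perm, Nat.factorial_succ]⟩
  have h0 := congrArg (fun τ : Equiv.Perm (Fin (n + 1)) => τ 0) h
  simp at h0
  subst h0
  have := Equiv.Perm.decomposeFin.symm.injective (mul_left_cancel h)
  simpa using this

/-- Expansion along the first factor of the product, like that of a determinant; `(-1)^i` is the
sign of the cycle bringing `i` to the front. -/
lemma sum_sign_smul_prod_ofFn {B : Type*} [Ring B] (n : ℕ) (X : Fin (n + 1) → B) :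
    ∑ τ : Equiv.Perm (Fin (n + 1)), Equiv.Perm.sign τ • (List.ofFn fun i => X (τ i)).prod =
      ∑ i : Fin (n + 1), (-1 : ℤ) ^ (i : ℕ) • (X i * ∑ σ : Equiv.Perm (Fin n),
        Equiv.Perm.sign σ • (List.ofFn fun m => i.removeNth X (σ m)).prod) := by
  rw [sum_perm_fin_succ]
  refine Finset.sum_congr rfl fun i _ => ?_
  rw [Finset.mul_sum, Finset.smul_sum]
  refine Finset.sum_congr rfl fun σ _ => ?_
  rw [List.ofFn_succ, List.prod_cons]
  simp only [Equiv.Perm.sign_mul, Equiv.Perm.sign_symm, Fin.sign_cycleRange,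
    Equiv.Perm.decomposeFin.symm_sign, if_true, one_mul, mul_smul, Equiv.Perm.mul_apply,
    Equiv.Perm.decomposeFin_symm_apply_zero, Fin.cycleRange_symm_zero,
    Equiv.Perm.decomposeFin_symm_apply_succ, Equiv.swap_self, Equiv.refl_apply,
    Fin.cycleRange_symm_succ, mul_smul_comm, Fin.removeNth]
  simp [Units.smul_def]

variable {k : Type*} [Field k] [CharZero k] {V : Type*} [AddCommGroup V] [Module k V]
  {B : Type*} [Ring B] [Algebra k B]

namespace ExteriorAlgebra

/-- The map `⋀(V) → B`, `X₁ ∧ ⋯ ∧ Xₚ ↦ (1 / p!) ∑_τ (-1)^{|τ|} j(X_{τ(1)}) ⋯ j(X_{τ(p)})`. -/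
def antisym (j : V →ₗ[k] B) : ExteriorAlgebra k V →ₗ[k] B :=
  ExteriorAlgebra.liftAlternating fun p => ((p.factorial : k)⁻¹) •
    MultilinearMap.alternatization ((MultilinearMap.mkPiAlgebraFin k p B).compLinearMap fun _ => j)

lemma antisym_ιMulti (j : V →ₗ[k] B) (p : ℕ) (X : Fin p → V) : antisym j (ιMulti k p X) =
    ((p.factorial : k)⁻¹) • ∑ τ : Equiv.Perm (Fin p),
      Equiv.Perm.sign τ • (List.ofFn fun i => j (X (τ i))).prod := by
  rw [antisym, ExteriorAlgebra.liftAlternating_apply_ιMulti, AlternatingMap.smul_apply,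
    MultilinearMap.alternatization_apply]
  rfl

lemma antisym_one (j : V →ₗ[k] B) : antisym j 1 = 1 := by
  have := antisym_ιMulti j 0 ![]
  simpa using this

lemma hom_ext_ιMulti {N : Type*} [AddCommGroup N] [Module k N]
    {f g : ExteriorAlgebra k V →ₗ[k] N}
    (h : ∀ p (X : Fin p → V), f (ιMulti k p X) = g (ιMulti k p X)) : f = g :=
  ExteriorAlgebra.lhom_ext fun p => AlternatingMap.ext fun X => h p X

/-- In degree `p + 1`, the factor `p + 1` turns `1 / (p + 1)!` into `1 / p!`, and the expansion
along the first factor is a contraction. From here on this recursion replaces the sums over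
permutations, apart from the comparison of orders in `antisym_reverse`. -/
lemma antisym_degOp (j : V →ₗ[k] B) (Y : ExteriorAlgebra k V) : antisym j (degOp Y) =
    contract (((LinearMap.mul k B).compl₂ (antisym j)) ∘ₗ j) Y := by
  suffices antisym j ∘ₗ degOp = contract (((LinearMap.mul k B).compl₂ (antisym j)) ∘ₗ j) from
    LinearMap.congr_fun this Y
  refine hom_ext_ιMulti fun p X => ?_
  rw [LinearMap.comp_apply, degOp_of_mem (ιMulti_range k p ⟨X, rfl⟩), map_smul, antisym_ιMulti]
  cases p with
  | zero => rw [contract_of_mem_zero _ (ιMulti_range k 0 ⟨X, rfl⟩)]; simp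
  | succ p =>
    have h0 : ((p + 1 : ℕ) : k) ≠ 0 := Nat.cast_ne_zero.mpr (by omega)
    rw [contract_ιMulti, sum_sign_smul_prod_ofFn p (fun i => j (X i)), Nat.factorial_succ,
      Nat.cast_mul, mul_inv, smul_smul, mul_inv_cancel_left₀ h0, Finset.smul_sum]
    refine Finset.sum_congr rfl fun i _ => ?_
    simp only [LinearMap.comp_apply, LinearMap.compl₂_apply, LinearMap.mul_apply', antisym_ιMulti]
    rw [mul_smul_comm, smul_comm]
    rfl

lemma smul_antisym (j : V →ₗ[k] B) {p : ℕ} {Y : ExteriorAlgebra k V} (hY : Y ∈ ⋀[k]^p V) :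
    (p : k) • antisym j Y = contract (((LinearMap.mul k B).compl₂ (antisym j)) ∘ₗ j) Y := by
  rw [← antisym_degOp, degOp_of_mem hY, map_smul]

/-- Passing to the opposite algebra transfers the recursion of `antisym` to the reversed order,
where the last factor is split off instead of the first. -/
lemma antisym_reverse (j : V →ₗ[k] B) (Y : ExteriorAlgebra k V) :
    antisym j (CliffordAlgebra.reverse (Q := (0 : QuadraticForm k V)) Y) =
      (antisym ((MulOpposite.opLinearEquiv k).toLinearMap ∘ₗ j) Y).unop := by
  suffices antisym j ∘ₗ CliffordAlgebra.reverse (Q := (0 : QuadraticForm k V)) =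
      (MulOpposite.opLinearEquiv k).symm.toLinearMap ∘ₗ
        antisym ((MulOpposite.opLinearEquiv k).toLinearMap ∘ₗ j) from LinearMap.congr_fun this Y
  refine hom_ext_ιMulti fun p X => ?_
  have hr : CliffordAlgebra.reverse (Q := (0 : QuadraticForm k V)) (ιMulti k p X) =
      ιMulti k p (fun i => X i.rev) := by
    rw [ιMulti_apply, ιMulti_apply]
    have := CliffordAlgebra.reverse_prod_map_ι (Q := (0 : QuadraticForm k V)) (List.ofFn X)
    rw [List.map_ofFn, List.reverse_ofFn_eq] at this
    exact this
  simp only [LinearMap.comp_apply]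
  rw [hr, antisym_ιMulti, antisym_ιMulti]
  simp only [LinearMap.comp_apply, LinearEquiv.coe_coe, MulOpposite.coe_opLinearEquiv_symm,
    MulOpposite.coe_opLinearEquiv, MulOpposite.unop_smul]
  congr 1
  rw [Finset.unop_sum]
  -- Reversing both the vectors and the order of multiplication conjugates `τ` by the reversal,
  -- which leaves its sign unchanged.
  refine Fintype.sum_equiv (MulAut.conj Fin.revPerm).toEquiv _ _ fun τ => ?_
  simp only [MulEquiv.toEquiv_eq_coe, EquivLike.coe_coe, MulOpposite.unop_smul]
  rw [MulOpposite.unop_list_prod, List.map_ofFn, List.reverse_ofFn_eq]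
  simp only [Function.comp_def, MulOpposite.unop_op, MulAut.conj_apply,
    Equiv.Perm.sign_mul, Equiv.Perm.mul_apply, Fin.revPerm_apply,
    Equiv.Perm.inv_def, Fin.revPerm_symm, Fin.rev_rev]
  rw [mul_right_comm, Int.units_mul_self, one_mul]

/-- The map `⋀(V) → B`, `X₁ ∧ ⋯ ∧ Xₚ ↦ (1 / p!) ∑_τ (-1)^{|τ|} j(X_{τ(p)}) ⋯ j(X_{τ(1)})`. -/
def antisymRev (j : V →ₗ[k] B) : ExteriorAlgebra k V →ₗ[k] B :=
  antisym j ∘ₗ CliffordAlgebra.reverse (Q := (0 : QuadraticForm k V))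

/-- The form `(y, Y) ↦ antisymRev j Y * j y`. -/
def antisymRevForm (j : V →ₗ[k] B) : V →ₗ[k] ExteriorAlgebra k V →ₗ[k] B :=
  ((LinearMap.mul k B).flip.compl₂ (antisymRev j)) ∘ₗ j

lemma antisymRevForm_apply (j : V →ₗ[k] B) (y : V) (Y : ExteriorAlgebra k V) :
    antisymRevForm j y Y = antisymRev j Y * j y := rfl

lemma antisymRev_one (j : V →ₗ[k] B) : antisymRev j 1 = 1 := by
  rw [antisymRev, LinearMap.comp_apply, CliffordAlgebra.reverse.map_one, antisym_one]

lemma antisymRev_degOp (j : V →ₗ[k] B) (Y : ExteriorAlgebra k V) :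
    antisymRev j (degOp Y) = contract (antisymRevForm j) Y := by
  rw [antisymRev, LinearMap.comp_apply, antisym_reverse, antisym_degOp,
    ← MulOpposite.coe_opLinearEquiv_symm k, ← LinearEquiv.coe_coe, map_contract]
  congr 2
  refine LinearMap.ext fun y => LinearMap.ext fun Y' => ?_
  rw [antisymRevForm_apply, antisymRev, LinearMap.comp_apply, antisym_reverse]
  rfl

lemma smul_antisymRev (j : V →ₗ[k] B) {p : ℕ} {Y : ExteriorAlgebra k V} (hY : Y ∈ ⋀[k]^p V) :
    (p : k) • antisymRev j Y = contract (antisymRevForm j) Y := by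
  rw [← antisymRev_degOp, degOp_of_mem hY, map_smul]

/-- Both sides obey the same recursion: the Leibniz rule for `D` on products matches that of
`extDer` under contraction. -/
lemma derivation_antisymRev (j : V →ₗ[k] B) (D : B →ₗ[k] B) (T : V →ₗ[k] V)
    (hD : ∀ a b, D (a * b) = D a * b + a * D b) (hj : ∀ v, D (j v) = j (T v))
    (Y : ExteriorAlgebra k V) : D (antisymRev j Y) = antisymRev j (extDer T Y) := by
  suffices D ∘ₗ antisymRev j = antisymRev j ∘ₗ extDer T from LinearMap.congr_fun this Y
  refine hom_ext_exteriorPower fun p => ?_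
  induction p with
  | zero =>
    intro Y hY
    induction hY using exteriorPower_zero_induction with
    | algebraMap c =>
      have h1 : D 1 = 0 := by simpa using hD 1 1
      rw [Algebra.algebraMap_eq_smul_one, LinearMap.comp_apply, LinearMap.comp_apply, map_smul,
        map_smul, map_smul, antisymRev_one, h1, extDer_one]
      simp
  | succ p ih =>
    intro Y hY
    simp only [LinearMap.comp_apply] at ih ⊢
    have h0 : ((p + 1 : ℕ) : k) ≠ 0 := Nat.cast_ne_zero.mpr (by omega)
    refine smul_right_injective B h0 ?_
    change ((p + 1 : ℕ) : k) • _ = ((p + 1 : ℕ) : k) • _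
    rw [smul_antisymRev j (extDer_mem T hY), ← map_smul, smul_antisymRev j hY, map_contract,
      contract_extDer, ← contract_add]
    refine contract_congr (fun y Y' hY' => ?_) hY
    simp only [LinearMap.compr₂_apply, LinearMap.add_apply, LinearMap.comp_apply,
      LinearMap.compl₂_apply, antisymRevForm_apply, hD, hj, ih Y' hY']
    exact add_comm _ _

end ExteriorAlgebra

end Antisymmetrization

section EvenEnveloping

attribute [local instance 100] LieRing.ofAssociativeRing

/-- By the universal property, the lift of `ι` to `T` followed by the inclusion of `T` is the
identity. -/
lemma UniversalEnvelopingAlgebra.eq_top_of_ι_mem {k : Type*} [CommRing k] {L : Type*} [LieRing L]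
    [LieAlgebra k L] (T : Subalgebra k (UniversalEnvelopingAlgebra k L))
    (h : ∀ Z, UniversalEnvelopingAlgebra.ι k Z ∈ T) : T = ⊤ := by
  have hT : T.val.comp (UniversalEnvelopingAlgebra.lift k (LieHom.mk
      ((UniversalEnvelopingAlgebra.ι k).toLinearMap.codRestrict T.toSubmodule h)
      (fun {x y} => Subtype.ext (((UniversalEnvelopingAlgebra.ι k).map_lie x y).trans
        (LieRing.of_associative_ring_bracket _ _))))) = AlgHom.id k _ := by
    apply UniversalEnvelopingAlgebra.hom_ext
    ext Z
    simp only [LieHom.comp_apply, AlgHom.coe_toLieHom, AlgHom.comp_apply,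
      UniversalEnvelopingAlgebra.lift_ι_apply]
    rfl
  refine eq_top_iff.mpr fun a _ => ?_
  rw [← AlgHom.id_apply (R := k) a, ← hT]
  exact SetLike.coe_mem (p := T) _

end EvenEnveloping

/-! ### The right action of `U(𝔤)` on `U(𝔤₀) ⊗ ⋀(𝔤₁)`. -/

namespace SuperUEA

open ExteriorAlgebra

attribute [local instance 100] LieRing.ofAssociativeRing

variable (k : Type*) [Field k] [CharZero k] (𝔤 : Type*) [AddCommGroup 𝔤] [Module k 𝔤]
  [LieSuperalgebra k 𝔤]

/-- The action of the even part of a Lie superalgebra on its odd part. -/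
def evenOddBracket : superPart k 𝔤 0 →ₗ[k] superPart k 𝔤 1 →ₗ[k] superPart k 𝔤 1 :=
  LinearMap.mk₂ k (fun Z x => ⟨superBracket k 𝔤 Z x, by
      simpa using LieSuperalgebra.bracket_mem Z.2 x.2⟩)
    (fun Z W x => by ext; simp) (fun c Z x => by ext; simp)
    (fun Z x y => by ext; simp) (fun c Z x => by ext; simp)

/-- The bracket of two odd elements of a Lie superalgebra. -/
def oddOddBracket : superPart k 𝔤 1 →ₗ[k] superPart k 𝔤 1 →ₗ[k] superPart k 𝔤 0 :=
  LinearMap.mk₂ k (fun x y => ⟨superBracket k 𝔤 x y, LieSuperalgebra.bracket_mem x.2 y.2⟩)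
    (fun Z W x => by ext; simp) (fun c Z x => by ext; simp)
    (fun Z x y => by ext; simp) (fun c Z x => by ext; simp)

variable {k 𝔤}

@[simp] lemma coe_evenOddBracket (Z : superPart k 𝔤 0) (x : superPart k 𝔤 1) :
    (evenOddBracket k 𝔤 Z x : 𝔤) = superBracket k 𝔤 Z x := rfl

@[simp] lemma coe_oddOddBracket (x y : superPart k 𝔤 1) :
    (oddOddBracket k 𝔤 x y : 𝔤) = superBracket k 𝔤 x y := rfl

@[simp] lemma coe_lie (Z W : superPart k 𝔤 0) :
    ((⁅Z, W⁆ : superPart k 𝔤 0) : 𝔤) = superBracket k 𝔤 Z W := rfl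

lemma odd_even_skew (x : superPart k 𝔤 1) (Z : superPart k 𝔤 0) :
    superBracket k 𝔤 x Z = -superBracket k 𝔤 Z x := by
  simpa using LieSuperalgebra.bracket_skew x.2 Z.2

lemma odd_odd_symm (x y : superPart k 𝔤 1) :
    superBracket k 𝔤 x y = superBracket k 𝔤 y x := by
  simpa [Units.smul_def] using LieSuperalgebra.bracket_skew x.2 y.2

variable (k 𝔤)

/-- A Lie superalgebra as an extension of its even part by its odd part. -/
def oddExtension : OddExtension k (superPart k 𝔤 0) (superPart k 𝔤 1)
    (UniversalEnvelopingAlgebra k (superPart k 𝔤 0)) where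
  j := (UniversalEnvelopingAlgebra.ι k).toLinearMap
  act := evenOddBracket k 𝔤
  br := oddOddBracket k 𝔤
  j_lie Z W := ((UniversalEnvelopingAlgebra.ι k).map_lie Z W).trans
    (LieRing.of_associative_ring_bracket _ _)
  act_lie Z W := by
    ext x
    have h := LieSuperalgebra.jacobi (x : 𝔤) Z.2 W.2
    simp only [mul_zero, uzpow_zero, one_smul] at h
    simpa [sub_eq_add_neg] using eq_sub_of_add_eq h.symm
  br_symm x y := Subtype.ext (odd_odd_symm x y)
  lie_br Z x y := by
    ext
    simpa using LieSuperalgebra.jacobi (y : 𝔤) Z.2 x.2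
  jacobi x y z := by
    ext
    have h := LieSuperalgebra.jacobi (z : 𝔤) x.2 y.2
    -- Skew-symmetry moves the even brackets of the super Jacobi identity into the first slot; with
    -- the odd-odd sign this yields the cyclic form.
    have h1 := odd_even_skew x (oddOddBracket k 𝔤 y z)
    have h2 := odd_even_skew y (oddOddBracket k 𝔤 x z)
    have h3 := odd_odd_symm x z
    simp only [coe_oddOddBracket] at h1 h2
    rw [mul_one, uzpow_one, Units.smul_def, Units.val_neg, Units.val_one, neg_smul, one_smul, h1,
      h2, h3, neg_neg] at h
    simp only [Submodule.coe_add, coe_evenOddBracket, coe_oddOddBracket, Submodule.coe_zero]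
    rw [add_right_comm, ← h, neg_add_cancel]

/-- The right action of `𝔤` on `U(𝔤₀) ⊗ ⋀(𝔤₁)`. -/
def rightAct : 𝔤 →ₗ[k] Module.End k (UniversalEnvelopingAlgebra k (superPart k 𝔤 0) ⊗[k]
    ExteriorAlgebra k (superPart k 𝔤 1)) :=
  (oddExtension k 𝔤).evenOp ∘ₗ gradedProj (superPart k 𝔤) 0 +
    (oddExtension k 𝔤).oddAct ∘ₗ gradedProj (superPart k 𝔤) 1

variable {k 𝔤}

lemma gradedProj_coe (i : ZMod 2) (x : superPart k 𝔤 i) :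
    gradedProj (superPart k 𝔤) i (x : 𝔤) = x := Subtype.ext (gradedProj_of_mem _ x.2)

lemma gradedProj_coe_ne {i j : ZMod 2} (x : superPart k 𝔤 i) (h : i ≠ j) :
    gradedProj (superPart k 𝔤) j (x : 𝔤) = 0 := Subtype.ext (gradedProj_of_ne _ x.2 h)

lemma rightAct_even (Z : superPart k 𝔤 0) :
    rightAct k 𝔤 (Z : 𝔤) = (oddExtension k 𝔤).evenOp Z := by
  simp [rightAct, gradedProj_coe, gradedProj_coe_ne Z (show (0 : ZMod 2) ≠ 1 by decide)]

lemma rightAct_odd (x : superPart k 𝔤 1) :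
    rightAct k 𝔤 (x : 𝔤) = (oddExtension k 𝔤).oddAct x := by
  simp [rightAct, gradedProj_coe, gradedProj_coe_ne x (show (1 : ZMod 2) ≠ 0 by decide)]

lemma rightAct_smul (x : 𝔤) (a : UniversalEnvelopingAlgebra k (superPart k 𝔤 0)) (m) :
    rightAct k 𝔤 x (a • m) = a • rightAct k 𝔤 x m := by
  change (oddExtension k 𝔤).evenOp _ _ + (oddExtension k 𝔤).oddAct _ _ =
    a • ((oddExtension k 𝔤).evenOp _ _ + (oddExtension k 𝔤).oddAct _ _)
  rw [OddExtension.evenOp_smul, OddExtension.oddOp_smul, smul_add]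

lemma rightAct_even_even (Z W : superPart k 𝔤 0) (m) :
    rightAct k 𝔤 (W : 𝔤) (rightAct k 𝔤 (Z : 𝔤) m) =
      rightAct k 𝔤 (Z : 𝔤) (rightAct k 𝔤 (W : 𝔤) m) + rightAct k 𝔤 (superBracket k 𝔤 Z W) m := by
  have h := (oddExtension k 𝔤).evenOp_evenOp W Z m
  have h2 : rightAct k 𝔤 (superBracket k 𝔤 Z W) = _ := rightAct_even ⁅Z, W⁆
  have h3 := rightAct_even (k := k) Z
  have h4 := rightAct_even (k := k) W
  rw [h2, h3, h4]
  exact h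

lemma rightAct_even_odd (Z : superPart k 𝔤 0) (x : superPart k 𝔤 1) (m) :
    rightAct k 𝔤 (x : 𝔤) (rightAct k 𝔤 (Z : 𝔤) m) =
      rightAct k 𝔤 (Z : 𝔤) (rightAct k 𝔤 (x : 𝔤) m) + rightAct k 𝔤 (superBracket k 𝔤 Z x) m := by
  have h := (oddExtension k 𝔤).oddAct_evenOp x Z m
  have h2 : rightAct k 𝔤 (superBracket k 𝔤 Z x) = _ := rightAct_odd (evenOddBracket k 𝔤 Z x)
  have h3 := rightAct_even (k := k) Z
  have h4 := rightAct_odd (k := k) x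
  rw [h2, h3, h4]
  exact h

lemma rightAct_odd_odd (x y : superPart k 𝔤 1) (m) :
    rightAct k 𝔤 (y : 𝔤) (rightAct k 𝔤 (x : 𝔤) m) =
      -rightAct k 𝔤 (x : 𝔤) (rightAct k 𝔤 (y : 𝔤) m) + rightAct k 𝔤 (superBracket k 𝔤 x y) m := by
  have h := (oddExtension k 𝔤).oddAct_oddAct y x m
  have h2 : rightAct k 𝔤 (superBracket k 𝔤 y x) = _ := rightAct_even (oddOddBracket k 𝔤 y x)
  have h3 := rightAct_odd (k := k) x
  have h4 := rightAct_odd (k := k) y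
  rw [odd_odd_symm x y, h2, h3, h4]
  exact h

lemma neg_one_uzpow_one_smul {N : Type*} [AddCommGroup N] (n : N) :
    (-1 : ℤˣ) ^ ((1 : ZMod 2) * 1) • n = -n := by
  rw [mul_one, uzpow_one, Units.smul_def, Units.val_neg, Units.val_one, neg_smul, one_smul]

lemma eq_neg_one_uzpow_zero_smul_add_neg {N : Type*} [AddCommGroup N] {a b c : N}
    (h : a = b + c) : b = (-1 : ℤˣ) ^ ((1 : ZMod 2) * 0) • a + -c := by
  rw [mul_zero, uzpow_zero, one_smul, h, add_neg_cancel_right]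

lemma _root_.LinearMap.end_map_neg_apply {M N : Type*} [AddCommGroup M] [Module k M]
    [AddCommGroup N] [Module k N] (f : M →ₗ[k] Module.End k N) (x : M) (n : N) :
    f (-x) n = -f x n := by rw [map_neg]; rfl

/-- The operators compose in reverse order because the action is on the right: `m · (x y)` applies
`x` before `y`. These are the relations needed to lift to the opposite endomorphism algebra. -/
lemma rightAct_rel (i j : ZMod 2) (x y : 𝔤) (hx : x ∈ superPart k 𝔤 i) (hy : y ∈ superPart k 𝔤 j)
    (m) : rightAct k 𝔤 y (rightAct k 𝔤 x m) = (-1 : ℤˣ) ^ (i * j) •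
      rightAct k 𝔤 x (rightAct k 𝔤 y m) + rightAct k 𝔤 (superBracket k 𝔤 x y) m := by
  have h01 : ∀ i : ZMod 2, i = 0 ∨ i = 1 := by decide
  rcases h01 i with rfl | rfl <;> rcases h01 j with rfl | rfl
  · rw [mul_zero, uzpow_zero, one_smul]
    exact rightAct_even_even ⟨x, hx⟩ ⟨y, hy⟩ m
  · rw [zero_mul, uzpow_zero, one_smul]
    exact rightAct_even_odd ⟨x, hx⟩ ⟨y, hy⟩ m
  · have h := rightAct_even_odd (k := k) ⟨y, hy⟩ ⟨x, hx⟩ m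
    have h' : superBracket k 𝔤 x y = -superBracket k 𝔤 y x := odd_even_skew ⟨x, hx⟩ ⟨y, hy⟩
    rw [h', LinearMap.end_map_neg_apply]
    exact eq_neg_one_uzpow_zero_smul_add_neg h
  · rw [neg_one_uzpow_one_smul]
    exact rightAct_odd_odd ⟨x, hx⟩ ⟨y, hy⟩ m

variable (k 𝔤)

/-- The right action of `U(𝔤)` on `U(𝔤₀) ⊗ ⋀(𝔤₁)`. -/
def rightActHom : SuperUEA k 𝔤 →ₐ[k] (Module.End k (UniversalEnvelopingAlgebra k
    (superPart k 𝔤 0) ⊗[k] ExteriorAlgebra k (superPart k 𝔤 1)))ᵐᵒᵖ :=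
  lift k ((MulOpposite.opLinearEquiv k).toLinearMap ∘ₗ rightAct k 𝔤) (fun i j x y hx hy => by
    apply MulOpposite.unop_injective
    refine LinearMap.ext fun m => ?_
    exact rightAct_rel i j x y hx hy m)

/-- The orbit map `u ↦ (1 ⊗ 1) · u`. -/
def orbitMap : SuperUEA k 𝔤 →ₗ[k] UniversalEnvelopingAlgebra k (superPart k 𝔤 0) ⊗[k]
    ExteriorAlgebra k (superPart k 𝔤 1) :=
  LinearMap.applyₗ (R := k) (1 ⊗ₜ 1) ∘ₗ (MulOpposite.opLinearEquiv k).symm.toLinearMap ∘ₗ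
    (rightActHom k 𝔤).toLinearMap

variable {k 𝔤}

lemma orbitMap_apply (u : SuperUEA k 𝔤) : orbitMap k 𝔤 u = (rightActHom k 𝔤 u).unop (1 ⊗ₜ 1) := rfl

lemma orbitMap_mul (u v : SuperUEA k 𝔤) :
    orbitMap k 𝔤 (u * v) = (rightActHom k 𝔤 v).unop (orbitMap k 𝔤 u) := by
  simp only [orbitMap_apply, map_mul]; rfl

lemma rightActHom_ι (x : 𝔤) : (rightActHom k 𝔤 (ι k 𝔤 x)).unop = rightAct k 𝔤 x := by
  rw [rightActHom, lift_ι]; rfl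

lemma orbitMap_mul_ι (u : SuperUEA k 𝔤) (x : 𝔤) :
    orbitMap k 𝔤 (u * ι k 𝔤 x) = rightAct k 𝔤 x (orbitMap k 𝔤 u) := by
  rw [orbitMap_mul, rightActHom_ι]

@[elab_as_elim]
lemma ι_induction {P : SuperUEA k 𝔤 → Prop} (one : P 1) (add : ∀ u v, P u → P v → P (u + v))
    (smul : ∀ (c : k) u, P u → P (c • u)) (mul_ι : ∀ u x, P u → P (u * ι k 𝔤 x))
    (u : SuperUEA k 𝔤) : P u := by
  have hu : u ∈ Algebra.adjoin k (Set.range (ι k 𝔤)) := by rw [adjoin_range_ι]; trivial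
  rw [← Subalgebra.mem_toSubmodule, Algebra.adjoin_eq_span] at hu
  induction hu using Submodule.span_induction with
  | mem x hx =>
    induction hx using Submonoid.closure_induction_right with
    | one => exact one
    | mul_right y hy s hs ih =>
      obtain ⟨x, rfl⟩ := hs
      exact mul_ι y x ih
  | zero => simpa using smul 0 1 one
  | add x y _ _ hx hy => exact add x y hx hy
  | smul c x _ hx => exact smul c x hx

lemma rightActHom_smul (u : SuperUEA k 𝔤) (a : UniversalEnvelopingAlgebra k (superPart k 𝔤 0)) (m) :
    (rightActHom k 𝔤 u).unop (a • m) = a • (rightActHom k 𝔤 u).unop m := by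
  induction u using ι_induction generalizing m with
  | one => simp
  | add u v hu hv => simp [hu, hv]
  | smul c u hu => simp [hu, smul_comm a c]
  | mul_ι u x hu => simp [hu, rightActHom_ι, rightAct_smul]

/-- On `1 ⊗ 1` the right action of an even `Z` agrees with left multiplication by `Z`, because
derivations kill `1`; and left multiplication commutes with the right action of `U(𝔤)`. The general
case follows since `𝔤₀` generates `U(𝔤₀)`. -/
lemma orbitMap_evenInclusion_mul (a : UniversalEnvelopingAlgebra k (superPart k 𝔤 0))
    (u : SuperUEA k 𝔤) : orbitMap k 𝔤 (evenInclusion k 𝔤 a * u) = a • orbitMap k 𝔤 u := by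
  let T : Subalgebra k (UniversalEnvelopingAlgebra k (superPart k 𝔤 0)) :=
    { carrier := {a | ∀ u, orbitMap k 𝔤 (evenInclusion k 𝔤 a * u) = a • orbitMap k 𝔤 u}
      mul_mem' := fun {a b} ha hb u => by
        rw [map_mul (evenInclusion k 𝔤), mul_assoc, ha, hb, mul_smul]
      add_mem' := fun {a b} ha hb u => by 
        rw [map_add (evenInclusion k 𝔤), add_mul, map_add, ha, hb, add_smul]
      algebraMap_mem' := fun c u => by simp [Algebra.algebraMap_eq_smul_one] }
  have hT : T = ⊤ := UniversalEnvelopingAlgebra.eq_top_of_ι_mem T fun Z u => by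
    rw [evenInclusion_ι, orbitMap_mul, ← one_mul (ι k 𝔤 (Z : 𝔤)), orbitMap_mul_ι, rightAct_even,
      orbitMap_apply, map_one, orbitMap_apply u, ← rightActHom_smul]
    congr 1
    simp only [MulOpposite.unop_one, Module.End.one_apply, OddExtension.evenOp_tmul, extDer_one,
      TensorProduct.tmul_zero, sub_zero, one_mul, TensorProduct.smul_tmul', smul_eq_mul, mul_one]
    rfl
  have : a ∈ T := hT ▸ Algebra.mem_top
  exact this u

end SuperUEA

/-! ### The orbit map and `gammaRev` are mutually inverse. -/

namespace SuperUEA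

open ExteriorAlgebra

attribute [local instance 100] LieRing.ofAssociativeRing

variable (k : Type*) [Field k] [CharZero k] (𝔤 : Type*) [AddCommGroup 𝔤] [Module k 𝔤]
  [LieSuperalgebra k 𝔤]

/-- The inclusion of the odd part of a Lie superalgebra into its enveloping algebra. -/
def oddι : superPart k 𝔤 1 →ₗ[k] SuperUEA k 𝔤 := ι k 𝔤 ∘ₗ (superPart k 𝔤 1).subtype

/-- The map `U(𝔤₀) ⊗ ⋀(𝔤₁) → U(𝔤)` formed with the order-reversing antisymmetrization. -/
def gammaRev : UniversalEnvelopingAlgebra k (superPart k 𝔤 0) ⊗[k]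
    ExteriorAlgebra k (superPart k 𝔤 1) →ₗ[k] SuperUEA k 𝔤 :=
  TensorProduct.lift ((LinearMap.mul k (SuperUEA k 𝔤)).compl₁₂ (evenInclusion k 𝔤).toLinearMap
    (antisymRev (oddι k 𝔤)))

variable {k 𝔤}

lemma gammaRev_tmul (a : UniversalEnvelopingAlgebra k (superPart k 𝔤 0))
    (Y : ExteriorAlgebra k (superPart k 𝔤 1)) :
    gammaRev k 𝔤 (a ⊗ₜ Y) = evenInclusion k 𝔤 a * antisymRev (oddι k 𝔤) Y := rfl

lemma gammaRev_one_tmul (Y : ExteriorAlgebra k (superPart k 𝔤 1)) :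
    gammaRev k 𝔤 (1 ⊗ₜ Y) = antisymRev (oddι k 𝔤) Y := by
  rw [gammaRev_tmul, map_one, one_mul]

lemma gammaRev_smul (a : UniversalEnvelopingAlgebra k (superPart k 𝔤 0)) (m) :
    gammaRev k 𝔤 (a • m) = evenInclusion k 𝔤 a * gammaRev k 𝔤 m := by
  induction m using TensorProduct.induction_on with
  | zero => simp
  | add x y hx hy => rw [smul_add, map_add, hx, hy, map_add, mul_add]
  | tmul b Y =>
    rw [TensorProduct.smul_tmul', gammaRev_tmul, gammaRev_tmul, smul_eq_mul, map_mul, mul_assoc]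

lemma gammaRev_tmul_reverse (a : UniversalEnvelopingAlgebra k (superPart k 𝔤 0))
    (Y : ExteriorAlgebra k (superPart k 𝔤 1)) : gammaRev k 𝔤 (a ⊗ₜ
      CliffordAlgebra.reverse (Q := (0 : QuadraticForm k (superPart k 𝔤 1))) Y) =
      gammaHat k 𝔤 (a ⊗ₜ Y) := by
  rw [gammaRev_tmul, gammaHat_tmul, antisymRev, LinearMap.comp_apply,
    CliffordAlgebra.reverse_reverse]
  rfl

/-- Applied to the recursion of `antisymRev`, the orbit map turns right multiplication by `y` into
the action of `y` on `1 ⊗ Y'`, and `contract_wedge_add_corr` evaluates the resulting contraction. -/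
lemma orbitMap_antisymRev (Y : ExteriorAlgebra k (superPart k 𝔤 1)) :
    orbitMap k 𝔤 (antisymRev (oddι k 𝔤) Y) = 1 ⊗ₜ Y := by
  suffices orbitMap k 𝔤 ∘ₗ antisymRev (oddι k 𝔤) = TensorProduct.mk k _ _ 1 from
    LinearMap.congr_fun this Y
  refine hom_ext_exteriorPower fun p => ?_
  induction p with
  | zero =>
    intro Y hY
    induction hY using exteriorPower_zero_induction with
    | algebraMap c =>
      rw [Algebra.algebraMap_eq_smul_one, map_smul, map_smul, LinearMap.comp_apply, antisymRev_one,
        orbitMap_apply, map_one]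
      rfl
  | succ p ih =>
    intro Y hY
    simp only [LinearMap.comp_apply] at ih ⊢
    have h0 : ((p + 1 : ℕ) : k) ≠ 0 := Nat.cast_ne_zero.mpr (by omega)
    have h1 : ((p + 1 : ℕ) : k) • orbitMap k 𝔤 (antisymRev (oddι k 𝔤) Y) =
        ((p + 1 : ℕ) : k) • TensorProduct.mk k _ _ 1 Y := by
      rw [← map_smul, smul_antisymRev _ hY, ← map_smul, ← degOp_of_mem hY, TensorProduct.mk_apply,
        ← OddExtension.contract_wedge_add_corr (oddExtension k 𝔤), map_contract]
      refine contract_congr (fun y Y' hY' => ?_) hY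
      rw [LinearMap.compr₂_apply, antisymRevForm_apply]
      refine (orbitMap_mul_ι _ (y : 𝔤)).trans ?_
      rw [ih Y' hY', rightAct_odd, TensorProduct.mk_apply, OddExtension.oddOp_one_tmul]
      rfl
    rw [← inv_smul_smul₀ h0 (orbitMap k 𝔤 _), h1, inv_smul_smul₀ h0]

lemma orbitMap_gammaRev (m) : orbitMap k 𝔤 (gammaRev k 𝔤 m) = m := by
  induction m using TensorProduct.induction_on with
  | zero => simp
  | add x y hx hy => rw [map_add, map_add, hx, hy]
  | tmul a Y =>
    rw [gammaRev_tmul, orbitMap_evenInclusion_mul, orbitMap_antisymRev, TensorProduct.smul_tmul',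
      smul_eq_mul, mul_one]

/-- The commutator with `Z` is a derivation of `U(𝔤)` extending the action of `Z` on `𝔤₁`. -/
lemma antisymRev_act (Z : superPart k 𝔤 0) (Y : ExteriorAlgebra k (superPart k 𝔤 1)) :
    antisymRev (oddι k 𝔤) (extDer (evenOddBracket k 𝔤 Z) Y) =
      ι k 𝔤 (Z : 𝔤) * antisymRev (oddι k 𝔤) Y - antisymRev (oddι k 𝔤) Y * ι k 𝔤 (Z : 𝔤) := by
  refine (derivation_antisymRev (oddι k 𝔤)
    (LinearMap.mulLeft k (ι k 𝔤 (Z : 𝔤)) - LinearMap.mulRight k (ι k 𝔤 (Z : 𝔤)))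
    (evenOddBracket k 𝔤 Z) (fun a b => ?_) (fun v => ?_) Y).symm
  · simp only [LinearMap.sub_apply, LinearMap.mulLeft_apply, LinearMap.mulRight_apply]
    noncomm_ring
  · have h := ι_mul_ι k 𝔤 Z.2 v.2
    rw [zero_mul, uzpow_zero, one_smul] at h
    exact sub_eq_of_eq_add' h

lemma gammaRev_evenOp (Z : superPart k 𝔤 0) (m) :
    gammaRev k 𝔤 ((oddExtension k 𝔤).evenOp Z m) = gammaRev k 𝔤 m * ι k 𝔤 (Z : 𝔤) := by
  induction m using TensorProduct.induction_on with
  | zero => simp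
  | add x y hx hy => rw [map_add, map_add, hx, hy, map_add, add_mul]
  | tmul a Y =>
    have h := antisymRev_act Z Y
    have hj : evenInclusion k 𝔤 ((oddExtension k 𝔤).j Z) = ι k 𝔤 (Z : 𝔤) := evenInclusion_ι k 𝔤 Z
    rw [OddExtension.evenOp_tmul, map_sub, gammaRev_tmul, gammaRev_tmul, gammaRev_tmul,
      show (oddExtension k 𝔤).act = evenOddBracket k 𝔤 from rfl, h, map_mul, hj]
    noncomm_ring

lemma oddι_mul_oddι (x y : superPart k 𝔤 1) : oddι k 𝔤 x * oddι k 𝔤 y =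
    -(oddι k 𝔤 y * oddι k 𝔤 x) + ι k 𝔤 (oddOddBracket k 𝔤 x y : 𝔤) := by
  have h := ι_mul_ι k 𝔤 x.2 y.2
  rwa [neg_one_uzpow_one_smul] at h

/-- Here the recursion for `corr` is recovered inside `U(𝔤)`: splitting off the last factor of the
antisymmetrization of `x ∧ Y` and reordering `x y` with `x y = -y x + [x, y]` produces the image of
`stepForm`. -/
lemma gammaRev_oddAct_one_tmul (p : ℕ) (x : superPart k 𝔤 1)
    {Y : ExteriorAlgebra k (superPart k 𝔤 1)} (hY : Y ∈ ⋀[k]^p (superPart k 𝔤 1)) :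
    gammaRev k 𝔤 ((oddExtension k 𝔤).oddAct x (1 ⊗ₜ Y)) =
      antisymRev (oddι k 𝔤) Y * oddι k 𝔤 x := by
  induction p using Nat.strong_induction_on generalizing x Y with
  | _ p ih =>
  -- The induction hypothesis extended over `U(𝔤₀)`; it is applied to the correction terms, which
  -- have strictly smaller degree.
  have hlow : ∀ q < p, ∀ x, ∀ m ∈ OddExtension.degLT _ q,
      gammaRev k 𝔤 ((oddExtension k 𝔤).oddAct x m) = gammaRev k 𝔤 m * oddι k 𝔤 x := by
    intro q hq x m hm
    induction hm using Submodule.span_induction with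
    | mem m h =>
      obtain ⟨r, hr, a, Z, hZ, rfl⟩ := h
      rw [← mul_one a, ← smul_eq_mul, ← TensorProduct.smul_tmul', OddExtension.oddOp_smul,
        gammaRev_smul, gammaRev_smul, ih r (by omega) x hZ, gammaRev_one_tmul, mul_assoc]
    | zero => simp
    | add m m' _ _ h h' => rw [map_add, map_add, h, h', map_add, add_mul]
    | smul c m _ h => rw [map_smul, map_smul, h, map_smul, smul_mul_assoc]
  have h0 : (p : k) + 1 ≠ 0 := Nat.cast_add_one_ne_zero p
  have h1 : contract (((oddExtension k 𝔤).stepForm (oddExtension k 𝔤).corr x).compr₂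
      (gammaRev k 𝔤)) Y =
      contract (-((antisymRevForm (oddι k 𝔤)).compr₂ (LinearMap.mulRight k (oddι k 𝔤 x)) +
        (antisymRevForm (oddι k 𝔤)).compl₂
          (LinearMap.mulLeft k (ExteriorAlgebra.ι k x)))) Y := by
    cases p with
    | zero => rw [contract_of_mem_zero _ hY, contract_of_mem_zero _ hY]
    | succ p =>
      refine contract_congr (fun y Y' hY' => ?_) hY
      have hc := ih p (by omega) x hY'
      rw [OddExtension.oddOp_one_tmul, map_add, gammaRev_one_tmul] at hc
      have he : gammaRev k 𝔤 ((oddExtension k 𝔤).evenCore (oddOddBracket k 𝔤 x y) Y') =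
          antisymRev (oddι k 𝔤) Y' * ι k 𝔤 (oddOddBracket k 𝔤 x y : 𝔤) := by
        rw [← gammaRev_one_tmul, ← gammaRev_evenOp]
        rw [OddExtension.evenOp, LinearMap.comp_apply, OddExtension.leftExt_tmul, one_smul]
      simp only [LinearMap.compr₂_apply, LinearMap.neg_apply, LinearMap.add_apply,
        LinearMap.compl₂_apply, LinearMap.mulRight_apply, LinearMap.mulLeft_apply,
        antisymRevForm_apply, OddExtension.stepForm_apply]
      rw [map_sub, hlow p (by omega) y _ ((oddExtension k 𝔤).corr_mem x p Y' hY'),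
        eq_sub_of_add_eq' hc, sub_mul, mul_assoc, oddι_mul_oddι x y]
      rw [show (oddExtension k 𝔤).br = oddOddBracket k 𝔤 from rfl, he]
      noncomm_ring
  -- The recursion in degree `p + 1`, with the removal of `x` separated. The remaining contraction
  -- is the one occurring in `h1` with the opposite sign, so it drops out of the sum.
  have h2 : ((p : k) + 1) • antisymRev (oddι k 𝔤) (ExteriorAlgebra.ι k x * Y) =
      antisymRev (oddι k 𝔤) Y * oddι k 𝔤 x - contract ((antisymRevForm (oddι k 𝔤)).compl₂
          (LinearMap.mulLeft k (ExteriorAlgebra.ι k x))) Y := by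
    have := smul_antisymRev (oddι k 𝔤) (ι_mul_mem x hY)
    rw [Nat.cast_succ] at this
    rw [this, contract_ι_mul, antisymRevForm_apply]
  have h3 : ((p : k) + 1) • gammaRev k 𝔤 ((oddExtension k 𝔤).oddAct x (1 ⊗ₜ Y)) =
      ((p : k) + 1) • (antisymRev (oddι k 𝔤) Y * oddι k 𝔤 x) := by
    rw [OddExtension.oddOp_one_tmul, map_add, gammaRev_one_tmul, smul_add, h2, ← map_smul,
      (oddExtension k 𝔤).corr_recursion x hY, map_neg, map_contract, h1, contract_neg,
      contract_add, ← map_contract, ← smul_antisymRev _ hY, add_smul, one_smul, map_smul,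
      LinearMap.mulRight_apply]
    abel
  rw [← inv_smul_smul₀ h0 (gammaRev k 𝔤 _), h3, inv_smul_smul₀ h0]

lemma gammaRev_oddAct (x : superPart k 𝔤 1) (m) :
    gammaRev k 𝔤 ((oddExtension k 𝔤).oddAct x m) = gammaRev k 𝔤 m * oddι k 𝔤 x := by
  induction m using TensorProduct.induction_on with
  | zero => simp
  | add m m' h h' => rw [map_add, map_add, h, h', map_add, add_mul]
  | tmul a Y =>
    have h1 : gammaRev k 𝔤 ∘ₗ (oddExtension k 𝔤).oddAct x ∘ₗ TensorProduct.mk k _ _ 1 =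
        LinearMap.mulRight k (oddι k 𝔤 x) ∘ₗ antisymRev (oddι k 𝔤) :=
      hom_ext_exteriorPower fun p Y hY => gammaRev_oddAct_one_tmul p x hY
    have h2 : gammaRev k 𝔤 ((oddExtension k 𝔤).oddAct x (1 ⊗ₜ Y)) =
      antisymRev (oddι k 𝔤) Y * oddι k 𝔤 x := LinearMap.congr_fun h1 Y
    rw [← mul_one a, ← smul_eq_mul, ← TensorProduct.smul_tmul', OddExtension.oddOp_smul,
      gammaRev_smul, gammaRev_smul, h2, gammaRev_one_tmul, mul_assoc]

lemma gammaRev_rightAct (x : 𝔤) (m) :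
    gammaRev k 𝔤 (rightAct k 𝔤 x m) = gammaRev k 𝔤 m * ι k 𝔤 x := by
  have h : rightAct k 𝔤 x m = (oddExtension k 𝔤).evenOp (gradedProj (superPart k 𝔤) 0 x) m +
    (oddExtension k 𝔤).oddAct (gradedProj (superPart k 𝔤) 1 x) m := rfl
  rw [h, map_add, gammaRev_evenOp, gammaRev_oddAct]
  conv_rhs => rw [← gradedProj_add (superPart k 𝔤) x, map_add, mul_add]
  rfl

/-- `gammaRev` intertwines the right actions and sends `1 ⊗ 1` to `1`, so the composite fixes every
product of elements of `𝔤`. -/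
lemma gammaRev_orbitMap (u : SuperUEA k 𝔤) : gammaRev k 𝔤 (orbitMap k 𝔤 u) = u := by
  induction u using ι_induction with
  | one =>
    rw [orbitMap_apply, map_one]
    exact (gammaRev_one_tmul 1).trans (antisymRev_one _)
  | add u v hu hv => rw [map_add, map_add, hu, hv]
  | smul c u hu => rw [map_smul, map_smul, hu]
  | mul_ι u x hu => rw [orbitMap_mul_ι, gammaRev_rightAct, hu]

lemma gammaRev_bijective : Function.Bijective (gammaRev k 𝔤) :=
  Function.bijective_iff_has_inverse.mpr ⟨orbitMap k 𝔤, orbitMap_gammaRev, gammaRev_orbitMap⟩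

/-- The Poincaré-Birkhoff-Witt theorem for Lie superalgebras, relative to the even part. -/
theorem gammaHat_bijective : Function.Bijective (gammaHat k 𝔤) := by
  let e : UniversalEnvelopingAlgebra k (superPart k 𝔤 0) ⊗[k]
      ExteriorAlgebra k (superPart k 𝔤 1) ≃ₗ[k] _ :=
    TensorProduct.congr (LinearEquiv.refl k _) (LinearEquiv.ofInvolutive
      (CliffordAlgebra.reverse (Q := (0 : QuadraticForm k (superPart k 𝔤 1))))
      CliffordAlgebra.reverse_involutive)
  -- The two antisymmetrizations differ by reversal of the exterior algebra, an involution.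
  have h : ⇑(gammaHat k 𝔤) = gammaRev k 𝔤 ∘ e := by
    funext m
    induction m using TensorProduct.induction_on with
    | zero => simp
    | add x y hx hy =>
      simp only [Function.comp_apply] at hx hy ⊢
      rw [map_add, map_add, map_add, hx, hy]
    | tmul a Y => exact (gammaRev_tmul_reverse a Y).symm
  rw [h]
  exact gammaRev_bijective.comp e.bijective

end SuperUEA

/-! ### Compatibility of `γ̂` with parities. -/

namespace ExteriorAlgebra

variable {k : Type*} [Field k] {V : Type*} [AddCommGroup V] [Module k V]

lemma exteriorPower_le_extParity (p : ℕ) : ⋀[k]^p V ≤ extParity k V (p : ZMod 2) :=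
  le_iSup (fun j : { n : ℕ // (n : ZMod 2) = p } =>
    LinearMap.range (CliffordAlgebra.ι (0 : QuadraticForm k V)) ^ (j : ℕ)) ⟨p, rfl⟩

lemma extParity_le {i : ZMod 2} {S : Submodule k (ExteriorAlgebra k V)}
    (h : ∀ p : ℕ, (p : ZMod 2) = i → ⋀[k]^p V ≤ S) : extParity k V i ≤ S :=
  iSup_le fun j => h j.1 j.2

lemma ι_mem_extParity (v : V) : ι k v ∈ extParity k V 1 := CliffordAlgebra.ι_mem_evenOdd_one _ v

end ExteriorAlgebra

namespace SuperUEA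

open ExteriorAlgebra

attribute [local instance 100] LieRing.ofAssociativeRing

variable {k : Type*} [Field k] [CharZero k] {𝔤 : Type*} [AddCommGroup 𝔤] [Module k 𝔤]
  [LieSuperalgebra k 𝔤]

/-- The form `(y, Y) ↦ y γ(Y)`. -/
def gammaForm : superPart k 𝔤 1 →ₗ[k] ExteriorAlgebra k (superPart k 𝔤 1) →ₗ[k] SuperUEA k 𝔤 :=
  ((LinearMap.mul k (SuperUEA k 𝔤)).compl₂ (antisymmetrizer k 𝔤)) ∘ₗ oddι k 𝔤

lemma gammaForm_apply (y : superPart k 𝔤 1) (Y : ExteriorAlgebra k (superPart k 𝔤 1)) :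
    gammaForm y Y = ι k 𝔤 (y : 𝔤) * antisymmetrizer k 𝔤 Y := rfl

lemma antisymmetrizer_one : antisymmetrizer k 𝔤 1 = 1 := antisym_one _

lemma antisymmetrizer_degOp (Y : ExteriorAlgebra k (superPart k 𝔤 1)) :
    antisymmetrizer k 𝔤 (degOp Y) = contract gammaForm Y := antisym_degOp _ Y

lemma smul_antisymmetrizer {p : ℕ} {Y : ExteriorAlgebra k (superPart k 𝔤 1)}
    (hY : Y ∈ ⋀[k]^p (superPart k 𝔤 1)) :
    (p : k) • antisymmetrizer k 𝔤 Y = contract gammaForm Y := smul_antisym _ hY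

/-- Up to the factor `p + 1`, the value in degree `p + 1` is a contraction of terms `y γ(Y')`, and
each `y` shifts the parity by one. -/
lemma antisymmetrizer_mem_of_exteriorPower {p : ℕ} {Y : ExteriorAlgebra k (superPart k 𝔤 1)}
    (hY : Y ∈ ⋀[k]^p (superPart k 𝔤 1)) : antisymmetrizer k 𝔤 Y ∈ gr k 𝔤 (p : ZMod 2) := by
  induction p generalizing Y with
  | zero =>
    induction hY using exteriorPower_zero_induction with
    | algebraMap c =>
      rw [Algebra.algebraMap_eq_smul_one, map_smul, antisymmetrizer_one, Nat.cast_zero]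
      exact Submodule.smul_mem _ c SetLike.GradedOne.one_mem
  | succ p ih =>
    have h0 : ((p + 1 : ℕ) : k) ≠ 0 := Nat.cast_ne_zero.mpr (by omega)
    rw [← inv_smul_smul₀ h0 (antisymmetrizer k 𝔤 Y), smul_antisymmetrizer hY]
    refine Submodule.smul_mem _ _ (contract_mem _ (fun y Y' hY' => ?_) hY)
    rw [gammaForm_apply, Nat.cast_succ, add_comm]
    exact SetLike.mul_mem_graded (ι_mem_gr k 𝔤 y.2) (ih hY')

lemma antisymmetrizer_mem {i : ZMod 2} {Y : ExteriorAlgebra k (superPart k 𝔤 1)}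
    (hY : Y ∈ extParity k (superPart k 𝔤 1) i) : antisymmetrizer k 𝔤 Y ∈ gr k 𝔤 i :=
  extParity_le (S := (gr k 𝔤 i).comap (antisymmetrizer k 𝔤))
    (by rintro p rfl Y hY; exact antisymmetrizer_mem_of_exteriorPower hY) hY

lemma evenInclusion_mem (a : UniversalEnvelopingAlgebra k (superPart k 𝔤 0)) :
    evenInclusion k 𝔤 a ∈ gr k 𝔤 0 := by
  let T : Subalgebra k (UniversalEnvelopingAlgebra k (superPart k 𝔤 0)) :=
    { carrier := {a | evenInclusion k 𝔤 a ∈ gr k 𝔤 0}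
      mul_mem' := fun {a b} ha hb => by
        have := SetLike.mul_mem_graded (A := gr k 𝔤) ha hb
        rw [Set.mem_ofPred_eq, map_mul]
        rwa [add_zero] at this
      add_mem' := fun {a b} ha hb => by
        rw [Set.mem_ofPred_eq, map_add]
        exact add_mem ha hb
      algebraMap_mem' := fun c => by
        rw [Set.mem_ofPred_eq, AlgHom.commutes, Algebra.algebraMap_eq_smul_one]
        exact Submodule.smul_mem _ c SetLike.GradedOne.one_mem }
  have hT : T = ⊤ := UniversalEnvelopingAlgebra.eq_top_of_ι_mem T fun Z => by
    change evenInclusion k 𝔤 _ ∈ gr k 𝔤 0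
    rw [evenInclusion_ι]
    exact ι_mem_gr k 𝔤 Z.2
  have : a ∈ T := hT ▸ Algebra.mem_top
  exact this

lemma gammaHat_mem {i : ZMod 2} {m : UniversalEnvelopingAlgebra k (superPart k 𝔤 0) ⊗[k]
    ExteriorAlgebra k (superPart k 𝔤 1)} (hm : m ∈ gammaDomainParity k 𝔤 i) :
    gammaHat k 𝔤 m ∈ gr k 𝔤 i := by
  obtain ⟨t, rfl⟩ := hm
  induction t using TensorProduct.induction_on with
  | zero => simp
  | add x y hx hy => rw [map_add, map_add]; exact add_mem hx hy
  | tmul a Y =>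
    rw [LinearMap.lTensor_tmul, gammaHat_tmul]
    have := SetLike.mul_mem_graded (evenInclusion_mem a) (antisymmetrizer_mem Y.2)
    rwa [zero_add] at this

/-- A surjection that preserves parities maps each homogeneous part onto the corresponding one: a
homogeneous image equals the image of the component of the same parity. -/
lemma map_gammaDomainParity (i : ZMod 2) :
    (gammaDomainParity k 𝔤 i).map ((gammaHat k 𝔤).restrictScalars k) = gr k 𝔤 i := by
  refine le_antisymm ?_ fun u hu => ?_
  · rintro _ ⟨m, hm, rfl⟩
    exact gammaHat_mem hm
  obtain ⟨m, rfl⟩ := gammaHat_bijective.2 u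
  let P (j : ZMod 2) := LinearMap.lTensor (UniversalEnvelopingAlgebra k (superPart k 𝔤 0))
    (extParity k (superPart k 𝔤 1) j).subtype (LinearMap.lTensor _
      (gradedProj (extParity k (superPart k 𝔤 1)) j) m)
  have hP : ∀ j, P j ∈ gammaDomainParity k 𝔤 j := fun j => ⟨_, rfl⟩
  have hm : P 0 + P 1 = m := by
    simp only [P]
    clear hu hP P
    induction m using TensorProduct.induction_on with
    | zero => simp
    | add x y hx hy =>
      simp only [map_add]
      rw [add_add_add_comm, hx, hy]
    | tmul a Y =>
      simp only [LinearMap.lTensor_tmul, Submodule.subtype_apply]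
      rw [← TensorProduct.tmul_add, gradedProj_add]
  have h01 : ∀ i : ZMod 2, i = 0 ∨ i = 1 := by decide
  have key : gammaHat k 𝔤 m = gammaHat k 𝔤 (P i) := by
    have h := congrArg (fun u => (gradedProj (gr k 𝔤) i u : SuperUEA k 𝔤))
      ((congrArg (gammaHat k 𝔤) hm).symm.trans (map_add (gammaHat k 𝔤) (P 0) (P 1)))
    simp only [map_add, Submodule.coe_add] at h
    rw [gradedProj_of_mem _ hu] at h
    rcases h01 i with rfl | rfl
    · rwa [gradedProj_of_mem _ (gammaHat_mem (hP 0)),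
        gradedProj_of_ne _ (gammaHat_mem (hP 1)) (by decide), add_zero] at h
    · rwa [gradedProj_of_mem _ (gammaHat_mem (hP 1)),
        gradedProj_of_ne _ (gammaHat_mem (hP 0)) (by decide), zero_add] at h
  exact ⟨P i, hP i, key.symm⟩

end SuperUEA

/-! ### Contractions in the convolution algebra of `⋀(V)`. -/

namespace SuperHom

section LinearVersions

variable {k : Type*} [Field k] {C : Type*} [Ring C] [Algebra k C] {𝒞 : ZMod 2 → Submodule k C}
  {R : Type*} [CommRing R] [Algebra k R]

/-- The identification of `SuperHom` with the space of linear maps. -/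
def linEquiv (𝒞 : ZMod 2 → Submodule k C) (R : Type*) [CommRing R] [Algebra k R] :
    SuperHom 𝒞 R ≃ₗ[k] (C →ₗ[k] R) := LinearEquiv.refl k _

@[simp] lemma neg_apply (f : SuperHom 𝒞 R) (c : C) : (-f) c = -f c := rfl
@[simp] lemma sub_apply (f g : SuperHom 𝒞 R) (c : C) : (f - g) c = f c - g c := rfl

/-- `shift s` as a linear map. -/
def shiftₗ (s : C) : SuperHom 𝒞 R →ₗ[k] SuperHom 𝒞 R where
  toFun := shift s
  map_add' _ _ := rfl
  map_smul' _ _ := rfl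

variable [GradedAlgebra 𝒞]

/-- `twist i` as a linear map. -/
def twistₗ (i : ZMod 2) : SuperHom 𝒞 R →ₗ[k] SuperHom 𝒞 R where
  toFun := twist i
  map_add' _ _ := rfl
  map_smul' _ _ := rfl

@[simp] lemma twistₗ_apply (i : ZMod 2) (f : SuperHom 𝒞 R) : twistₗ i f = twist i f := rfl

lemma shift_twist_one_of_odd [PrimitivelyGenerated 𝒞] {s : C} (hs : s ∈ 𝒞 1) (f : SuperHom 𝒞 R) :
    shift s (twist 1 f) = -twist 1 (shift s f) := by
  rw [shift_twist hs]
  simp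

lemma twist_apply_one (i : ZMod 2) (f : SuperHom 𝒞 R) : twist i f 1 = f 1 := by
  rw [twist_apply, signTwist_of_mem 𝒞 i (SetLike.GradedOne.one_mem (A := 𝒞))]
  simp

end LinearVersions

open ExteriorAlgebra

variable {k : Type*} [Field k] {V : Type*} [AddCommGroup V] [Module k V]
  {R : Type*} [CommRing R] [Algebra k R]

/-- `contract`, for families of elements of `SuperHom`. -/
def superContract (F : V →ₗ[k] SuperHom (extParity k V) R) : SuperHom (extParity k V) R :=
  mk _ (contract ((linEquiv _ R).toLinearMap ∘ₗ F))

lemma superContract_apply (F : V →ₗ[k] SuperHom (extParity k V) R) (Y : ExteriorAlgebra k V) :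
    superContract F Y = contract ((linEquiv _ R).toLinearMap ∘ₗ F) Y := rfl

lemma superContract_one (F : V →ₗ[k] SuperHom (extParity k V) R) :
    superContract F 1 = 0 := contract_one _

lemma shift_superContract (F : V →ₗ[k] SuperHom (extParity k V) R) (v : V) :
    shift (ι k v) (superContract F) = F v - superContract (shiftₗ (ι k v) ∘ₗ F) :=
  SuperHom.ext fun Y => contract_ι_mul _ v Y

lemma superContract_add (F G : V →ₗ[k] SuperHom (extParity k V) R) :
    superContract (F + G) = superContract F + superContract G :=
  SuperHom.ext fun Y => by
    rw [superContract_apply, LinearMap.comp_add, contract_add]; rfl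

lemma superContract_neg (F : V →ₗ[k] SuperHom (extParity k V) R) :
    superContract (-F) = -superContract F :=
  SuperHom.ext fun Y => by
    rw [superContract_apply, LinearMap.comp_neg, contract_neg]; rfl

/-- The sign appears because `F` is evaluated on an element with one odd factor fewer. -/
lemma twist_superContract (F : V →ₗ[k] SuperHom (extParity k V) R) :
    twist 1 (superContract F) = -superContract (twistₗ 1 ∘ₗ F) := by
  refine SuperHom.ext fun Y => ?_
  induction Y using ι_mul_induction generalizing F with
  | one => rw [twist_apply_one, neg_apply, superContract_one, superContract_one, neg_zero]
  | add x y hx hy => rw [map_add, map_add, hx, hy]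
  | smul c x hx => rw [map_smul, map_smul, hx]
  | ι_mul v Y ih =>
    have e : shiftₗ (ι k v) ∘ₗ twistₗ 1 ∘ₗ F = -(twistₗ 1 ∘ₗ shiftₗ (ι k v) ∘ₗ F) :=
      LinearMap.ext fun y => shift_twist_one_of_odd (ι_mem_extParity v) _
    have h := ih (shiftₗ (ι k v) ∘ₗ F)
    rw [neg_apply] at h
    rw [← shift_apply, ← shift_apply, shift_twist_one_of_odd (ι_mem_extParity v),
      shift_superContract, ← twistₗ_apply, map_sub]
    change -(twist 1 (F v) Y - twist 1 (superContract (shiftₗ (ι k v) ∘ₗ F)) Y) =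
      -(shift (ι k v) (superContract (twistₗ 1 ∘ₗ F))) Y
    rw [shift_superContract, e, superContract_neg, h]
    simp

lemma comul_ι (v : V) : PrimitivelyGenerated.comul (𝒞 := extParity k V) (ι k v) =
    ι k v ᵍ⊗ₜ[k] (1 : ExteriorAlgebra k V) + (1 : ExteriorAlgebra k V) ᵍ⊗ₜ[k] ι k v :=
  ExteriorAlgebra.lift_ι_apply ..

lemma shift_ι_mul (v : V) (F G : SuperHom (extParity k V) R) :
    shift (ι k v) (F * G) = shift (ι k v) F * twist 1 G + F * shift (ι k v) G :=
  shift_mul (ι_mem_extParity v) (comul_ι v) F G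

/-- Induction on wedge factors: translation by `v` acts on both sides as a superderivation. The
twist of `G` is the Koszul sign for moving the removed odd vector past it, and moving `v` as well
accounts for the double twist. -/
lemma superContract_mul (F : V →ₗ[k] SuperHom (extParity k V) R)
    (G : SuperHom (extParity k V) R) :
    superContract F * G = superContract (LinearMap.mulRight k (twist 1 G) ∘ₗ F) := by
  refine SuperHom.ext fun Y => ?_
  induction Y using ι_mul_induction generalizing F G with
  | one => rw [mul_apply_one, superContract_one, superContract_one, zero_mul]
  | add x y hx hy => rw [map_add, map_add, hx, hy]
  | smul c x hx => rw [map_smul, map_smul, hx]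
  | ι_mul v Y ih =>
    have e : shiftₗ (ι k v) ∘ₗ LinearMap.mulRight k (twist 1 G) ∘ₗ F =
        LinearMap.mulRight k (twist 1 (twist 1 G)) ∘ₗ shiftₗ (ι k v) ∘ₗ F +
          -(LinearMap.mulRight k (twist 1 (shift (ι k v) G)) ∘ₗ F) :=
      LinearMap.ext fun y => by
        change shift (ι k v) (F y * twist 1 G) = shift (ι k v) (F y) * twist 1 (twist 1 G) +
          -(F y * twist 1 (shift (ι k v) G))
        rw [shift_ι_mul, shift_twist_one_of_odd (ι_mem_extParity v), mul_neg]
    rw [← shift_apply, ← shift_apply, shift_ι_mul, shift_superContract, shift_superContract, e,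
      superContract_add, superContract_neg, sub_mul]
    simp only [add_apply, sub_apply, neg_apply, ih, LinearMap.comp_apply, LinearMap.mulRight_apply]
    ring

lemma mul_superContract (G : SuperHom (extParity k V) R)
    (F : V →ₗ[k] SuperHom (extParity k V) R) :
    G * superContract F = superContract (LinearMap.mulLeft k G ∘ₗ F) := by
  refine SuperHom.ext fun Y => ?_
  induction Y using ι_mul_induction generalizing F G with
  | one => rw [mul_apply_one, superContract_one, superContract_one, mul_zero]
  | add x y hx hy => rw [map_add, map_add, hx, hy]
  | smul c x hx => rw [map_smul, map_smul, hx]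
  | ι_mul v Y ih =>
    have e : shiftₗ (ι k v) ∘ₗ LinearMap.mulLeft k G ∘ₗ F =
        LinearMap.mulLeft k (shift (ι k v) G) ∘ₗ twistₗ 1 ∘ₗ F +
          LinearMap.mulLeft k G ∘ₗ shiftₗ (ι k v) ∘ₗ F :=
      LinearMap.ext fun y => shift_ι_mul v _ _
    rw [← shift_apply, ← shift_apply, shift_ι_mul, shift_superContract, shift_superContract, e,
      superContract_add, twist_superContract, mul_neg, mul_sub]
    simp only [add_apply, sub_apply, neg_apply, ih, LinearMap.comp_apply, LinearMap.mulLeft_apply]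
    ring

/-- The family `v ↦ shift (ι v) F`. -/
def shiftFamily (F : SuperHom (extParity k V) R) : V →ₗ[k] SuperHom (extParity k V) R where
  toFun v := shift (ι k v) F
  map_add' v w := SuperHom.ext fun Y => by simp [add_mul]
  map_smul' c v := SuperHom.ext fun Y => by simp

lemma superContract_shiftFamily (F : SuperHom (extParity k V) R) (Y : ExteriorAlgebra k V) :
    superContract (shiftFamily F) Y = F (degOp Y) :=
  ((map_contract F.toLin (LinearMap.mul k (ExteriorAlgebra k V) ∘ₗ ι k) Y).trans
    (congrArg (fun B => contract B Y) (LinearMap.ext fun _ => LinearMap.ext fun _ => rfl))).symm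

lemma shiftFamily_mul (F G : SuperHom (extParity k V) R) :
    shiftFamily (F * G) = LinearMap.mulRight k (twist 1 G) ∘ₗ shiftFamily F +
      LinearMap.mulLeft k F ∘ₗ shiftFamily G :=
  LinearMap.ext fun v => shift_ι_mul v F G

/-- By `superContract_shiftFamily` this says that precomposition with `degOp` is a derivation of the
convolution algebra. -/
lemma superContract_shiftFamily_mul (F G : SuperHom (extParity k V) R) :
    superContract (shiftFamily (F * G)) =
      superContract (shiftFamily F) * G + F * superContract (shiftFamily G) := by
  rw [shiftFamily_mul, superContract_add, superContract_mul, mul_superContract]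

lemma ext_exteriorPower {F G : SuperHom (extParity k V) R}
    (h : ∀ p, ∀ Y ∈ ⋀[k]^p V, F Y = G Y) : F = G :=
  (linEquiv _ R).injective (hom_ext_exteriorPower h)

end SuperHom

/-! ### The isomorphism `f ↦ f ∘ γ`. -/

namespace SuperUEA

open ExteriorAlgebra SuperHom

attribute [local instance 100] LieRing.ofAssociativeRing

variable {k : Type*} [Field k] [CharZero k] {𝔤 : Type*} [AddCommGroup 𝔤] [Module k 𝔤]
  [LieSuperalgebra k 𝔤] {R : Type*} [CommRing R] [Algebra k R]

/-- The map `f ↦ f ∘ γ`. -/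
def pullGamma :
    SuperHom (gr k 𝔤) R →ₗ[k] SuperHom (extParity k (superPart k 𝔤 1)) R where
  toFun f := mk _ (f.toLin ∘ₗ antisymmetrizer k 𝔤)
  map_add' _ _ := rfl
  map_smul' _ _ := rfl

@[simp] lemma pullGamma_apply (f : SuperHom (gr k 𝔤) R)
    (Y : ExteriorAlgebra k (superPart k 𝔤 1)) : pullGamma f Y = f (antisymmetrizer k 𝔤 Y) := rfl

lemma antisymmetrizer_signTwist (i : ZMod 2) (Y : ExteriorAlgebra k (superPart k 𝔤 1)) :
    antisymmetrizer k 𝔤 (signTwist (extParity k (superPart k 𝔤 1)) i Y) =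
      signTwist (gr k 𝔤) i (antisymmetrizer k 𝔤 Y) := by
  induction Y using DirectSum.Decomposition.inductionOn (extParity k (superPart k 𝔤 1)) with
  | zero => simp
  | add x y hx hy => simp only [map_add, hx, hy]
  | homogeneous Y =>
    rw [signTwist_of_mem _ i Y.2, signTwist_of_mem _ i (antisymmetrizer_mem Y.2), Units.smul_def,
      map_zsmul, Units.smul_def]

lemma pullGamma_twist (i : ZMod 2) (f : SuperHom (gr k 𝔤) R) :
    pullGamma (twist i f) = twist i (pullGamma f) :=
  SuperHom.ext fun Y => by
    rw [pullGamma_apply, twist_apply, twist_apply, pullGamma_apply, antisymmetrizer_signTwist]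

/-- The family `y ↦ (Y ↦ f (y γ(Y)))`. -/
def pullFamily (f : SuperHom (gr k 𝔤) R) :
    superPart k 𝔤 1 →ₗ[k] SuperHom (extParity k (superPart k 𝔤 1)) R where
  toFun y := pullGamma (shift (ι k 𝔤 (y : 𝔤)) f)
  map_add' v w := SuperHom.ext fun Y => by simp [add_mul]
  map_smul' c v := SuperHom.ext fun Y => by simp

/-- `f(y γ(Y))` and `f(γ(y ∧ Y))` differ in general; only their contractions agree, both being `f ∘
γ ∘ degOp`. This suffices for multiplicativity. -/
lemma superContract_pullFamily (f : SuperHom (gr k 𝔤) R) :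
    superContract (pullFamily f) = superContract (shiftFamily (pullGamma f)) :=
  SuperHom.ext fun Y => by
    rw [superContract_shiftFamily, pullGamma_apply, antisymmetrizer_degOp]
    exact ((map_contract f.toLin gammaForm Y).trans (congrArg (fun B => contract B Y)
      (LinearMap.ext fun _ => LinearMap.ext fun _ => rfl))).symm

lemma shift_ι_mul (y : superPart k 𝔤 1) (f g : SuperHom (gr k 𝔤) R) :
    shift (ι k 𝔤 (y : 𝔤)) (f * g) =
      shift (ι k 𝔤 (y : 𝔤)) f * twist 1 g + f * shift (ι k 𝔤 (y : 𝔤)) g :=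
  shift_mul (ι_mem_gr k 𝔤 y.2) (lift_ι ..) f g

/-- In degree `p + 1`, `(p + 1)(fg)(γ(Y))` is a contraction of `(fg)(y γ(Y'))`, to which the
superderivation rule and the induction hypothesis apply. The result is matched with the derivation
rule for the degree operator on `⋀(𝔤₁)`. -/
lemma pullGamma_mul_apply {p : ℕ} {Y : ExteriorAlgebra k (superPart k 𝔤 1)}
    (hY : Y ∈ ⋀[k]^p (superPart k 𝔤 1)) (f g : SuperHom (gr k 𝔤) R) :
    pullGamma (f * g) Y = (pullGamma f * pullGamma g) Y := by
  induction p generalizing Y f g with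
  | zero =>
    induction hY using exteriorPower_zero_induction with
    | algebraMap c =>
      rw [Algebra.algebraMap_eq_smul_one, map_smul, map_smul, mul_apply_one, pullGamma_apply,
        pullGamma_apply, pullGamma_apply, antisymmetrizer_one, mul_apply_one]
  | succ p ih =>
    have h0 : ((p + 1 : ℕ) : k) ≠ 0 := Nat.cast_ne_zero.mpr (by omega)
    refine (smul_right_injective R h0) ?_
    change ((p + 1 : ℕ) : k) • _ = ((p + 1 : ℕ) : k) • _
    -- The derivation rule must be used before exchanging `shiftFamily` for `pullFamily`, since the
    -- two families agree only when contracted.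
    rw [← map_smul (pullGamma f * pullGamma g), ← degOp_of_mem hY, ← superContract_shiftFamily,
      superContract_shiftFamily_mul, ← superContract_pullFamily, ← superContract_pullFamily,
      superContract_mul, mul_superContract, ← superContract_add, pullGamma_apply, ← map_smul,
      smul_antisymmetrizer hY]
    refine (map_contract (f * g).toLin gammaForm Y).trans ?_
    refine contract_congr (fun y Y' hY' => ?_) hY
    change shift (ι k 𝔤 (y : 𝔤)) (f * g) (antisymmetrizer k 𝔤 Y') = _
    rw [shift_ι_mul, SuperHom.add_apply, ← pullGamma_apply, ← pullGamma_apply, ih hY', ih hY',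
      pullGamma_twist]
    rfl

lemma pullGamma_mul (f g : SuperHom (gr k 𝔤) R) :
    pullGamma (f * g) = pullGamma f * pullGamma g :=
  ext_exteriorPower fun _ _ hY => pullGamma_mul_apply hY f g

/-- In positive degree both counits are contractions of forms that vanish, because translating a
counit by a primitive element gives zero. -/
lemma pullGamma_one : pullGamma (1 : SuperHom (gr k 𝔤) R) = 1 := by
  refine ext_exteriorPower fun p Y hY => ?_
  cases p with
  | zero =>
    induction hY using exteriorPower_zero_induction with
    | algebraMap c =>
      rw [Algebra.algebraMap_eq_smul_one, map_smul, map_smul, pullGamma_apply,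
        antisymmetrizer_one, SuperHom.one_apply, SuperHom.one_apply, map_one,
        map_one, map_one, map_one]
  | succ p =>
    have h0 : ((p + 1 : ℕ) : k) ≠ 0 := Nat.cast_ne_zero.mpr (by omega)
    refine (smul_right_injective R h0) ?_
    change ((p + 1 : ℕ) : k) • _ = ((p + 1 : ℕ) : k) • _
    rw [pullGamma_apply, ← map_smul (1 : SuperHom (gr k 𝔤) R), smul_antisymmetrizer hY,
      ← map_smul, ← degOp_of_mem hY]
    refine (map_contract (1 : SuperHom (gr k 𝔤) R).toLin gammaForm Y).trans
      (Eq.trans ?_ (map_contract (1 : SuperHom (extParity k (superPart k 𝔤 1)) R).toLin _ Y).symm)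
    refine congrArg (fun B => contract B Y) (LinearMap.ext fun y => LinearMap.ext fun Y' => ?_)
    change shift (ι k 𝔤 (y : 𝔤)) (1 : SuperHom (gr k 𝔤) R) (antisymmetrizer k 𝔤 Y') =
      shift (ExteriorAlgebra.ι k y) (1 : SuperHom (extParity k (superPart k 𝔤 1)) R) Y'
    rw [shift_one (lift_ι ..), shift_one (ExteriorAlgebra.lift_ι_apply ..)]
    rfl

variable (δ : superPart k 𝔤 0 →ₗ⁅k⁆ Derivation k R R)

/-- The morphism of superalgebras `f ↦ f ∘ γ`. -/
def sectionsHom : superSections δ →ₐ[k] SuperHom (extParity k (superPart k 𝔤 1)) R :=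
  (AlgHom.ofLinearMap pullGamma pullGamma_one pullGamma_mul).comp (superSections δ).val

/-- The `U(𝔤₀)`-linear map `U(𝔤₀) ⊗ ⋀(𝔤₁) → R` that extends `F : ⋀(𝔤₁) → R`. -/
def extendEven (F : SuperHom (extParity k (superPart k 𝔤 1)) R) :
    UniversalEnvelopingAlgebra k (superPart k 𝔤 0) ⊗[k] ExteriorAlgebra k (superPart k 𝔤 1)
      →ₗ[k] R :=
  TensorProduct.lift (LinearMap.compl₂ (evenAction δ).toLinearMap F.toLin)

lemma extendEven_tmul (F : SuperHom (extParity k (superPart k 𝔤 1)) R)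
    (a : UniversalEnvelopingAlgebra k (superPart k 𝔤 0))
    (Y : ExteriorAlgebra k (superPart k 𝔤 1)) :
    extendEven δ F (a ⊗ₜ[k] Y) = evenAction δ a (F Y) := rfl

lemma extendEven_smul (F : SuperHom (extParity k (superPart k 𝔤 1)) R)
    (a : UniversalEnvelopingAlgebra k (superPart k 𝔤 0))
    (m : UniversalEnvelopingAlgebra k (superPart k 𝔤 0) ⊗[k]
      ExteriorAlgebra k (superPart k 𝔤 1)) :
    extendEven δ F (a • m) = evenAction δ a (extendEven δ F m) := by
  induction m using TensorProduct.induction_on with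
  | zero => rw [smul_zero, map_zero, map_zero]
  | add x y hx hy => rw [smul_add, map_add, map_add, map_add, hx, hy]
  | tmul b Y =>
    rw [TensorProduct.smul_tmul', extendEven_tmul, extendEven_tmul, smul_eq_mul,
      map_mul (evenAction δ)]
    rfl

lemma apply_gammaHat (f : superSections δ) (m : UniversalEnvelopingAlgebra k (superPart k 𝔤 0) ⊗[k]
      ExteriorAlgebra k (superPart k 𝔤 1)) :
    f.1 (gammaHat k 𝔤 m) = extendEven δ (sectionsHom δ f) m := by
  induction m using TensorProduct.induction_on with
  | zero => rw [map_zero, map_zero, map_zero]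
  | add x y hx hy => rw [map_add, map_add, map_add, hx, hy]
  | tmul a Y => exact f.2 a (antisymmetrizer k 𝔤 Y)

/-- Through `gammaHat`, `U(𝔤)` is the `U(𝔤₀)`-module induced from the vector space `⋀(𝔤₁)`, so a
`U(𝔤₀)`-linear map is determined by its restriction along `γ`, which can be prescribed. -/
lemma sectionsHom_bijective : Function.Bijective (sectionsHom δ) := by
  refine ⟨fun f g h => Subtype.ext (SuperHom.ext fun u => ?_), fun F => ?_⟩
  · obtain ⟨m, rfl⟩ := gammaHat_bijective.2 u
    rw [apply_gammaHat, apply_gammaHat, h]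
  · let e := LinearEquiv.ofBijective ((gammaHat k 𝔤).restrictScalars k) gammaHat_bijective
    let f : SuperHom (gr k 𝔤) R := mk _ (extendEven δ F ∘ₗ e.symm.toLinearMap)
    have hf : ∀ m, f (gammaHat k 𝔤 m) = extendEven δ F m := fun m =>
      congrArg (extendEven δ F) (e.symm_apply_apply m)
    refine ⟨⟨f, fun a u => ?_⟩, SuperHom.ext fun Y => ?_⟩
    · obtain ⟨m, rfl⟩ := gammaHat_bijective.2 u
      rw [← map_smul, hf, hf, extendEven_smul]
    · have h := hf (1 ⊗ₜ[k] Y)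
      rwa [gammaHat_tmul, map_one, one_mul, extendEven_tmul, map_one] at h

/-- The isomorphism `Hom_{U(𝔤₀)}(U(𝔤), R) ≃ Hom(⋀(𝔤₁), R)`, `f ↦ f ∘ γ`. -/
def sectionsEquiv : superSections δ ≃ₐ[k] SuperHom (extParity k (superPart k 𝔤 1)) R :=
  AlgEquiv.ofBijective (sectionsHom δ) (sectionsHom_bijective δ)

/-- For the converse direction, the part of `U(𝔤)` of a given parity is the image of `U(𝔤₀) ⊗ ⋀(𝔤₁)`
in that parity, and vanishing on `γ(Y)` propagates by `U(𝔤₀)`-linearity. -/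
lemma sectionsEquiv_mem_parity {i : ZMod 2} {f : superSections δ} :
    sectionsEquiv δ f ∈ SuperHom.parity (extParity k (superPart k 𝔤 1)) R i ↔
      f ∈ superSections.parity δ i := by
  refine ⟨fun h j hj u hu => ?_, fun h j hj Y hY => h j hj _ (antisymmetrizer_mem hY)⟩
  rw [← map_gammaDomainParity] at hu
  obtain ⟨_, ⟨t, rfl⟩, rfl⟩ := hu
  refine (apply_gammaHat δ f _).trans ?_
  induction t using TensorProduct.induction_on with
  | zero => rw [map_zero, map_zero]
  | add x y hx hy => rw [map_add, map_add, hx, hy, add_zero]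
  | tmul a Y =>
    rw [LinearMap.lTensor_tmul, extendEven_tmul]
    exact (congrArg (evenAction δ a) (h j hj Y Y.2)).trans (map_zero _)

lemma map_sectionsEquiv_parity (i : ZMod 2) :
    (superSections.parity δ i).map (sectionsEquiv δ).toLinearMap =
      SuperHom.parity (extParity k (superPart k 𝔤 1)) R i := by
  ext F
  constructor
  · rintro ⟨f, hf, rfl⟩
    exact (sectionsEquiv_mem_parity δ).mpr hf
  · intro hF
    obtain ⟨f, rfl⟩ := (sectionsEquiv δ).surjective F
    exact ⟨f, (sectionsEquiv_mem_parity δ).mp hF, rfl⟩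

end SuperUEA

/-! ### The tensor product form and degrees. -/

namespace SuperHom

open ExteriorAlgebra

section DualTensor

variable {k : Type*} [Field k] {C : Type*} [Ring C] [Algebra k C] {𝒞 : ZMod 2 → Submodule k C}
  [GradedAlgebra 𝒞] {R : Type*} [CommRing R] [Algebra k R]

/-- The identification `R ⊗ C^* ≃ Hom(C, R)` for a finite-dimensional `C`. -/
def dualTensorLinearEquiv (𝒞 : ZMod 2 → Submodule k C) (R : Type*) [CommRing R] [Algebra k R]
    [Module.Finite k C] : R ⊗[k] SuperHom 𝒞 k ≃ₗ[k] SuperHom 𝒞 R :=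
  TensorProduct.comm k R (SuperHom 𝒞 k) ≪≫ₗ
    TensorProduct.congr (linEquiv 𝒞 k) (LinearEquiv.refl k R) ≪≫ₗ
    dualTensorHomEquiv (R := k) (M := C) (N := R) ≪≫ₗ (linEquiv 𝒞 R).symm

lemma dualTensorLinearEquiv_tmul [Module.Finite k C] (r : R) (η : SuperHom 𝒞 k) (c : C) :
    dualTensorLinearEquiv 𝒞 R (r ⊗ₜ[k] η) c = η c • r := by
  rfl

lemma koszulMul_smul [Module.Finite k C] (r s : R) (η ζ : SuperHom 𝒞 k) (t : 𝒞 ᵍ⊗[k] 𝒞) :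
    koszulMul (dualTensorLinearEquiv 𝒞 R (r ⊗ₜ[k] η)) (dualTensorLinearEquiv 𝒞 R (s ⊗ₜ[k] ζ)) t =
      koszulMul η ζ t • (r * s) := by
  obtain ⟨t, rfl⟩ := (GradedTensorProduct.of k 𝒞 𝒞).surjective t
  induction t using TensorProduct.induction_on with
  | zero => simp
  | add x y hx hy => simp only [map_add, hx, hy, add_smul]
  | tmul a b =>
    change koszulMul _ _ (a ᵍ⊗ₜ[k] b) = koszulMul η ζ (a ᵍ⊗ₜ[k] b) • (r * s)
    simp only [koszulMul_tmul, dualTensorLinearEquiv_tmul, smul_mul_smul_comm, add_smul]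

variable [PrimitivelyGenerated 𝒞]

/-- The isomorphism of superalgebras `R ⊗ C^* ≃ Hom(C, R)` for a finite-dimensional `C`. -/
def dualTensorEquiv (𝒞 : ZMod 2 → Submodule k C) [GradedAlgebra 𝒞] [PrimitivelyGenerated 𝒞]
    (R : Type*) [CommRing R] [Algebra k R] [Module.Finite k C] :
    R ⊗[k] SuperHom 𝒞 k ≃ₐ[k] SuperHom 𝒞 R :=
  AlgEquiv.ofLinearEquiv (dualTensorLinearEquiv 𝒞 R)
    (SuperHom.ext fun c => by
      rw [Algebra.TensorProduct.one_def, dualTensorLinearEquiv_tmul, one_apply, one_apply,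
        Algebra.algebraMap_self_apply, ← Algebra.algebraMap_eq_smul_one])
    (fun x y => by
      induction x using TensorProduct.induction_on with
      | zero => rw [zero_mul, map_zero, zero_mul]
      | add x x' hx hx' => rw [add_mul, map_add, map_add, hx, hx', add_mul]
      | tmul r η =>
        induction y using TensorProduct.induction_on with
        | zero => rw [mul_zero, map_zero, mul_zero]
        | add y y' hy hy' => rw [mul_add, map_add, map_add, hy, hy', mul_add]
        | tmul s ζ =>
          refine SuperHom.ext fun c => ?_
          rw [Algebra.TensorProduct.tmul_mul_tmul, dualTensorLinearEquiv_tmul, mul_apply, mul_apply,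
            koszulMul_smul])

variable [Module.Finite k C]

lemma dualTensorEquiv_tmul (r : R) (η : SuperHom 𝒞 k) (c : C) :
    dualTensorEquiv 𝒞 R (r ⊗ₜ[k] η) c = η c • r := dualTensorLinearEquiv_tmul r η c

lemma map_dualTensorEquiv {R' : Type*} [CommRing R'] [Algebra k R'] (φ : R →ₐ[k] R')
    (t : R ⊗[k] SuperHom 𝒞 k) : map φ (dualTensorEquiv 𝒞 R t) =
      dualTensorEquiv 𝒞 R' (Algebra.TensorProduct.map φ (AlgHom.id k _) t) := by
  induction t using TensorProduct.induction_on with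
  | zero => simp only [map_zero]
  | add x y hx hy => simp only [map_add, hx, hy]
  | tmul r η =>
    refine SuperHom.ext fun c => ?_
    rw [map_apply, Algebra.TensorProduct.map_tmul, dualTensorEquiv_tmul, dualTensorEquiv_tmul,
      map_smul]
    rfl

lemma dualTensorEquiv_symm_map {R' : Type*} [CommRing R'] [Algebra k R'] (φ : R →ₐ[k] R')
    (f : SuperHom 𝒞 R) : (dualTensorEquiv 𝒞 R').symm (map φ f) =
      Algebra.TensorProduct.map φ (AlgHom.id k _) ((dualTensorEquiv 𝒞 R).symm f) := by
  rw [AlgEquiv.symm_apply_eq, ← map_dualTensorEquiv, AlgEquiv.apply_symm_apply]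

/-- The component of parity `i` of a linear map. -/
def parityProj (𝒞 : ZMod 2 → Submodule k C) [GradedAlgebra 𝒞] (R : Type*) [CommRing R]
    [Algebra k R] (i : ZMod 2) : SuperHom 𝒞 R →ₗ[k] parity 𝒞 R i where
  toFun f := ⟨mk 𝒞 (f.toLin ∘ₗ (𝒞 i).subtype ∘ₗ gradedProj 𝒞 i), fun j hj c hc => by
    simp [gradedProj_of_ne 𝒞 hc hj]⟩
  map_add' _ _ := rfl
  map_smul' _ _ := rfl

lemma parityProj_apply (i : ZMod 2) (f : SuperHom 𝒞 R) (c : C) :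
    (parityProj 𝒞 R i f).1 c = f (gradedProj 𝒞 i c) := rfl

lemma parityProj_of_mem {i : ZMod 2} {f : SuperHom 𝒞 R} (hf : f ∈ parity 𝒞 R i) :
    (parityProj 𝒞 R i f).1 = f := by
  refine SuperHom.ext fun c => ?_
  rw [parityProj_apply]
  induction c using DirectSum.Decomposition.inductionOn 𝒞 with
  | zero => simp
  | add x y hx hy => rw [map_add, Submodule.coe_add, map_add, map_add, hx, hy]
  | homogeneous c =>
    rename_i j
    by_cases h : j = i
    · subst h; rw [gradedProj_of_mem 𝒞 c.2]
    · rw [gradedProj_of_ne 𝒞 c.2 h, map_zero, hf j h c c.2]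

/-- Taking parity components only involves the factor `C^*`. A homogeneous map therefore comes from
a tensor whose second factors are homogeneous. -/
lemma parityProj_dualTensorEquiv (i : ZMod 2) (t : R ⊗[k] SuperHom 𝒞 k) :
    (parityProj 𝒞 R i (dualTensorEquiv 𝒞 R t)).1 =
      dualTensorEquiv 𝒞 R (LinearMap.lTensor R
        ((parity 𝒞 k i).subtype ∘ₗ parityProj 𝒞 k i) t) := by
  induction t using TensorProduct.induction_on with
  | zero => simp only [map_zero, Submodule.coe_zero]
  | add x y hx hy => simp only [map_add, Submodule.coe_add, hx, hy]
  | tmul r η =>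
    refine SuperHom.ext fun c => ?_
    rw [parityProj_apply, LinearMap.lTensor_tmul, dualTensorEquiv_tmul, dualTensorEquiv_tmul]
    rfl

lemma map_dualTensorEquiv_symm_parity (i : ZMod 2) :
    (parity 𝒞 R i).map (dualTensorEquiv 𝒞 R).symm.toLinearMap =
      LinearMap.range (LinearMap.lTensor R (parity 𝒞 k i).subtype) := by
  refine le_antisymm ?_ ?_
  · rintro _ ⟨f, hf, rfl⟩
    obtain ⟨t, rfl⟩ := (dualTensorEquiv 𝒞 R).surjective f
    refine ⟨LinearMap.lTensor R (parityProj 𝒞 k i) t, ?_⟩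
    refine Eq.trans ?_ ((AlgEquiv.eq_symm_apply _).mpr
      ((parityProj_dualTensorEquiv i t).symm.trans (parityProj_of_mem hf)))
    rw [LinearMap.lTensor_comp, LinearMap.comp_apply]
  · rintro _ ⟨t, rfl⟩
    refine ⟨_, ?_, (dualTensorEquiv 𝒞 R).symm_apply_apply _⟩
    induction t using TensorProduct.induction_on with
    | zero => rw [map_zero, map_zero]; exact zero_mem _
    | add x y hx hy => rw [map_add, map_add]; exact add_mem hx hy
    | tmul r η =>
      intro j hj c hc
      rw [LinearMap.lTensor_tmul, dualTensorEquiv_tmul, Submodule.subtype_apply, η.2 j hj c hc,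
        zero_smul]

end DualTensor

variable {k : Type*} [Field k] {V : Type*} [AddCommGroup V] [Module k V]
  {R : Type*} [CommRing R] [Algebra k R]

/-- The maps `⋀(V) → R` of degree `n`. -/
def HasDegree (F : SuperHom (extParity k V) R) (n : ℤ) : Prop :=
  ∀ m : ℕ, (m : ℤ) ≠ n → ∀ Y ∈ ⋀[k]^m V, F Y = 0

lemma HasDegree.shift_ι {F : SuperHom (extParity k V) R} {n : ℤ} (hF : F.HasDegree n) (v : V) :
    (shift (ι k v) F).HasDegree (n - 1) := fun m hm Y hY =>
  hF (m + 1) (fun h => hm (by push_cast at h; omega)) _ (ι_mul_mem v hY)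

lemma HasDegree.twist {F : SuperHom (extParity k V) R} {n : ℤ} (hF : F.HasDegree n)
    (i : ZMod 2) : (twist i F).HasDegree n := fun m hm Y hY => by
  rw [twist_apply, signTwist_of_mem _ i (exteriorPower_le_extParity m hY), Units.smul_def,
    map_zsmul, hF m hm Y hY, smul_zero]

/-- Translation by an odd vector is a superderivation lowering degrees by one, so induction on the
number of wedge factors reduces the claim to the value at `1`. Degrees may become negative on the
way, which is harmless in `ℤ`. -/
lemma HasDegree.mul {F G : SuperHom (extParity k V) R} {a b : ℤ} (hF : F.HasDegree a)
    (hG : G.HasDegree b) : (F * G).HasDegree (a + b) := by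
  intro m
  induction m generalizing F G a b with
  | zero =>
    intro hm Y hY
    induction hY using exteriorPower_zero_induction with
    | algebraMap c =>
      have h1 : (1 : ExteriorAlgebra k V) ∈ ⋀[k]^0 V := SetLike.GradedOne.one_mem
      rw [Algebra.algebraMap_eq_smul_one, map_smul, mul_apply_one]
      by_cases ha : ((0 : ℕ) : ℤ) = a
      · rw [hG 0 (fun hb => hm (by rw [← ha, ← hb]; rfl)) 1 h1, mul_zero, smul_zero]
      · rw [hF 0 ha 1 h1, zero_mul, smul_zero]
  | succ m ih =>
    intro hm Y hY
    induction hY using exteriorPower_succ_induction with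
    | add x _ y _ hx hy => rw [map_add, hx, hy, add_zero]
    | ι_mul v Y hY =>
      rw [← shift_apply, shift_ι_mul, SuperHom.add_apply,
        ih (hF.shift_ι v) (hG.twist 1) (fun h => hm (by push_cast; omega)) Y hY,
        ih hF (hG.shift_ι v) (fun h => hm (by push_cast; omega)) Y hY, add_zero]

lemma hasDegree_one : (1 : SuperHom (extParity k V) R).HasDegree 0 := fun m hm Y hY => by
  cases m with
  | zero => exact absurd rfl hm
  | succ m =>
    induction hY using exteriorPower_succ_induction with
    | add x _ y _ hx hy => rw [map_add, hx, hy, add_zero]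
    | ι_mul v Y hY =>
      rw [← shift_apply, shift_one (ExteriorAlgebra.lift_ι_apply ..)]
      rfl

/-- The component of degree `n` of a map `⋀(V) → R`. -/
def degreeProj (n : ℕ) (F : SuperHom (extParity k V) R) : SuperHom (extParity k V) R :=
  mk _ (gradedMap fun m => if m = n then F.toLin else 0)

lemma degreeProj_apply (n : ℕ) (F : SuperHom (extParity k V) R) {m : ℕ}
    {Y : ExteriorAlgebra k V} (hY : Y ∈ ⋀[k]^m V) :
    degreeProj n F Y = if m = n then F Y else 0 := by
  rw [degreeProj, mk_apply, gradedMap_of_mem _ hY]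
  split <;> rfl

lemma hasDegree_degreeProj (n : ℕ) (F : SuperHom (extParity k V) R) :
    (degreeProj n F).HasDegree n := fun m hm Y hY => by
  rw [degreeProj_apply n F hY, if_neg fun h => hm (by rw [h])]

lemma sum_degreeProj [FiniteDimensional k V] (F : SuperHom (extParity k V) R) :
    ∑ n ∈ Finset.range (Module.finrank k V + 1), degreeProj n F = F := by
  refine ext_exteriorPower fun p Y hY => ?_
  have e : ∀ s : Finset ℕ, (∑ n ∈ s, degreeProj n F) Y = ∑ n ∈ s, degreeProj n F Y := fun s =>
    LinearMap.sum_apply s (fun n => (degreeProj n F).toLin) Y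
  rw [e]
  simp only [degreeProj_apply _ F hY]
  by_cases h : p ≤ Module.finrank k V
  · rw [Finset.sum_ite_eq, if_pos (Finset.mem_range.mpr (by omega))]
  -- Beyond the dimension of `V` the exterior power is zero, so the omitted components contribute
  -- nothing.
  · have h0 : Module.finrank k (⋀[k]^p V) = 0 := by
      rw [exteriorPower.finrank_eq, Nat.choose_eq_zero_of_lt (by omega)]
    have hY0 : Y = 0 := by
      have := Module.finrank_zero_iff.mp h0
      exact congrArg Subtype.val (Subsingleton.elim (⟨Y, hY⟩ : ⋀[k]^p V) 0)
    simp [hY0]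

end SuperHom

/-! ### The `ℤ`-gradation and the globally split structure. -/

namespace superSections

open ExteriorAlgebra SuperHom SuperUEA

attribute [local instance 100] LieRing.ofAssociativeRing

variable {k : Type*} [Field k] [CharZero k] {𝔤 : Type*} [AddCommGroup 𝔤] [Module k 𝔤]
  [LieSuperalgebra k 𝔤] {R : Type*} [CommRing R] [Algebra k R]
  (δ : superPart k 𝔤 0 →ₗ⁅k⁆ Derivation k R R)

lemma mem_degree_iff {n : ℤ} {f : superSections δ} :
    f ∈ degree δ n ↔ (sectionsEquiv δ f).HasDegree n := Iff.rfl

/-- On `⋀ᵐ` only the component of degree `m` of a sum survives. This makes the components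
recoverable, hence the sum direct. -/
lemma sectionsEquiv_coeLinearMap (x : ⨁ n, degree δ n) {m : ℕ}
    {Y : ExteriorAlgebra k (superPart k 𝔤 1)} (hY : Y ∈ ⋀[k]^m (superPart k 𝔤 1)) :
    sectionsEquiv δ (DirectSum.coeLinearMap (degree δ) x) Y = sectionsEquiv δ (x m).1 Y := by
  induction x using DirectSum.induction_on with
  | zero => rw [map_zero]; rfl
  | add x y hx hy =>
    rw [map_add, map_add, SuperHom.add_apply, hx, hy, DirectSum.add_apply, Submodule.coe_add,
      map_add, SuperHom.add_apply]
  | of n f =>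
    rw [DirectSum.coeLinearMap_of]
    by_cases h : (m : ℤ) = n
    · subst h
      rw [DirectSum.of_eq_same]
    · rw [DirectSum.of_eq_of_ne _ _ _ h]
      exact (f.2 m h Y hY).trans (by rw [Submodule.coe_zero, map_zero]; rfl)

variable [FiniteDimensional k 𝔤]

lemma isInternal_degree : DirectSum.IsInternal (degree δ) := by
  refine ⟨fun x y hxy => ?_, fun f => ?_⟩
  · refine DFinsupp.ext fun n => Subtype.ext ((sectionsEquiv δ).injective ?_)
    refine ext_exteriorPower fun m Y hY => ?_
    by_cases h : (m : ℤ) = n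
    · subst h
      exact (sectionsEquiv_coeLinearMap δ x hY).symm.trans
        ((congrArg (fun f => sectionsEquiv δ f Y) hxy).trans (sectionsEquiv_coeLinearMap δ y hY))
    · exact ((x n).2 m h Y hY).trans ((y n).2 m h Y hY).symm
  -- Homogeneous components are taken on the exterior side and carried back; finitely many suffice
  -- by `sum_degreeProj`, so no negative degree occurs.
  · let c (m : ℕ) : degree δ m := ⟨(sectionsEquiv δ).symm (degreeProj m (sectionsEquiv δ f)), by
      rw [mem_degree_iff, AlgEquiv.apply_symm_apply]
      exact hasDegree_degreeProj m _⟩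
    refine ⟨∑ m ∈ Finset.range (Module.finrank k (superPart k 𝔤 1) + 1),
      DirectSum.of (fun n => degree δ n) (m : ℤ) (c m), (sectionsEquiv δ).injective ?_⟩
    rw [map_sum, map_sum]
    simp only [DirectSum.coeAddMonoidHom_of, c, AlgEquiv.apply_symm_apply]
    exact sum_degreeProj _

lemma nonempty_gradedAlgebra_degree : Nonempty (GradedAlgebra (degree δ)) :=
  ⟨{ one_mem := by
      rw [mem_degree_iff, map_one]
      exact hasDegree_one
     mul_mem := fun m n f g hf hg => by
      rw [mem_degree_iff, map_mul]
      exact HasDegree.mul hf hg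
     toDecomposition := (isInternal_degree δ).chooseDecomposition }⟩

end superSections

namespace superSections

open ExteriorAlgebra SuperHom SuperUEA

attribute [local instance 100] LieRing.ofAssociativeRing

variable {k : Type*} [Field k] [CharZero k] {𝔤 : Type*} [AddCommGroup 𝔤] [Module k 𝔤]
  [LieSuperalgebra k 𝔤] {R : Type*} [CommRing R] [Algebra k R]

lemma degree_le_parity (δ : superPart k 𝔤 0 →ₗ⁅k⁆ Derivation k R R) (n : ℤ) :
    degree δ n ≤ parity δ (n : ZMod 2) := fun f hf => by
  rw [← sectionsEquiv_mem_parity]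
  intro j hj Y hY
  refine extParity_le (S := LinearMap.ker (sectionsEquiv δ f).toLin) (fun p hp Y hY => ?_) hY
  refine hf p (fun h => hj ?_) Y hY
  rw [← hp, ← h, Int.cast_natCast]

lemma map_mem_degree {R' : Type*} [CommRing R'] [Algebra k R']
    {δ : superPart k 𝔤 0 →ₗ⁅k⁆ Derivation k R R} {δ' : superPart k 𝔤 0 →ₗ⁅k⁆ Derivation k R' R'}
    (φ : R →ₐ[k] R') (h : ∀ Z r, φ (δ Z r) = δ' Z (φ r)) {n : ℤ} {f : superSections δ}
    (hf : f ∈ degree δ n) : map φ h f ∈ degree δ' n := fun m hm Y hY =>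
  (congrArg φ (hf m hm Y hY)).trans (map_zero φ)

end superSections

open TopologicalSpace SuperUEA SuperHom in
lemma globallySplit {k : Type*} [Field k] [CharZero k] {𝔤 : Type*} [AddCommGroup 𝔤] [Module k 𝔤]
    [LieSuperalgebra k 𝔤] [FiniteDimensional k 𝔤] {X : Type*} [TopologicalSpace X]
    (O : Opens X → Type*) [∀ U, CommRing (O U)] [∀ U, Algebra k (O U)]
    (δ : ∀ U, superPart k 𝔤 0 →ₗ⁅k⁆ Derivation k (O U) (O U))
    (res : ∀ {U V : Opens X}, V ≤ U → O U →ₐ[k] O V)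
    (hres : ∀ {U V : Opens X} (h : V ≤ U) Z r, res h (δ U Z r) = δ V Z (res h r)) :
    GloballySplit O δ res hres := by
  -- The map from `R ⊗ C^*` to `Hom(C, R)` is shown to be bijective for finite-dimensional `C`; this
  -- is applied to `C = ⋀(𝔤₁)`.
  have : Module.Finite k (ExteriorAlgebra k (superPart k 𝔤 1)) :=
    Module.Finite.of_basis (Module.finBasis k (superPart k 𝔤 1)).ExteriorAlgebra
  refine ⟨fun U => sectionsEquiv (δ U), fun U => (dualTensorEquiv _ (O U)).symm,
    fun U f Y => rfl, fun U r η Y => dualTensorEquiv_tmul r η Y,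
    fun U i => map_sectionsEquiv_parity (δ U) i, fun U i => map_dualTensorEquiv_symm_parity i,
    fun U V h f => rfl, fun U V h f => dualTensorEquiv_symm_map (res h) f,
    fun U => superSections.nonempty_gradedAlgebra_degree (δ U),
    fun U n => superSections.degree_le_parity (δ U) n,
    fun U V h n f hf => superSections.map_mem_degree (res h) (hres h) hf⟩

end

theorem mainTheorem3 :
    (∀ (k : Type*) [Field k] [CharZero k] (𝔤 : Type*) [AddCommGroup 𝔤] [Module k 𝔤]
        [LieSuperalgebra k 𝔤],
      Function.Bijective (gammaHat k 𝔤) ∧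
      ∀ i, (gammaDomainParity k 𝔤 i).map ((gammaHat k 𝔤).restrictScalars k) =
        SuperUEA.gr k 𝔤 i) ∧
    (∀ (𝕜 : Type*) [NontriviallyNormedField 𝕜] [CompleteSpace 𝕜] [CharZero 𝕜] (E : Type*)
        [NormedAddCommGroup E] [NormedSpace 𝕜 E] [CompleteSpace E] (G : Type*) [TopologicalSpace G]
        [ChartedSpace E G] [Group G] [LieGroup 𝓘(𝕜, E) ω G] (𝔤 : Type*) [AddCommGroup 𝔤]
        [Module 𝕜 𝔤] [FiniteDimensional 𝕜 𝔤] [LieSuperalgebra 𝕜 𝔤] (S : AnalyticSHCP 𝕜 E G 𝔤),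
      GloballySplit (X := G) (AnalyticSections 𝕜 E) S.action AnalyticSections.res
        S.res_action) ∧
    (∀ (k : Type*) [Field k] [CharZero k] (A : Type*) [CommRing A] [HopfAlgebra k A]
        [Algebra.FiniteType k A] (𝔤 : Type*) [AddCommGroup 𝔤] [Module k 𝔤]
        [FiniteDimensional k 𝔤] [LieSuperalgebra k 𝔤] (S : AlgebraicSHCP k A 𝔤),
      GloballySplit (X := AlgebraicGeometry.PrimeSpectrum.Top A) (AlgebraicSections A) S.action
        AlgebraicSections.res S.res_action) := by
  refine ⟨fun k _ _ 𝔤 _ _ _ => ⟨SuperUEA.gammaHat_bijective, SuperUEA.map_gammaDomainParity⟩,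
    fun 𝕜 _ _ _ E _ _ _ G _ _ _ _ 𝔤 _ _ _ _ S => globallySplit _ _ _ _,
    fun k _ _ A _ _ _ 𝔤 _ _ _ _ S => globallySplit _ _ _ _⟩
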